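/- Setting. There are $n\ge 1$ clients with differentiable functions $f_1,\dots,f_n:\mathbb R^m\times\mathbb R^d\to\mathbb R$. Let $f=\frac1n\sum_i f_i$, let $G_i=(\nabla_x f_i,-\nabla_y f_i)$ and $G=(\nabla_x f,-\nabla_y f)$, and write $z=(x,y)$. Each $f_i$ is $\beta$-smooth (each of $\nabla_x f_i$, $\nabla_y f_i$ is $\beta$-Lipschitz in $x$ and in $y$ separately) and $\mu$-strongly convex-concave (strongly convex in $x$, strongly concave in $y$, both with modulus $\mu$), where $0<\mu\le\beta$. The clients are $\zeta$-heterogeneous, $\|G_i(z)-G_j(z)\|^2\le\zeta^2$ for all $i,j,z$, with $\zeta\in[0,\infty]$ ($\zeta=\infty$ is arbitrary heterogeneity). Client $i$ has a stochastic oracle $\hat G_i(z,\xi)$, $\xi\sim\mathcal D_i$, that is unbiased for $G_i(z)$ and has variance at most $\sigma^2$ at every $z$. Let $z^*$ be the saddle point of $f$. SCAFFOLD-S, with synchronization probability $p\in(0,1]$, stepsizes $\gamma_l\ge0$, $\gamma_g>0$, and $K$ iterations, starts all clients at $z_i^0=\tilde z^0=z^0$. At iteration $k$, client $i$ draws a fresh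 sample $\xi_i^k\sim\mathcal D_i$ and forms $g_i^k=\hat G_i(z_i^k,\xi_i^k)-\hat G_i(\tilde z^k,\xi_i^k)+G(\tilde z^k)$; then an independent coin is flipped. With probability $1-p$ it shows no synchronization, $z_i^{k+1}=z_i^k-\gamma_l g_i^k$ and $\tilde z^{k+1}=\tilde z^k$. With probability $p$ the clients synchronize: $z_i^{k+1}=\tilde z^{k+1}=\tilde z^k-\gamma_g\frac1n\sum_i\sum_{l=k'}^k g_i^l$, where $k'$ is the first iteration since the last synchronization. The output is $\frac1{W_K}\sum_{k=0}^K w_k\,\frac1n\sum_i z_i^k$ with geometric weights $w_k=\rho^{1-k}$, $0<\rho<1$, and $W_K=\sum_{k=0}^K w_k$. SCAFFOLD-Catalyst-S starts at $\bar z^0$. For $t=0,\dots,T-1$ it lets $\bar z^{t+1}$ be the output of SCAFFOLD-S, started at $\bar z^t$, on the clients $f_i^\theta(x,y)=f_i(x,y)+\frac\theta2\|x-\bar x^t\|^2-\frac\theta2\|y-\bar y^t\|^2$ with oracles $\hat G_i(z,\xi)+\theta(z-\bar z^t)$. It returns $z'=\bar z^T$. Theorem. Let $$B=\min\Big\{\frac{\beta}{\mu},\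 \frac{p\beta^2}{\mu^2}+\frac{p\sigma^2}{n\mu^2\epsilon}+\frac{p^{1/2}\beta\sigma}{\mu^2\epsilon^{1/2}}+\frac{\beta\zeta}{\mu^2\epsilon^{1/2}}\Big\}.$$ There are universal constants $C>0$ and $q\in\mathbb N$ such that for all $n,p,\beta,\mu,\sigma,\zeta$ as above, every $\epsilon>0$ and every $R\ge0$ there are parameters $\theta\ge0,\gamma_l,\gamma_g,\rho,T,K$, depending on these numbers only, such that for all $m,d$, all clients and oracles as above, and every $\bar z^0$ with $\|\bar z^0-z^*\|\le R$, the following hold with $\Lambda=C\log^q\!\big(2+\frac\beta\mu+\frac{R^2}\epsilon\big)$. 1. Every subproblem is solved to the accuracy $\mathbb E\|\bar z^{t+1}-\hat z^{t}\|^2\le\big(\frac{\mu}{2(\theta+\mu)}\big)^2\epsilon$ for $t<T$, where $\hat z^{t}$ is the saddle point of $\frac1n\sum_i f_i^\theta$ in meta-iteration $t$. 2. The output satisfies $\mathbb E\|z'-z^*\|^2\le\epsilon$. 3. The expected number $N$ of synchronizations (communication rounds) in the whole run satisfies $N\le\Lambda B$; and if one further communication per meta-iteration is counted, $T+N\le\Lambda\max\{1,B\}$.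 -/

import Mathlib

open MeasureTheory ProbabilityTheory
open scoped ENNReal

noncomputable section

namespace FedMinimax

/-- The space `ℝᵐ × ℝᵈ` of pairs `z = (x, y)`, with the Euclidean norm
`‖z‖² = ‖x‖² + ‖y‖²`. -/
abbrev Z (m d : ℕ) : Type :=
  WithLp 2 (EuclideanSpace ℝ (Fin m) × EuclideanSpace ℝ (Fin d))

/-- The pair `z = (x, y)`. -/
abbrev mk {m d : ℕ} (x : EuclideanSpace ℝ (Fin m)) (y : EuclideanSpace ℝ (Fin d)) : Z m d :=
  WithLp.toLp 2 (x, y)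

/-! ### Saddle functions -/

/-- The partial gradient `∇ₓ g (x, y)`. -/
def gradX {m d : ℕ} (g : Z m d → ℝ) (x : EuclideanSpace ℝ (Fin m))
    (y : EuclideanSpace ℝ (Fin d)) : EuclideanSpace ℝ (Fin m) :=
  gradient (fun x' => g (mk x' y)) x

/-- The partial gradient `∇_y g (x, y)`. -/
def gradY {m d : ℕ} (g : Z m d → ℝ) (x : EuclideanSpace ℝ (Fin m))
    (y : EuclideanSpace ℝ (Fin d)) : EuclideanSpace ℝ (Fin d) :=
  gradient (fun y' => g (mk x y')) y

/-- The gradient mapping `G(z) = (∇ₓ g(z), -∇_y g(z))`. -/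
def gradMap {m d : ℕ} (g : Z m d → ℝ) (z : Z m d) : Z m d :=
  mk (gradX g z.fst z.snd) (-gradY g z.fst z.snd)

/-- `g` is differentiable and `β`-smooth. -/
structure IsSmooth {m d : ℕ} (β : ℝ) (g : Z m d → ℝ) : Prop where
  differentiable : Differentiable ℝ g
  xx : ∀ x x' y, ‖gradX g x y - gradX g x' y‖ ≤ β * ‖x - x'‖
  yy : ∀ x y y', ‖gradY g x y - gradY g x y'‖ ≤ β * ‖y - y'‖
  xy : ∀ x y y', ‖gradX g x y - gradX g x y'‖ ≤ β * ‖y - y'‖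
  yx : ∀ x x' y, ‖gradY g x y - gradY g x' y‖ ≤ β * ‖x - x'‖

/-- `g` is `μ`-strongly convex-concave. -/
structure IsStronglyConvexConcave {m d : ℕ} (μ : ℝ) (g : Z m d → ℝ) : Prop where
  convex : ∀ x x' y,
    g (mk x' y) ≥ g (mk x y) + inner ℝ (gradX g x y) (x' - x) + μ / 2 * ‖x' - x‖ ^ 2
  concave : ∀ x y y',
    -g (mk x y') ≥ -g (mk x y) + inner ℝ (-gradY g x y) (y' - y) + μ / 2 * ‖y' - y‖ ^ 2

/-- `z = (x*, y*)` is a minimax-optimal point (saddle point) of `g`. -/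
def IsMinimaxOptimal {m d : ℕ} (g : Z m d → ℝ) (z : Z m d) : Prop :=
  ∀ x y, g (mk z.fst y) ≤ g z ∧ g z ≤ g (mk x z.snd)

/-- The average `(1/n) ∑ᵢ vᵢ` over the `n` clients. -/
def avg {n : ℕ} {E : Type*} [AddCommMonoid E] [Module ℝ E] (v : Fin n → E) : E :=
  (n : ℝ)⁻¹ • ∑ i, v i

/-- The global objective `f = (1/n) ∑ᵢ fᵢ`. -/
def global {n m d : ℕ} (f : Fin n → Z m d → ℝ) : Z m d → ℝ :=
  fun z => avg fun i => f i z

/-- The clients are `ζ`-heterogeneous, where `ζ = ∞` is no restriction at all. -/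
def IsHeterogeneous {n m d : ℕ} (ζ : ℝ≥0∞) (f : Fin n → Z m d → ℝ) : Prop :=
  ∀ i j z, ‖gradMap (f i) z - gradMap (f j) z‖ₑ ^ 2 ≤ ζ ^ 2

/-- `Ghat` is an unbiased stochastic oracle, driven by a sample from the distribution `D`,
for the gradient mapping of `g`, with variance at most `σ²` at every point. -/
structure IsOracle {m d : ℕ} {Ξ : Type*} [MeasurableSpace Ξ] (σ : ℝ) (g : Z m d → ℝ)
    (D : Measure Ξ) (Ghat : Z m d → Ξ → Z m d) : Prop where
  measurable : Measurable (Function.uncurry Ghat)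
  integrable : ∀ z, Integrable (Ghat z) D
  unbiased : ∀ z, ∫ ξ, Ghat z ξ ∂D = gradMap g z
  integrable_sq : ∀ z, Integrable (fun ξ => ‖Ghat z ξ - gradMap g z‖ ^ 2) D
  variance_le : ∀ z, ∫ ξ, ‖Ghat z ξ - gradMap g z‖ ^ 2 ∂D ≤ σ ^ 2

/-! ### Regularization -/

/-- The regularized function
`g^θ(x, y) = g(x, y) + (θ/2) ‖x - x̄‖² - (θ/2) ‖y - ȳ‖²` with center `c = (x̄, ȳ)`. -/
def regularize {m d : ℕ} (θ : ℝ) (c : Z m d) (g : Z m d → ℝ) : Z m d → ℝ :=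
  fun z => g z + θ / 2 * ‖z.fst - c.fst‖ ^ 2 - θ / 2 * ‖z.snd - c.snd‖ ^ 2

/-- The stochastic oracle of the regularized function: the (deterministic) gradient mapping
`θ (z - c)` of the regularizer is added to the answer of the given oracle. -/
def regularizeOracle {m d : ℕ} {Ξ : Type*} (θ : ℝ) (c : Z m d) (Ghat : Z m d → Ξ → Z m d) :
    Z m d → Ξ → Z m d :=
  fun z ξ => Ghat z ξ + θ • (z - c)

/-! ### SCAFFOLD-S -/

/-- The state of SCAFFOLD-S at an iteration: the iterates `zᵢ` of the clients, the last
synchronized iterate `z̃`, and for each client the sum of the directions `gᵢ` that it has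
used since the last synchronization. -/
structure ScaffoldState (n m d : ℕ) where
  iter : Fin n → Z m d
  anchor : Z m d
  acc : Fin n → Z m d

/-- The direction `gᵢ = Ĝᵢ(zᵢ) - Ĝᵢ(z̃) + G(z̃)`. Both calls of the stochastic oracle use the
same sample `ξ i`. -/
def scaffoldDir {n m d : ℕ} {Ξ : Type*} (f : Fin n → Z m d → ℝ)
    (Ghat : Fin n → Z m d → Ξ → Z m d) (ξ : Fin n → Ξ) (s : ScaffoldState n m d)
    (i : Fin n) : Z m d :=
  Ghat i (s.iter i) (ξ i) - Ghat i s.anchor (ξ i) + gradMap (global f) s.anchor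

/-- One iteration of SCAFFOLD-S. If the coin `w.1` shows `true`, the clients synchronize:
`z̃` moves by the global stepsize `γg` along the average of the accumulated directions, and all
clients continue from there. Otherwise each client makes a local step with stepsize `γl`. -/
def scaffoldStep {n m d : ℕ} {Ξ : Type*} (f : Fin n → Z m d → ℝ)
    (Ghat : Fin n → Z m d → Ξ → Z m d) (γl γg : ℝ) (w : Bool × (Fin n → Ξ))
    (s : ScaffoldState n m d) : ScaffoldState n m d :=
  let g : Fin n → Z m d := scaffoldDir f Ghat w.2 s
  if w.1 = true then
    let a : Z m d := s.anchor - γg • avg fun i => s.acc i + g i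
    { iter := fun _ => a, anchor := a, acc := fun _ => 0 }
  else
    { iter := fun i => s.iter i - γl • g i, anchor := s.anchor, acc := fun i => s.acc i + g i }

/-- The state of SCAFFOLD-S before iteration `k`, started at `z0` and driven by the coins and
samples `w`. -/
def scaffoldRun {n m d : ℕ} {Ξ : Type*} (f : Fin n → Z m d → ℝ)
    (Ghat : Fin n → Z m d → Ξ → Z m d) (γl γg : ℝ) (z0 : Z m d)
    (w : ℕ → Bool × (Fin n → Ξ)) : ℕ → ScaffoldState n m d
  | 0 => { iter := fun _ => z0, anchor := z0, acc := fun _ => 0 }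
  | k + 1 => scaffoldStep f Ghat γl γg (w k) (scaffoldRun f Ghat γl γg z0 w k)

/-- The output of SCAFFOLD-S after `K` iterations: the weighted average
`(1 / W_K) ∑_{k ≤ K} w_k z^k` of the client means `z^k = (1/n) ∑ᵢ zᵢ^k`, with geometric weights
`w_k = ρ^(1-k)` and `W_K = ∑_{k ≤ K} w_k`. -/
def scaffoldOutput {n m d : ℕ} {Ξ : Type*} (f : Fin n → Z m d → ℝ)
    (Ghat : Fin n → Z m d → Ξ → Z m d) (γl γg ρ : ℝ) (K : ℕ) (z0 : Z m d)
    (w : ℕ → Bool × (Fin n → Ξ)) : Z m d :=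
  (∑ k ∈ Finset.range (K + 1), ρ ^ (1 - (k : ℤ)))⁻¹ •
    ∑ k ∈ Finset.range (K + 1),
      ρ ^ (1 - (k : ℤ)) • avg (scaffoldRun f Ghat γl γg z0 w k).iter

/-! ### SCAFFOLD-Catalyst-S -/

/-- The parameters of SCAFFOLD-Catalyst-S. -/
structure CatalystParams where
  /-- the regularization parameter -/
  θ : ℝ
  /-- the local stepsize -/
  γl : ℝ
  /-- the global stepsize -/
  γg : ℝ
  /-- the base of the averaging weights of SCAFFOLD-S -/
  ρ : ℝ
  /-- the number of meta-iterations -/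
  T : ℕ
  /-- the number of iterations of SCAFFOLD-S in each meta-iteration -/
  K : ℕ
  θ_nonneg : 0 ≤ θ
  γl_nonneg : 0 ≤ γl
  γg_pos : 0 < γg
  ρ_pos : 0 < ρ
  ρ_lt_one : ρ < 1

/-- The meta-iterates `z̄^t` of SCAFFOLD-Catalyst-S, started at `z0`: `z̄^(t+1)` is the output of
SCAFFOLD-S, started at `z̄^t`, on the clients regularized around `z̄^t`. The coin and the samples
of iteration `k` of SCAFFOLD-S in meta-iteration `t` are `w t k`. -/
def catalystIterate {n m d : ℕ} {Ξ : Type*} (f : Fin n → Z m d → ℝ)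
    (Ghat : Fin n → Z m d → Ξ → Z m d) (c : CatalystParams) (z0 : Z m d)
    (w : ℕ → ℕ → Bool × (Fin n → Ξ)) : ℕ → Z m d
  | 0 => z0
  | t + 1 =>
    let zbar : Z m d := catalystIterate f Ghat c z0 w t
    scaffoldOutput (fun i => regularize c.θ zbar (f i))
      (fun i => regularizeOracle c.θ zbar (Ghat i)) c.γl c.γg c.ρ c.K zbar (w t)

/-- The number of synchronizations that SCAFFOLD-Catalyst-S performs in its `c.T`
meta-iterations, each of which runs `c.K` iterations of SCAFFOLD-S. -/
def syncRounds {n : ℕ} {Ξ : Type*} (c : CatalystParams)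
    (w : ℕ → ℕ → Bool × (Fin n → Ξ)) : ℕ :=
  ∑ t ∈ Finset.range c.T, ∑ k ∈ Finset.range c.K, if (w t k).1 = true then 1 else 0

/-- The randomness of the algorithm: for all pairs `(t, k)` independently, a coin that shows
`true` with probability `p`, together with, independently of the coin, independent samples from
the distributions `D i` of the clients. -/
structure IsDriver {n : ℕ} {Ξ Ω : Type*} [MeasurableSpace Ξ] [MeasurableSpace Ω]
    (p : unitInterval) (D : Fin n → Measure Ξ) (P : Measure Ω)
    (W : ℕ → ℕ → Ω → Bool × (Fin n → Ξ)) : Prop where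
  measurable : ∀ t k, Measurable (W t k)
  law : ∀ t k, P.map (W t k) = (bernoulliMeasure true false p).prod (Measure.pi D)
  indep : iIndepFun (fun (q : ℕ × ℕ) => W q.1 q.2) P

/-- The meta-iterate `z̄^t` as a random variable. -/
def metaIterate {n m d : ℕ} {Ξ Ω : Type*} (f : Fin n → Z m d → ℝ)
    (Ghat : Fin n → Z m d → Ξ → Z m d) (c : CatalystParams) (z0 : Z m d)
    (W : ℕ → ℕ → Ω → Bool × (Fin n → Ξ)) (t : ℕ) (ω : Ω) : Z m d :=
  catalystIterate f Ghat c z0 (fun s k => W s k ω) t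

/-- The expected number of synchronizations that SCAFFOLD-Catalyst-S performs. -/
def expectedRounds {n : ℕ} {Ξ Ω : Type*} [MeasurableSpace Ω] (c : CatalystParams)
    (P : Measure Ω) (W : ℕ → ℕ → Ω → Bool × (Fin n → Ξ)) : ℝ≥0∞ :=
  ∫⁻ ω, (syncRounds c (fun s k => W s k ω) : ℝ≥0∞) ∂P

/-! ### The rate -/

/-- The rate `min {β/μ, pβ²/μ² + pσ²/(nμ²ε) + p^(1/2) βσ/(μ² ε^(1/2)) + βζ/(μ² ε^(1/2))}`. -/
def rate (n : ℕ) (p β μ σ : ℝ) (ζ : ℝ≥0∞) (ε : ℝ) : ℝ≥0∞ :=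
  min (ENNReal.ofReal (β / μ))
    (ENNReal.ofReal (p * β ^ 2 / μ ^ 2 + p * σ ^ 2 / (n * μ ^ 2 * ε)
        + √p * β * σ / (μ ^ 2 * √ε))
      + ENNReal.ofReal (β / (μ ^ 2 * √ε)) * ζ)

/-- The factor `C log(2 + β/μ + D²/ε)^q` that is hidden in the notation `Õ`. -/
def logFactor (C : ℝ) (q : ℕ) (β μ ε D : ℝ) : ℝ≥0∞ :=
  ENNReal.ofReal (C * Real.log (2 + β / μ + D ^ 2 / ε) ^ q)

end FedMinimax

end

noncomputable section

namespace FedMinimax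

/-! ### Gradient mappings of averaged and regularized functions. -/

section Calculus

variable {n m d : ℕ}

/-! The rate is a minimum of two terms, and each term is reached by its own parameters. Which term
is smaller depends only on the given numbers, so the parameters can be fixed before the problem is
seen.

Both cases follow the virtual iterate `v`, the point to which the clients would synchronize now. It
moves by `-γg` times the mean direction at every iteration, whatever the coin shows
(`virtualIterate_scaffoldStep`). A synchronization therefore changes nothing but the drift, the mean
squared distance of the clients to `v`, which it resets to zero. The potential `‖v - u‖² + lam *
drift`, with `u` the saddle point of the subproblem, contracts in expectation by a factor `r` up to
an offset `b`: strong monotonicity pulls `v` towards `u`, and the error caused by the drift is paid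
for by the reset of probability `p`.

Rate `β/μ`: take `θ = β` and `γl = 0`. Clients without local steps stay at the anchor, the two
oracle calls in a direction coincide, and noise and heterogeneity cancel exactly. The subproblem has
condition number at most 3, so `b = 0` and `r = 1 - p/576`
(`lintegral_potential_scaffoldStep_zero_le`). A subproblem costs order `log / p` iterations, that is
order `log` synchronizations, and the proximal point iteration, with factor `β/(β+μ)`, needs order
`(β/μ) log` subproblems.

Second term `B` of the rate: take `θ = 0`, `T = 1` and equal stepsizes `γ`. The virtual iterate is
then the mean of the clients and `r = 1 - γμ/2` (`lintegral_potential_scaffoldStep_le`). The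
stationary error `b/(1-r)` is of order `γσ²/(nμ) + (γβσ)²/(μ²p) + (γβζ/(μp))²`. The stepsize `γ =
p/(128μB)` makes every summand a small fraction of `ε` (`stationary_error_le`), and order
`log/(γμ)`, that is `B log / p`, iterations suffice.

To pass from contraction to accuracy, the coin and the samples of an iteration are independent of
the past, so the one-step bound integrates along the run. Averaging weights with base `ρ = r/2` grow
so fast that the weighted average inherits the bound of the last iterate
(`sum_geometric_weights_le`), and `catalyst_recursion` accumulates the errors of the subproblems.
Expectations are kept as `∫⁻` until the end, so that integrability is a conclusion and not a side
condition. -/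

lemma mk_add (x x' : EuclideanSpace ℝ (Fin m)) (y y' : EuclideanSpace ℝ (Fin d)) :
    mk (x + x') (y + y') = mk x y + mk x' y' := rfl

lemma smul_mk (a : ℝ) (x : EuclideanSpace ℝ (Fin m)) (y : EuclideanSpace ℝ (Fin d)) :
    a • mk x y = mk (a • x) (a • y) := rfl

lemma Z.inner_eq (z w : Z m d) :
    inner ℝ z w = inner ℝ z.fst w.fst + inner ℝ z.snd w.snd :=
  WithLp.prod_inner_apply z w

lemma Z.norm_sq_eq (z : Z m d) : ‖z‖ ^ 2 = ‖z.fst‖ ^ 2 + ‖z.snd‖ ^ 2 :=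
  WithLp.prod_norm_sq_eq_of_L2 z

lemma differentiable_mk_left (y : EuclideanSpace ℝ (Fin d)) :
    Differentiable ℝ fun x : EuclideanSpace ℝ (Fin m) => mk x y :=
  (WithLp.prodContinuousLinearEquiv 2 ℝ (EuclideanSpace ℝ (Fin m))
    (EuclideanSpace ℝ (Fin d))).symm.differentiable.comp
    (differentiable_id.prodMk (differentiable_const y))

lemma differentiable_mk_right (x : EuclideanSpace ℝ (Fin m)) :
    Differentiable ℝ fun y : EuclideanSpace ℝ (Fin d) => mk x y :=
  (WithLp.prodContinuousLinearEquiv 2 ℝ (EuclideanSpace ℝ (Fin m))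
    (EuclideanSpace ℝ (Fin d))).symm.differentiable.comp
    ((differentiable_const x).prodMk differentiable_id)

lemma hasGradientAt_gradX {g : Z m d → ℝ} (hg : Differentiable ℝ g)
    (x : EuclideanSpace ℝ (Fin m)) (y : EuclideanSpace ℝ (Fin d)) :
    HasGradientAt (fun x' => g (mk x' y)) (gradX g x y) x :=
  ((hg.comp (differentiable_mk_left y)) x).hasGradientAt

lemma hasGradientAt_gradY {g : Z m d → ℝ} (hg : Differentiable ℝ g)
    (x : EuclideanSpace ℝ (Fin m)) (y : EuclideanSpace ℝ (Fin d)) :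
    HasGradientAt (fun y' => g (mk x y')) (gradY g x y) y :=
  ((hg.comp (differentiable_mk_right x)) y).hasGradientAt

section Gradient

variable {F : Type*} [NormedAddCommGroup F] [InnerProductSpace ℝ F] [CompleteSpace F]

lemma hasGradientAt_avg {u : Fin n → F → ℝ} {u' : Fin n → F} {x : F}
    (h : ∀ i, HasGradientAt (u i) (u' i) x) :
    HasGradientAt (fun x => avg fun i => u i x) (avg u') x := by
  rw [hasGradientAt_iff_hasFDerivAt]
  refine ((HasFDerivAt.fun_sum (u := Finset.univ) fun i _ => (h i).hasFDerivAt).const_smul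
    ((n : ℝ)⁻¹)).congr_fderiv ?_
  ext v
  simp [avg, map_sum]

lemma hasGradientAt_norm_sub_sq (c x : F) (a : ℝ) :
    HasGradientAt (fun x => a / 2 * ‖x - c‖ ^ 2) (a • (x - c)) x := by
  rw [hasGradientAt_iff_hasFDerivAt]
  refine ((((hasFDerivAt_id (𝕜 := ℝ) x).sub_const c).norm_sq).const_mul (a / 2)).congr_fderiv ?_
  ext v
  simp
  ring

lemma hasGradientAt_add {u v : F → ℝ} {u' v' x : F} (hu : HasGradientAt u u' x)
    (hv : HasGradientAt v v' x) : HasGradientAt (fun x => u x + v x) (u' + v') x := by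
  rw [hasGradientAt_iff_hasFDerivAt] at *
  exact (hu.fun_add hv).congr_fderiv (map_add _ _ _).symm

lemma hasGradientAt_sub {u v : F → ℝ} {u' v' x : F} (hu : HasGradientAt u u' x)
    (hv : HasGradientAt v v' x) : HasGradientAt (fun x => u x - v x) (u' - v') x := by
  rw [hasGradientAt_iff_hasFDerivAt] at *
  exact (hu.fun_sub hv).congr_fderiv (map_sub _ _ _).symm

lemma hasGradientAt_add_const {u : F → ℝ} {u' x : F} (hu : HasGradientAt u u' x) (c : ℝ) :
    HasGradientAt (fun x => u x + c) u' x := by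
  rw [hasGradientAt_iff_hasFDerivAt] at *
  exact hu.add_const c

end Gradient

lemma differentiable_global {f : Fin n → Z m d → ℝ} (hf : ∀ i, Differentiable ℝ (f i)) :
    Differentiable ℝ (global f) := by
  have h : Differentiable ℝ fun z => ∑ i, f i z := Differentiable.fun_sum fun i _ => hf i
  exact h.const_smul (n : ℝ)⁻¹

lemma differentiable_regularize {g : Z m d → ℝ} (hg : Differentiable ℝ g) (θ : ℝ) (c : Z m d) :
    Differentiable ℝ (regularize θ c g) := by
  have h1 : Differentiable ℝ fun z : Z m d => z.fst :=
    (WithLp.fstL 2 ℝ (EuclideanSpace ℝ (Fin m)) (EuclideanSpace ℝ (Fin d))).differentiable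
  have h2 : Differentiable ℝ fun z : Z m d => z.snd :=
    (WithLp.sndL 2 ℝ (EuclideanSpace ℝ (Fin m)) (EuclideanSpace ℝ (Fin d))).differentiable
  unfold regularize
  exact (hg.add (((h1.sub_const _).norm_sq ℝ).const_mul _)).sub
    (((h2.sub_const _).norm_sq ℝ).const_mul _)

lemma avg_mk (u : Fin n → EuclideanSpace ℝ (Fin m)) (v : Fin n → EuclideanSpace ℝ (Fin d)) :
    avg (fun i => mk (u i) (v i)) = mk (avg u) (avg v) := by
  have h : ∑ i, mk (u i) (v i) = mk (∑ i, u i) (∑ i, v i) := by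
    have := map_sum (WithLp.prodContinuousLinearEquiv 2 ℝ (EuclideanSpace ℝ (Fin m))
      (EuclideanSpace ℝ (Fin d))).symm (fun i => (u i, v i)) Finset.univ
    have e : ∑ i, (u i, v i) = (∑ i, u i, ∑ i, v i) :=
      Prod.ext (by simp [Prod.fst_sum]) (by simp [Prod.snd_sum])
    rw [e] at this
    exact this.symm
  rw [avg, h, smul_mk]; rfl

lemma gradMap_global {f : Fin n → Z m d → ℝ} (hf : ∀ i, Differentiable ℝ (f i)) (z : Z m d) :
    gradMap (global f) z = avg fun i => gradMap (f i) z := by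
  have hx : gradX (global f) z.fst z.snd = avg fun i => gradX (f i) z.fst z.snd :=
    (hasGradientAt_avg fun i => hasGradientAt_gradX (hf i) z.fst z.snd).gradient
  have hy : gradY (global f) z.fst z.snd = avg fun i => gradY (f i) z.fst z.snd :=
    (hasGradientAt_avg fun i => hasGradientAt_gradY (hf i) z.fst z.snd).gradient
  unfold gradMap
  rw [avg_mk, hx, hy]
  simp [avg]

lemma gradMap_regularize {g : Z m d → ℝ} (hg : Differentiable ℝ g) (θ : ℝ) (c z : Z m d) :
    gradMap (regularize θ c g) z = gradMap g z + θ • (z - c) := by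
  have hx : gradX (regularize θ c g) z.fst z.snd = gradX g z.fst z.snd + θ • (z.fst - c.fst) := by
    have := hasGradientAt_add_const (hasGradientAt_add (hasGradientAt_gradX hg z.fst z.snd)
      (hasGradientAt_norm_sub_sq c.fst z.fst θ)) (-(θ / 2 * ‖z.snd - c.snd‖ ^ 2))
    exact this.gradient
  have hy : gradY (regularize θ c g) z.fst z.snd = gradY g z.fst z.snd - θ • (z.snd - c.snd) := by
    have := hasGradientAt_sub (hasGradientAt_add_const (hasGradientAt_gradY hg z.fst z.snd)
      (θ / 2 * ‖z.fst - c.fst‖ ^ 2)) (hasGradientAt_norm_sub_sq c.snd z.snd θ)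
    exact this.gradient
  have hz : θ • (z - c) = mk (θ • (z.fst - c.fst)) (θ • (z.snd - c.snd)) := rfl
  unfold gradMap
  rw [hx, hy, hz, ← mk_add]
  congr 1
  abel

lemma gradMap_eq_zero_of_isMinimaxOptimal {g : Z m d → ℝ} (hg : Differentiable ℝ g) {z : Z m d}
    (hz : IsMinimaxOptimal g z) : gradMap g z = 0 := by
  have hx : gradX g z.fst z.snd = 0 := by
    have hmin : IsLocalMin (fun x' => g (mk x' z.snd)) z.fst :=
      Filter.Eventually.of_forall fun x => (hz x z.snd).2
    have := hmin.hasFDerivAt_eq_zero (hasGradientAt_gradX hg z.fst z.snd).hasFDerivAt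
    simpa using this
  have hy : gradY g z.fst z.snd = 0 := by
    have hmax : IsLocalMax (fun y' => g (mk z.fst y')) z.snd :=
      Filter.Eventually.of_forall fun y => (hz z.fst y).1
    have := hmax.hasFDerivAt_eq_zero (hasGradientAt_gradY hg z.fst z.snd).hasFDerivAt
    simpa using this
  unfold gradMap
  rw [hx, hy, neg_zero]
  rfl

/-- Smoothness in `x` and `y` separately bounds either block of the difference by `β (a + b)`, with
`a`, `b` the block distances. Since `(a + b)² ≤ 2 (a² + b²)` and there are two blocks, the joint
Lipschitz constant is at most `2β`. -/
lemma IsSmooth.norm_gradMap_sub_le {β : ℝ} {g : Z m d → ℝ} (hβ : 0 ≤ β) (hg : IsSmooth β g)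
    (z w : Z m d) : ‖gradMap g z - gradMap g w‖ ≤ 2 * β * ‖z - w‖ := by
  have hx : ‖gradX g z.fst z.snd - gradX g w.fst w.snd‖
      ≤ β * ‖z.fst - w.fst‖ + β * ‖z.snd - w.snd‖ := by
    calc _ = ‖(gradX g z.fst z.snd - gradX g w.fst z.snd)
          + (gradX g w.fst z.snd - gradX g w.fst w.snd)‖ := by congr 1; abel
      _ ≤ _ := (norm_add_le _ _).trans (add_le_add (hg.xx _ _ _) (hg.xy _ _ _))
  have hy : ‖gradY g z.fst z.snd - gradY g w.fst w.snd‖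
      ≤ β * ‖z.fst - w.fst‖ + β * ‖z.snd - w.snd‖ := by
    calc _ = ‖(gradY g z.fst z.snd - gradY g w.fst z.snd)
          + (gradY g w.fst z.snd - gradY g w.fst w.snd)‖ := by congr 1; abel
      _ ≤ _ := (norm_add_le _ _).trans (add_le_add (hg.yx _ _ _) (hg.yy _ _ _))
  have h1 : ‖gradMap g z - gradMap g w‖ ^ 2 = ‖gradX g z.fst z.snd - gradX g w.fst w.snd‖ ^ 2
      + ‖gradY g z.fst z.snd - gradY g w.fst w.snd‖ ^ 2 := by
    rw [Z.norm_sq_eq]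
    congr 2
    change ‖-gradY g z.fst z.snd - -gradY g w.fst w.snd‖ = _
    rw [← neg_sub_neg, norm_sub_rev]; congr 1; abel
  have h2 : ‖z - w‖ ^ 2 = ‖z.fst - w.fst‖ ^ 2 + ‖z.snd - w.snd‖ ^ 2 := Z.norm_sq_eq _
  refine abs_le_of_sq_le_sq' ?_ (by positivity) |>.2
  rw [h1, mul_pow, h2]
  have h3 := pow_le_pow_left₀ (norm_nonneg _) hx 2
  have h4 := pow_le_pow_left₀ (norm_nonneg _) hy 2
  nlinarith [mul_nonneg (sq_nonneg β) (sq_nonneg (‖z.fst - w.fst‖ - ‖z.snd - w.snd‖))]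

/-- Summing the two convexity and the two concavity inequalities between `z` and `w` cancels all
function values, those at the mixed points included, and leaves strong monotonicity. -/
lemma IsStronglyConvexConcave.inner_gradMap_sub_ge {μ : ℝ} {g : Z m d → ℝ}
    (hg : IsStronglyConvexConcave μ g) (z w : Z m d) :
    μ * ‖z - w‖ ^ 2 ≤ inner ℝ (gradMap g z - gradMap g w) (z - w) := by
  have h1 := hg.convex z.fst w.fst z.snd
  have h2 := hg.convex w.fst z.fst w.snd
  have h3 := hg.concave z.fst z.snd w.snd
  have h4 := hg.concave w.fst w.snd z.snd
  have h5 : inner ℝ (gradMap g z - gradMap g w) (z - w)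
      = inner ℝ (gradX g z.fst z.snd - gradX g w.fst w.snd) (z.fst - w.fst)
        + inner ℝ (-gradY g z.fst z.snd - -gradY g w.fst w.snd) (z.snd - w.snd) := Z.inner_eq _ _
  have h6 : ‖z - w‖ ^ 2 = ‖z.fst - w.fst‖ ^ 2 + ‖z.snd - w.snd‖ ^ 2 := Z.norm_sq_eq _
  rw [h5, h6]
  rw [← neg_sub z.fst w.fst, norm_neg, inner_neg_right] at h1
  rw [← neg_sub z.snd w.snd, norm_neg, inner_neg_right] at h3
  rw [inner_sub_left, inner_sub_left]
  linarith

end Calculus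

/-! ### Averages over the clients. -/

section Average

variable {n : ℕ} {F : Type*} [NormedAddCommGroup F] [InnerProductSpace ℝ F]

lemma avg_add (u v : Fin n → F) : (avg fun i => u i + v i) = avg u + avg v := by
  simp [avg, Finset.sum_add_distrib]

lemma avg_sub (u v : Fin n → F) : (avg fun i => u i - v i) = avg u - avg v := by
  simp [avg, Finset.sum_sub_distrib, smul_sub]

lemma avg_smul (a : ℝ) (u : Fin n → F) : (avg fun i => a • u i) = a • avg u := by
  simp [avg, ← Finset.smul_sum, smul_comm a]

lemma avg_const (hn : 0 < n) (c : F) : (avg fun _ : Fin n => c) = c := by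
  have : (n : ℝ) ≠ 0 := by positivity
  simp [avg, ← Nat.cast_smul_eq_nsmul ℝ, this]

lemma avg_mul (a : ℝ) (u : Fin n → ℝ) : (avg fun i => a * u i) = a * avg u := avg_smul a u

lemma avg_mono {u v : Fin n → ℝ} (h : ∀ i, u i ≤ v i) : avg u ≤ avg v :=
  smul_le_smul_of_nonneg_left (Finset.sum_le_sum fun i _ => h i) (by positivity)

lemma avg_nonneg {u : Fin n → ℝ} (h : ∀ i, 0 ≤ u i) : 0 ≤ avg u :=
  smul_nonneg (by positivity) (Finset.sum_nonneg fun i _ => h i)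

lemma norm_avg_le (v : Fin n → F) : ‖avg v‖ ≤ avg fun i => ‖v i‖ := by
  rw [avg, norm_smul, avg, smul_eq_mul, Real.norm_of_nonneg (by positivity)]
  gcongr
  exact norm_sum_le _ _

/-- The mean minimizes the average squared distance. -/
lemma avg_norm_sub_avg_sq_le (hn : 0 < n) (v : Fin n → F) (w : F) :
    (avg fun i => ‖v i - avg v‖ ^ 2) ≤ avg fun i => ‖v i - w‖ ^ 2 := by
  have h : ∀ i, ‖v i - w‖ ^ 2 = ‖v i - avg v‖ ^ 2 + 2 * inner ℝ (v i - avg v) (avg v - w)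
      + ‖avg v - w‖ ^ 2 := fun i => by
    rw [← norm_add_sq_real]; congr 2; abel
  have h0 : ∑ i, (v i - avg v) = 0 := by
    have : (n : ℝ) ≠ 0 := by positivity
    have h1 : (avg fun i => v i - avg v) = 0 := by rw [avg_sub, avg_const hn, sub_self]
    simpa [avg, this] using h1
  have h1 : ∑ i, ‖v i - avg v‖ ^ 2 ≤ ∑ i, ‖v i - w‖ ^ 2 := by
    simp_rw [h, Finset.sum_add_distrib, ← Finset.mul_sum, ← sum_inner, h0, inner_zero_left]
    have : 0 ≤ ∑ _i : Fin n, ‖avg v - w‖ ^ 2 := by positivity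
    linarith
  exact smul_le_smul_of_nonneg_left h1 (by positivity)

lemma norm_avg_sq_le (hn : 0 < n) (v : Fin n → F) : ‖avg v‖ ^ 2 ≤ avg fun i => ‖v i‖ ^ 2 := by
  have h : ∀ i, ‖v i - avg v‖ ^ 2 = ‖v i‖ ^ 2 - 2 * inner ℝ (v i) (avg v) + ‖avg v‖ ^ 2 :=
    fun i => norm_sub_sq_real _ _
  have h0 : 0 ≤ avg fun i => ‖v i - avg v‖ ^ 2 := avg_nonneg fun i => by positivity
  have h1 : (avg fun i => ‖v i - avg v‖ ^ 2) = (avg fun i => ‖v i‖ ^ 2) - ‖avg v‖ ^ 2 := by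
    simp_rw [h]
    rw [avg_add (fun i => ‖v i‖ ^ 2 - 2 * inner ℝ (v i) (avg v)), avg_sub, avg_const hn, avg_mul]
    have : (avg fun i => inner ℝ (v i) (avg v)) = ‖avg v‖ ^ 2 := by
      rw [← real_inner_self_eq_norm_sq]
      conv_rhs => rw [avg, inner_smul_left, sum_inner]
      simp [avg]
    rw [this]; ring
  linarith

lemma norm_add_sq_le_two {E : Type*} [NormedAddCommGroup E] (a b : E) : ‖a + b‖ ^ 2 ≤ 2 * ‖a‖ ^ 2 + 2 * ‖b‖ ^ 2 := by
  have := norm_add_le a b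
  nlinarith [sq_nonneg (‖a‖ - ‖b‖), norm_nonneg (a + b)]

lemma norm_add_sq_le_young {E : Type*} [NormedAddCommGroup E] (a b : E) {t : ℝ} (ht : 0 < t) :
    ‖a + b‖ ^ 2 ≤ (1 + t) * ‖a‖ ^ 2 + (1 + 1 / t) * ‖b‖ ^ 2 := by
  have h1 : ‖a + b‖ ^ 2 ≤ (‖a‖ + ‖b‖) ^ 2 := by gcongr; exact norm_add_le a b
  have h2 : (1 + t) * ‖a‖ ^ 2 + (1 + 1 / t) * ‖b‖ ^ 2 - (‖a‖ + ‖b‖) ^ 2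
      = (t * ‖a‖ - ‖b‖) ^ 2 / t := by field_simp; ring
  have : 0 ≤ (t * ‖a‖ - ‖b‖) ^ 2 / t := by positivity
  linarith

end Average

/-! ### Strongly monotone Lipschitz operators and their resolvents. -/

section Monotone

variable {F : Type*} [NormedAddCommGroup F] [InnerProductSpace ℝ F]

lemma norm_gradientStep_sub_sq_le {A : F → F} {L μ γ : ℝ} (hγ : 0 ≤ γ)
    (hL : ∀ z w, ‖A z - A w‖ ≤ L * ‖z - w‖)
    (hμ : ∀ z w, μ * ‖z - w‖ ^ 2 ≤ inner ℝ (A z - A w) (z - w)) (z w : F) :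
    ‖(z - γ • A z) - (w - γ • A w)‖ ^ 2 ≤ (1 - 2 * γ * μ + γ ^ 2 * L ^ 2) * ‖z - w‖ ^ 2 := by
  have h1 : (z - γ • A z) - (w - γ • A w) = (z - w) - γ • (A z - A w) := by module
  rw [h1, norm_sub_sq_real, inner_smul_right, real_inner_comm, norm_smul, mul_pow,
    Real.norm_of_nonneg hγ]
  have h2 := mul_le_mul_of_nonneg_left (hμ z w) hγ
  have h3 := mul_le_mul_of_nonneg_left (pow_le_pow_left₀ (norm_nonneg _) (hL z w) 2) (sq_nonneg γ)
  rw [mul_pow] at h3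
  linarith

/-- A strongly monotone Lipschitz operator has a zero. -/
lemma exists_zero_of_stronglyMonotone [CompleteSpace F] {A : F → F} {L μ : ℝ} (hμ0 : 0 < μ)
    (hμL : μ ≤ L) (hL : ∀ z w, ‖A z - A w‖ ≤ L * ‖z - w‖)
    (hμ : ∀ z w, μ * ‖z - w‖ ^ 2 ≤ inner ℝ (A z - A w) (z - w)) : ∃ z, A z = 0 := by
  have hL0 : 0 < L := hμ0.trans_le hμL
  -- This stepsize minimizes `1 - 2γμ + γ²L²`; the minimum `1 - μ²/L²` is nonnegative because `μ ≤
  -- L`.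
  set γ := μ / L ^ 2 with hγ
  have hγ0 : 0 < γ := by positivity
  set k := Real.sqrt (1 - μ ^ 2 / L ^ 2)
  have hk : k < 1 := by
    rw [Real.sqrt_lt' one_pos]
    have : 0 < μ ^ 2 / L ^ 2 := by positivity
    linarith
  have hk2 : k ^ 2 = 1 - μ ^ 2 / L ^ 2 := Real.sq_sqrt (by
    rw [sub_nonneg, div_le_one (by positivity)]; gcongr)
  have hc : ContractingWith ⟨k, Real.sqrt_nonneg _⟩ fun z => z - γ • A z := by
    refine ⟨by exact_mod_cast hk, LipschitzWith.of_dist_le_mul fun z w => ?_⟩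
    rw [dist_eq_norm, dist_eq_norm]
    refine abs_le_of_sq_le_sq' ?_ (mul_nonneg (Real.sqrt_nonneg _) (norm_nonneg _)) |>.2
    refine (norm_gradientStep_sub_sq_le hγ0.le hL hμ z w).trans_eq ?_
    change _ = (k * ‖z - w‖) ^ 2
    rw [mul_pow, hk2, hγ]
    field_simp
    ring
  refine ⟨ContractingWith.fixedPoint _ hc, ?_⟩
  have := hc.fixedPoint_isFixedPt
  have h := sub_eq_self.1 this
  exact (smul_eq_zero.1 h).resolve_left hγ0.ne'

/-- Subtract the two equations and pair with `z - w`: the result is `(θ + μ) ‖z - w‖² ≤ θ ⟪c - e, z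
- w⟫`. Equal centers give uniqueness of the proximal point, and a zero of `A`, which is its own
proximal point, gives the contraction of the proximal point iteration. -/
lemma resolvent_norm_sub_le {A : F → F} {μ θ : ℝ} (hμ0 : 0 < μ) (hθ : 0 ≤ θ)
    (hμ : ∀ z w, μ * ‖z - w‖ ^ 2 ≤ inner ℝ (A z - A w) (z - w)) {z w c e : F}
    (hz : A z + θ • (z - c) = 0) (hw : A w + θ • (w - e) = 0) :
    ‖z - w‖ ≤ θ / (θ + μ) * ‖c - e‖ := by
  have h1 : A z - A w = θ • (c - e) - θ • (z - w) := by
    have hz' := eq_neg_of_add_eq_zero_left hz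
    have hw' := eq_neg_of_add_eq_zero_left hw
    rw [hz', hw']; module
  have h2 := hμ z w
  rw [h1, inner_sub_left, inner_smul_left, inner_smul_left, real_inner_self_eq_norm_sq] at h2
  simp only [conj_trivial] at h2
  have h3 := mul_le_mul_of_nonneg_left (real_inner_le_norm (c - e) (z - w)) hθ
  rw [div_mul_eq_mul_div, le_div_iff₀ (by positivity)]
  rcases (norm_nonneg (z - w)).eq_or_lt with h0 | h0
  · rw [← h0, zero_mul]; positivity
  · refine le_of_mul_le_mul_right ?_ h0
    linarith

end Monotone

/-! ### Deterministic estimates for one step. -/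

section OneStep

variable {n : ℕ} {F : Type*} [NormedAddCommGroup F] [InnerProductSpace ℝ F]

lemma norm_avg_sub_sq_le (hn : 0 < n) {A : Fin n → F → F} {L : ℝ}
    (hL : ∀ i z w, ‖A i z - A i w‖ ≤ L * ‖z - w‖) (z : Fin n → F) (v : F) :
    ‖avg (fun i => A i (z i)) - avg (fun i => A i v)‖ ^ 2
      ≤ L ^ 2 * avg fun i => ‖z i - v‖ ^ 2 := by
  rw [← avg_sub, ← avg_mul]
  refine (norm_avg_sq_le hn _).trans (avg_mono fun i => ?_)
  rw [← mul_pow]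
  exact pow_le_pow_left₀ (norm_nonneg _) (hL i _ _) 2

lemma norm_avg_operator_sub_le (hn : 0 < n) {A : Fin n → F → F} {L : ℝ}
    (hL : ∀ i z w, ‖A i z - A i w‖ ≤ L * ‖z - w‖) (z w : F) :
    ‖avg (fun i => A i z) - avg (fun i => A i w)‖ ≤ L * ‖z - w‖ := by
  rw [← avg_sub, ← avg_const hn (L * ‖z - w‖)]
  exact (norm_avg_le _).trans (avg_mono fun i => hL i _ _)

lemma inner_avg_operator_sub_ge (hn : 0 < n) {A : Fin n → F → F} {μ : ℝ}
    (hμ : ∀ i z w, μ * ‖z - w‖ ^ 2 ≤ inner ℝ (A i z - A i w) (z - w)) (z w : F) :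
    μ * ‖z - w‖ ^ 2 ≤ inner ℝ (avg (fun i => A i z) - avg (fun i => A i w)) (z - w) := by
  rw [← avg_sub, ← avg_const hn (μ * ‖z - w‖ ^ 2), avg, avg, inner_smul_left, sum_inner]
  exact mul_le_mul_of_nonneg_left (Finset.sum_le_sum fun i _ => hμ i z w) (by simp)

/-- One step along the mean direction from the virtual iterate `v`, when client `i` evaluates
its operator at `z i`. -/
lemma norm_meanStep_sub_sq_le (hn : 0 < n) {A : Fin n → F → F} {L μ γ : ℝ} (hμ0 : 0 < μ)
    (hμL : μ ≤ L) (hγ0 : 0 ≤ γ) (hγ : γ ≤ μ / (4 * L ^ 2))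
    (hL : ∀ i z w, ‖A i z - A i w‖ ≤ L * ‖z - w‖)
    (hμ : ∀ i z w, μ * ‖z - w‖ ^ 2 ≤ inner ℝ (A i z - A i w) (z - w))
    {u : F} (hu : avg (fun i => A i u) = 0) (z : Fin n → F) (v : F) :
    ‖v - γ • avg (fun i => A i (z i)) - u‖ ^ 2
      ≤ (1 - γ * μ / 2) * ‖v - u‖ ^ 2
        + 2 * γ * L ^ 2 / μ * avg fun i => ‖z i - v‖ ^ 2 := by
  have hL0 : 0 < L := hμ0.trans_le hμL
  have hδ := norm_avg_sub_sq_le hn hL z v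
  set h := avg fun i => A i (z i)
  set a := avg fun i => A i v with ha
  set D := avg fun i => ‖z i - v‖ ^ 2
  have hD : 0 ≤ D := avg_nonneg fun i => by positivity
  have h1 := inner_avg_operator_sub_ge hn hμ v u
  have h2 := norm_avg_operator_sub_le hn hL v u
  rw [hu, sub_zero, ← ha] at h1 h2
  have e1 : v - γ • h - u = (v - u) - γ • h := by abel
  have e2 : inner ℝ (v - u) h = inner ℝ a (v - u) + inner ℝ (h - a) (v - u) := by
    rw [← inner_add_left, add_sub_cancel, real_inner_comm]
  have h3 : -(‖h - a‖ * ‖v - u‖) ≤ inner ℝ (h - a) (v - u) :=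
    (abs_le.1 (abs_real_inner_le_norm _ _)).1
  -- Young's inequality: half of the strong monotonicity pays for evaluating the operators away from
  -- `v`.
  have h4 : ‖h - a‖ * ‖v - u‖ ≤ μ / 2 * ‖v - u‖ ^ 2 + L ^ 2 / (2 * μ) * D := by
    have : ‖h - a‖ ^ 2 / (2 * μ) ≤ L ^ 2 / (2 * μ) * D := by
      rw [div_mul_eq_mul_div]; gcongr
    refine le_trans ?_ (add_le_add_right this _)
    have e : μ / 2 * ‖v - u‖ ^ 2 + ‖h - a‖ ^ 2 / (2 * μ) - ‖h - a‖ * ‖v - u‖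
        = (μ * ‖v - u‖ - ‖h - a‖) ^ 2 / (2 * μ) := by field_simp; ring
    have : 0 ≤ (μ * ‖v - u‖ - ‖h - a‖) ^ 2 / (2 * μ) := by positivity
    linarith
  have h5 : ‖h‖ ^ 2 ≤ 2 * L ^ 2 * ‖v - u‖ ^ 2 + 2 * L ^ 2 * D := by
    have := norm_add_sq_le_two a (h - a)
    rw [add_sub_cancel] at this
    have h2' := pow_le_pow_left₀ (norm_nonneg _) h2 2
    rw [mul_pow] at h2'
    linarith
  -- The stepsize bound lets the remaining half absorb the quadratic term.
  have h6 : 2 * γ ^ 2 * L ^ 2 ≤ γ * μ / 2 := by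
    rw [le_div_iff₀ (by positivity)] at hγ
    nlinarith
  have h7 : γ * μ / 2 ≤ γ * L ^ 2 / μ := by
    rw [div_le_div_iff₀ two_pos hμ0]
    have : μ * μ ≤ L ^ 2 * 2 := by nlinarith
    nlinarith
  rw [e1, norm_sub_sq_real, inner_smul_right, norm_smul, mul_pow, Real.norm_of_nonneg hγ0, e2]
  have h8 : γ * (μ / 2 * ‖v - u‖ ^ 2 - L ^ 2 / (2 * μ) * D)
      ≤ γ * (inner ℝ a (v - u) + inner ℝ (h - a) (v - u)) := by
    gcongr; linarith
  have h9 := mul_le_mul_of_nonneg_left h5 (sq_nonneg γ)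
  have h10 := mul_le_mul_of_nonneg_right h6 (sq_nonneg ‖v - u‖)
  have h11 := mul_le_mul_of_nonneg_right (h6.trans h7) hD
  have e3 : 2 * γ * L ^ 2 / μ * D = 2 * (γ * (L ^ 2 / (2 * μ) * D)) + γ * L ^ 2 / μ * D := by
    field_simp; ring
  rw [e3]
  linarith

/-- One local step of a client, compared with the step of the virtual iterate `v` along the
mean operator. The vector `b` measures the heterogeneity of the clients. -/
lemma norm_localStep_sub_sq_le {A : F → F} {L μ γ ζ p : ℝ} (hμ0 : 0 < μ)
    (hγ0 : 0 ≤ γ) (hγ : γ ≤ μ / (4 * L ^ 2)) (hL0 : 0 < L) (hp0 : 0 < p)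
    (hL : ∀ z w, ‖A z - A w‖ ≤ L * ‖z - w‖)
    (hμ : ∀ z w, μ * ‖z - w‖ ^ 2 ≤ inner ℝ (A z - A w) (z - w))
    (z v b : F) (hb : ‖b‖ ≤ 2 * ζ) :
    ‖(z - v) - γ • (A z - A v + b)‖ ^ 2
      ≤ (1 - γ * μ + p / 2) * ‖z - v‖ ^ 2 + (8 / p + 8) * (γ ^ 2 * ζ ^ 2) := by
  rw [norm_sub_sq_real, inner_smul_right, norm_smul, mul_pow, Real.norm_of_nonneg hγ0,
    inner_add_right, real_inner_comm]
  have h1 := hμ z v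
  have h2 : -(‖z - v‖ * ‖b‖) ≤ inner ℝ (z - v) b := (abs_le.1 (abs_real_inner_le_norm _ _)).1
  have h2' : ‖z - v‖ * ‖b‖ ≤ ‖z - v‖ * (2 * ζ) := by gcongr
  have h3 := norm_add_sq_le_two (A z - A v) b
  have h4 := pow_le_pow_left₀ (norm_nonneg _) (hL z v) 2
  have h5 := pow_le_pow_left₀ (norm_nonneg _) hb 2
  rw [mul_pow] at h4 h5
  have h6 : 2 * γ ^ 2 * L ^ 2 ≤ γ * μ := by
    rw [le_div_iff₀ (by positivity)] at hγ
    nlinarith [mul_nonneg hγ0 hμ0.le]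
  have h7 := mul_le_mul_of_nonneg_right h6 (sq_nonneg ‖z - v‖)
  -- The weight `p / 2` is the growth that the drift can afford: a synchronization removes the drift
  -- with probability `p`.
  have h8 : 4 * γ * ζ * ‖z - v‖ ≤ p / 2 * ‖z - v‖ ^ 2 + 8 / p * (γ ^ 2 * ζ ^ 2) := by
    have e : p / 2 * ‖z - v‖ ^ 2 + 8 / p * (γ ^ 2 * ζ ^ 2) - 4 * γ * ζ * ‖z - v‖
      = (p * ‖z - v‖ - 4 * γ * ζ) ^ 2 / (2 * p) := by field_simp; ring
    have : 0 ≤ (p * ‖z - v‖ - 4 * γ * ζ) ^ 2 / (2 * p) := by positivity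
    linarith
  have h9 := mul_le_mul_of_nonneg_left (h1.trans_eq (real_inner_comm _ _)) hγ0
  have h10 : γ * -(‖z - v‖ * (2 * ζ)) ≤ γ * inner ℝ (z - v) b := by gcongr; linarith
  have h11 : γ ^ 2 * ‖A z - A v + b‖ ^ 2
      ≤ γ ^ 2 * (2 * (L ^ 2 * ‖z - v‖ ^ 2) + 2 * (2 ^ 2 * ζ ^ 2)) := by gcongr; linarith
  have h12 := real_inner_comm (A z - A v) (z - v)
  nlinarith

end OneStep

/-! ### Centered noise and its average over independent clients. -/

section Noise

variable {F : Type*} [NormedAddCommGroup F] [InnerProductSpace ℝ F]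

/-- `e` is a centered square-integrable random vector with second moment at most `s`. -/
structure IsNoise {Ξ : Type*} [MeasurableSpace Ξ] (D : Measure Ξ) (s : ℝ) (e : Ξ → F) : Prop where
  integrable : Integrable e D
  centered : ∫ ξ, e ξ ∂D = 0
  integrable_sq : Integrable (fun ξ => ‖e ξ‖ ^ 2) D
  sq_le : ∫ ξ, ‖e ξ‖ ^ 2 ∂D ≤ s

variable {Ξ : Type*} [MeasurableSpace Ξ]

lemma IsNoise.integral_norm_sub_smul_sq_le [CompleteSpace F] {D : Measure Ξ} [IsProbabilityMeasure D] {s : ℝ}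
    {e : Ξ → F} (he : IsNoise D s e) (a : F) (γ : ℝ) :
    Integrable (fun ξ => ‖a - γ • e ξ‖ ^ 2) D ∧
      ∫ ξ, ‖a - γ • e ξ‖ ^ 2 ∂D ≤ ‖a‖ ^ 2 + γ ^ 2 * s := by
  have h1 : ∀ ξ, ‖a - γ • e ξ‖ ^ 2 = ‖a‖ ^ 2 - 2 * γ * inner ℝ a (e ξ) + γ ^ 2 * ‖e ξ‖ ^ 2 :=
    fun ξ => by
      rw [norm_sub_sq_real, inner_smul_right, norm_smul, mul_pow, Real.norm_eq_abs, sq_abs]; ring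
  have i1 : Integrable (fun ξ => inner ℝ a (e ξ)) D := he.integrable.const_inner a
  have i2 : Integrable (fun ξ => ‖a‖ ^ 2 - 2 * γ * inner ℝ a (e ξ)) D :=
    (integrable_const _).sub (i1.const_mul _)
  have i3 : Integrable (fun ξ => γ ^ 2 * ‖e ξ‖ ^ 2) D := he.integrable_sq.const_mul _
  simp_rw [h1]
  refine ⟨i2.add i3, ?_⟩
  rw [integral_add i2 i3, integral_sub (integrable_const _) (i1.const_mul _),
    integral_const_mul, integral_const_mul, integral_inner he.integrable, he.centered]
  simp only [inner_zero_right, mul_zero, sub_zero, integral_const, probReal_univ, one_smul]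
  gcongr
  exact he.sq_le

lemma IsNoise.comp_measurePreserving {Ξ' : Type*} [MeasurableSpace Ξ'] {D : Measure Ξ}
    {D' : Measure Ξ'} {s : ℝ} {e : Ξ → F} (he : IsNoise D s e) {φ : Ξ' → Ξ}
    (hφ : MeasurePreserving φ D' D) : IsNoise D' s fun ξ => e (φ ξ) := by
  refine ⟨hφ.integrable_comp_of_integrable he.integrable, ?_,
    hφ.integrable_comp_of_integrable he.integrable_sq, ?_⟩
  · rw [← he.centered, ← hφ.map_eq, integral_map hφ.aemeasurable]
    rw [hφ.map_eq]
    exact he.integrable.1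
  · refine le_of_eq_of_le ?_ he.sq_le
    conv_rhs => rw [← hφ.map_eq]
    rw [integral_map hφ.aemeasurable]
    rw [hφ.map_eq]
    exact he.integrable_sq.1

/-- In the double sum for the squared norm, independence of the samples kills the off-diagonal
terms. The `n` diagonal terms, scaled by `1/n²`, give the speedup `1/n`. -/
lemma IsNoise.avg [CompleteSpace F] {n : ℕ} (hn : 0 < n) {D : Fin n → Measure Ξ} [∀ i, IsProbabilityMeasure (D i)]
    {s : ℝ} {e : Fin n → Ξ → F} (he : ∀ i, IsNoise (D i) s (e i)) :
    IsNoise (Measure.pi D) (s / n) fun ξ => FedMinimax.avg fun i => e i (ξ i) := by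
  have hmp : ∀ i, MeasurePreserving (fun ξ : Fin n → Ξ => ξ i) (Measure.pi D) (D i) :=
    fun i => measurePreserving_eval D i
  have h : ∀ i, IsNoise (Measure.pi D) s fun ξ : Fin n → Ξ => e i (ξ i) := fun i =>
    (he i).comp_measurePreserving (hmp i)
  have i3 : ∀ i j, Integrable (fun ξ : Fin n → Ξ => inner ℝ (e i (ξ i)) (e j (ξ j)))
      (Measure.pi D) := fun i j => by
    refine ((h i).integrable_sq.add (h j).integrable_sq).mono' ((h i).integrable.1.inner (h j).integrable.1)
      (Filter.Eventually.of_forall fun ξ => ?_)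
    refine (norm_inner_le_norm _ _).trans ?_
    simp only [Pi.add_apply]
    nlinarith [sq_nonneg (‖e i (ξ i)‖ - ‖e j (ξ j)‖), sq_nonneg ‖e i (ξ i)‖,
      sq_nonneg ‖e j (ξ j)‖]
  have c3 : ∀ i j, i ≠ j →
      ∫ ξ : Fin n → Ξ, inner ℝ (e i (ξ i)) (e j (ξ j)) ∂Measure.pi D = 0 := fun i j hij => by
    have hind : IndepFun (fun ξ : Fin n → Ξ => ξ i) (fun ξ => ξ j) (Measure.pi D) :=
      (iIndepFun_pi (X := fun _ ξ => ξ) fun i => aemeasurable_id).indepFun hij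
    have := hind.integral_bilin_comp_comp (f := e i) (g := e j) (hmp i).aemeasurable
      (hmp j).aemeasurable
      (by rw [(hmp i).map_eq]; exact (he i).integrable)
      (by rw [(hmp j).map_eq]; exact (he j).integrable) (innerSL ℝ)
    refine Eq.trans this ?_
    rw [(h i).centered]
    exact inner_zero_left _
  have hsq : ∀ ξ : Fin n → Ξ, ‖FedMinimax.avg fun i => e i (ξ i)‖ ^ 2
      = ((n : ℝ)⁻¹) ^ 2 * ∑ i, ∑ j, inner ℝ (e i (ξ i)) (e j (ξ j)) := fun ξ => by
    rw [FedMinimax.avg, norm_smul, mul_pow, Real.norm_eq_abs, sq_abs,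
      ← real_inner_self_eq_norm_sq, sum_inner]
    simp_rw [inner_sum]
  have i4 : Integrable (fun ξ : Fin n → Ξ => ∑ i, ∑ j, inner ℝ (e i (ξ i)) (e j (ξ j)))
      (Measure.pi D) :=
    integrable_finsetSum _ fun i _ => integrable_finsetSum _ fun j _ => i3 i j
  refine ⟨?_, ?_, ?_, ?_⟩
  · exact (integrable_finsetSum _ fun i _ => (h i).integrable).smul _
  · simp only [FedMinimax.avg]
    rw [integral_smul, integral_finsetSum _ fun i _ => (h i).integrable]
    simp [fun i => (h i).centered]
  · simp_rw [hsq]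
    exact i4.const_mul _
  · simp_rw [hsq]
    rw [integral_const_mul, integral_finsetSum _ fun i _ => integrable_finsetSum _ fun j _ => i3 i j]
    have : ∀ i, ∫ ξ : Fin n → Ξ, ∑ j, inner ℝ (e i (ξ i)) (e j (ξ j)) ∂Measure.pi D ≤ s :=
      fun i => by
        rw [integral_finsetSum _ fun j _ => i3 i j, Finset.sum_eq_single i]
        · simpa only [real_inner_self_eq_norm_sq] using (h i).sq_le
        · exact fun j _ hj => c3 i j hj.symm
        · simp
    have hn' : (0 : ℝ) < n := by positivity
    calc _ ≤ ((n : ℝ)⁻¹) ^ 2 * ∑ _i : Fin n, s := by gcongr; exact this _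
      _ = s / n := by simp; field_simp

end Noise

/-- Both calls use the same sample, so their errors are not independent. Only `‖a - b‖² ≤ 2‖a‖² +
2‖b‖²` is available, which is the source of the factor 4. -/
lemma IsOracle.isNoise_sub {m d : ℕ} {Ξ : Type*} [MeasurableSpace Ξ] {σ : ℝ} {g : Z m d → ℝ}
    {D : Measure Ξ} [IsProbabilityMeasure D] {Ghat : Z m d → Ξ → Z m d}
    (h : IsOracle σ g D Ghat) (z w : Z m d) :
    IsNoise D (4 * σ ^ 2)
      fun ξ => (Ghat z ξ - gradMap g z) - (Ghat w ξ - gradMap g w) := by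
  have i1 : ∀ z, Integrable (fun ξ => Ghat z ξ - gradMap g z) D := fun z =>
    (h.integrable z).sub (integrable_const _)
  have c1 : ∀ z, ∫ ξ, (Ghat z ξ - gradMap g z) ∂D = 0 := fun z => by
    rw [integral_sub (h.integrable z) (integrable_const _), h.unbiased]; simp
  have hle : ∀ ξ, ‖(Ghat z ξ - gradMap g z) - (Ghat w ξ - gradMap g w)‖ ^ 2
      ≤ 2 * ‖Ghat z ξ - gradMap g z‖ ^ 2 + 2 * ‖Ghat w ξ - gradMap g w‖ ^ 2 := fun ξ => by
    rw [sub_eq_add_neg, ← norm_neg (Ghat w ξ - gradMap g w)]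
    exact norm_add_sq_le_two _ _
  have i2 : Integrable (fun ξ => 2 * ‖Ghat z ξ - gradMap g z‖ ^ 2
      + 2 * ‖Ghat w ξ - gradMap g w‖ ^ 2) D :=
    ((h.integrable_sq z).const_mul 2).add ((h.integrable_sq w).const_mul 2)
  have i3 : Integrable (fun ξ => ‖(Ghat z ξ - gradMap g z) - (Ghat w ξ - gradMap g w)‖ ^ 2) D :=
    i2.mono' (((i1 z).sub (i1 w)).1.norm.pow 2) (Filter.Eventually.of_forall fun ξ => by
      rw [Real.norm_of_nonneg (by positivity)]; exact hle ξ)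
  refine ⟨(i1 z).sub (i1 w), ?_, i3, ?_⟩
  · rw [integral_sub (i1 z) (i1 w), c1, c1, sub_zero]
  · refine (integral_mono i3 i2 hle).trans ?_
    rw [integral_add ((h.integrable_sq z).const_mul 2) ((h.integrable_sq w).const_mul 2),
      integral_const_mul, integral_const_mul]
    linarith [h.variance_le z, h.variance_le w]

lemma lintegral_bernoulli_prod {Ξ : Type*} [MeasurableSpace Ξ] {D : Measure Ξ} [SFinite D]
    (p : unitInterval) {φ : Bool × Ξ → ℝ≥0∞} (hφ : Measurable φ) :
    ∫⁻ w, φ w ∂((bernoulliMeasure true false p).prod D)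
      = ENNReal.ofReal p * ∫⁻ ξ, φ (true, ξ) ∂D
        + ENNReal.ofReal (1 - p) * ∫⁻ ξ, φ (false, ξ) ∂D := by
  rw [lintegral_prod _ hφ.aemeasurable, bernoulliMeasure_def, lintegral_add_measure,
    lintegral_smul_measure, lintegral_smul_measure, lintegral_dirac, lintegral_dirac]
  congr 2
  · exact (Real.toNNReal_of_nonneg p.2.1).symm
  · exact (Real.toNNReal_of_nonneg (sub_nonneg.2 p.2.2)).symm

/-! ### Measurability of the run in the center and the randomness. -/

section Measurability

variable {n m d : ℕ}

instance : MeasurableSpace (ScaffoldState n m d) :=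
  MeasurableSpace.comap (fun s => (s.iter, s.anchor, s.acc)) inferInstance

lemma measurable_scaffoldState : Measurable fun s : ScaffoldState n m d =>
    (s.iter, s.anchor, s.acc) :=
  comap_measurable _

lemma ScaffoldState.measurable_iter (i : Fin n) :
    Measurable fun s : ScaffoldState n m d => s.iter i :=
  (measurable_pi_apply i).comp (measurable_fst.comp measurable_scaffoldState)

lemma ScaffoldState.measurable_anchor : Measurable (ScaffoldState.anchor (n := n) (m := m) (d := d)) :=
  measurable_fst.comp (measurable_snd.comp measurable_scaffoldState)

lemma ScaffoldState.measurable_acc (i : Fin n) :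
    Measurable fun s : ScaffoldState n m d => s.acc i :=
  (measurable_pi_apply i).comp (measurable_snd.comp (measurable_snd.comp measurable_scaffoldState))

variable {Ω : Type*} [MeasurableSpace Ω]

lemma ScaffoldState.measurable_mk {a : Ω → Fin n → Z m d} {b : Ω → Z m d} {c : Ω → Fin n → Z m d}
    (ha : ∀ i, Measurable fun ω => a ω i) (hb : Measurable b)
    (hc : ∀ i, Measurable fun ω => c ω i) :
    Measurable fun ω => (⟨a ω, b ω, c ω⟩ : ScaffoldState n m d) :=
  measurable_comap_iff.2 ((measurable_pi_lambda _ ha).prodMk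
    (hb.prodMk (measurable_pi_lambda _ hc)))

lemma measurable_avg {E : Type*} [NormedAddCommGroup E] [NormedSpace ℝ E] [MeasurableSpace E]
    [BorelSpace E] [SecondCountableTopology E] {v : Ω → Fin n → E}
    (hv : ∀ i, Measurable fun ω => v ω i) : Measurable fun ω => avg (v ω) := by
  unfold avg
  exact (Finset.measurable_fun_sum _ fun i _ => hv i).const_smul _

lemma gradMap_global_regularize (hn : 0 < n) {f : Fin n → Z m d → ℝ}
    (hf : ∀ i, Differentiable ℝ (f i)) (θ : ℝ) (c z : Z m d) :
    gradMap (global fun i => regularize θ c (f i)) z = gradMap (global f) z + θ • (z - c) := by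
  rw [gradMap_global (fun i => differentiable_regularize (hf i) θ c), gradMap_global hf]
  simp_rw [gradMap_regularize (hf _)]
  rw [avg_add, avg_const hn]

variable {Ξ : Type*} [MeasurableSpace Ξ]

/-- The center `c` is random, because it is a previous meta-iterate. Writing the regularized
gradient mapping as `G z + θ (z - c)` makes it jointly measurable in `z` and `c`. The σ-algebra on
`Ω` is arbitrary, so that the one generated by the past can be inserted. -/
lemma measurable_scaffoldStep (hn : 0 < n) {f : Fin n → Z m d → ℝ}
    (hf : ∀ i, Differentiable ℝ (f i)) (hG : Measurable (gradMap (global f)))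
    {Ghat : Fin n → Z m d → Ξ → Z m d} (hGhat : ∀ i, Measurable (Function.uncurry (Ghat i)))
    (θ γl γg : ℝ) {c : Ω → Z m d} {s : Ω → ScaffoldState n m d} {w : Ω → Bool × (Fin n → Ξ)}
    (hc : Measurable c) (hs : Measurable s) (hw : Measurable w) :
    Measurable fun ω => scaffoldStep (fun i => regularize θ (c ω) (f i))
      (fun i => regularizeOracle θ (c ω) (Ghat i)) γl γg (w ω) (s ω) := by
  have hi : ∀ i, Measurable fun ω => (s ω).iter i := fun i =>
    (ScaffoldState.measurable_iter i).comp hs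
  have ha : Measurable fun ω => (s ω).anchor := ScaffoldState.measurable_anchor.comp hs
  have hacc : ∀ i, Measurable fun ω => (s ω).acc i := fun i =>
    (ScaffoldState.measurable_acc i).comp hs
  have hξ : ∀ i, Measurable fun ω => (w ω).2 i := fun i =>
    (measurable_pi_apply i).comp (measurable_snd.comp hw)
  have ho : ∀ (i : Fin n) {z : Ω → Z m d}, Measurable z → Measurable fun ω =>
      regularizeOracle θ (c ω) (Ghat i) (z ω) ((w ω).2 i) := fun i z hz => by
    unfold regularizeOracle
    exact ((hGhat i).comp (hz.prodMk (hξ i))).add ((hz.sub hc).const_smul θ)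
  have hdir : ∀ i, Measurable fun ω => scaffoldDir (fun i => regularize θ (c ω) (f i))
      (fun i => regularizeOracle θ (c ω) (Ghat i)) (w ω).2 (s ω) i := fun i => by
    unfold scaffoldDir
    simp_rw [gradMap_global_regularize hn hf]
    exact ((ho i (hi i)).sub (ho i ha)).add ((hG.comp ha).add ((ha.sub hc).const_smul θ))
  have hb : MeasurableSet {ω | (w ω).1 = true} :=
    (measurable_fst.comp hw) (measurableSet_singleton true)
  have hsum : ∀ i, Measurable fun ω => (s ω).acc i + scaffoldDir
      (fun i => regularize θ (c ω) (f i)) (fun i => regularizeOracle θ (c ω) (Ghat i))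
      (w ω).2 (s ω) i := fun i => (hacc i).add (hdir i)
  have hnew : Measurable fun ω => (s ω).anchor - γg • avg fun i => (s ω).acc i + scaffoldDir
      (fun i => regularize θ (c ω) (f i)) (fun i => regularizeOracle θ (c ω) (Ghat i))
      (w ω).2 (s ω) i := ha.sub ((measurable_avg hsum).const_smul γg)
  exact Measurable.ite hb
    (ScaffoldState.measurable_mk (fun _ => hnew) hnew fun _ => measurable_const)
    (ScaffoldState.measurable_mk (fun i => (hi i).sub ((hdir i).const_smul γl)) ha
      hsum)

lemma measurable_scaffoldRun (hn : 0 < n) {f : Fin n → Z m d → ℝ}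
    (hf : ∀ i, Differentiable ℝ (f i)) (hG : Measurable (gradMap (global f)))
    {Ghat : Fin n → Z m d → Ξ → Z m d} (hGhat : ∀ i, Measurable (Function.uncurry (Ghat i)))
    (θ γl γg : ℝ) {c : Ω → Z m d} {w : ℕ → Ω → Bool × (Fin n → Ξ)}
    (hc : Measurable c) (k : ℕ) (hw : ∀ j < k, Measurable (w j)) :
    Measurable fun ω => scaffoldRun (fun i => regularize θ (c ω) (f i))
      (fun i => regularizeOracle θ (c ω) (Ghat i)) γl γg (c ω) (fun j => w j ω) k := by
  induction k with
  | zero => exact ScaffoldState.measurable_mk (fun _ => hc) hc fun _ => measurable_const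
  | succ k ih =>
    exact measurable_scaffoldStep hn hf hG hGhat θ γl γg hc
      (ih fun j hj => hw j (hj.trans k.lt_succ_self)) (hw k k.lt_succ_self)

lemma measurable_catalystIterate (hn : 0 < n) {f : Fin n → Z m d → ℝ}
    (hf : ∀ i, Differentiable ℝ (f i)) (hG : Measurable (gradMap (global f)))
    {Ghat : Fin n → Z m d → Ξ → Z m d} (hGhat : ∀ i, Measurable (Function.uncurry (Ghat i)))
    (c : CatalystParams) (z0 : Z m d) {W : ℕ → ℕ → Ω → Bool × (Fin n → Ξ)} (t : ℕ)
    (hW : ∀ s < t, ∀ j, Measurable (W s j)) :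
    Measurable fun ω => catalystIterate f Ghat c z0 (fun s k => W s k ω) t := by
  induction t with
  | zero => exact measurable_const
  | succ t ih =>
    have ih := ih fun s hs => hW s (hs.trans t.lt_succ_self)
    have h : ∀ k, Measurable fun ω =>
        avg (scaffoldRun (fun i => regularize c.θ (catalystIterate f Ghat c z0
          (fun s k => W s k ω) t) (f i)) (fun i => regularizeOracle c.θ (catalystIterate f Ghat c z0
          (fun s k => W s k ω) t) (Ghat i)) c.γl c.γg (catalystIterate f Ghat c z0
          (fun s k => W s k ω) t) (fun j => W t j ω) k).iter := fun k =>
      measurable_avg fun i => (ScaffoldState.measurable_iter i).comp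
        (measurable_scaffoldRun hn hf hG hGhat c.θ c.γl c.γg ih k fun j _ =>
          hW t t.lt_succ_self j)
    have h' : Measurable fun ω => ∑ k ∈ Finset.range (c.K + 1), c.ρ ^ (1 - (k : ℤ)) •
        avg (scaffoldRun (fun i => regularize c.θ (catalystIterate f Ghat c z0
          (fun s k => W s k ω) t) (f i)) (fun i => regularizeOracle c.θ (catalystIterate f Ghat c z0
          (fun s k => W s k ω) t) (Ghat i)) c.γl c.γg (catalystIterate f Ghat c z0
          (fun s k => W s k ω) t) (fun j => W t j ω) k).iter :=
      Finset.measurable_fun_sum _ fun k _ =>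
        (measurable_const_smul (c.ρ ^ (1 - (k : ℤ)))).comp (h k)
    exact (measurable_const_smul (∑ k ∈ Finset.range (c.K + 1), c.ρ ^ (1 - (k : ℤ)))⁻¹).comp h'

end Measurability

/-! ### Independence of past and present. -/

section Independence

variable {Ω : Type*} [MeasurableSpace Ω] {P : Measure Ω}

lemma indepFun_of_measurable_iSup_comap {ι S T : Type*} [MeasurableSpace S] [mT : MeasurableSpace T]
    {V : ι → Ω → S} (hind : iIndepFun V P) (hV : ∀ q, Measurable (V q)) {A : Set ι} {q : ι}
    (hq : q ∉ A) {X : Ω → T}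
    (hX : Measurable[⨆ q ∈ A, MeasurableSpace.comap (V q) inferInstance] X) :
    IndepFun X (V q) P := by
  have h := indep_iSup_of_disjoint (fun q => (hV q).comap_le) hind
    (Set.disjoint_singleton_right.2 hq)
  rw [iSup_singleton] at h
  exact (IndepFun_iff_Indep _ _ _).2 (indep_of_indep_of_le_left h hX.comap_le)

/-- The freezing lemma: independence makes the joint law a product, so the fresh variable is
integrated with the past held fixed. -/
lemma IndepFun.lintegral_comp_prodMk [IsProbabilityMeasure P] {S T : Type*} [MeasurableSpace S]
    [MeasurableSpace T] {X : Ω → T} {Y : Ω → S} (h : IndepFun X Y P) (hX : Measurable X)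
    (hY : Measurable Y) {φ : T × S → ℝ≥0∞} (hφ : Measurable φ) :
    ∫⁻ ω, φ (X ω, Y ω) ∂P = ∫⁻ ω, ∫⁻ y, φ (X ω, y) ∂(P.map Y) ∂P := by
  have : IsProbabilityMeasure (P.map Y) := Measure.isProbabilityMeasure_map hY.aemeasurable
  have : IsProbabilityMeasure (P.map X) := Measure.isProbabilityMeasure_map hX.aemeasurable
  rw [← lintegral_map hφ (hX.prodMk hY),
    (indepFun_iff_map_prod_eq_prod_map_map hX.aemeasurable hY.aemeasurable).1 h,
    lintegral_prod _ hφ.aemeasurable, lintegral_map hφ.lintegral_prod_right' hX]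

end Independence

/-! ### The potential and its contraction in one iteration. -/

section Potential

variable {n m d : ℕ} {Ξ : Type*}

/-- The virtual iterate: the point to which the clients would synchronize now. -/
def virtualIterate (γg : ℝ) (s : ScaffoldState n m d) : Z m d := s.anchor - γg • avg s.acc

/-- The mean squared distance of the clients to the virtual iterate. -/
def clientDrift (γg : ℝ) (s : ScaffoldState n m d) : ℝ :=
  avg fun i => ‖s.iter i - virtualIterate γg s‖ ^ 2

/-- The potential of SCAFFOLD-S with respect to the target `u`. -/
def potential (γg lam : ℝ) (u : Z m d) (s : ScaffoldState n m d) : ℝ :=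
  ‖virtualIterate γg s - u‖ ^ 2 + lam * clientDrift γg s

lemma clientDrift_nonneg (γg : ℝ) (s : ScaffoldState n m d) : 0 ≤ clientDrift γg s :=
  avg_nonneg fun _ => by positivity

lemma potential_nonneg {γg lam : ℝ} (hlam : 0 ≤ lam) (u : Z m d) (s : ScaffoldState n m d) :
    0 ≤ potential γg lam u s :=
  add_nonneg (by positivity) (mul_nonneg hlam (clientDrift_nonneg _ _))

lemma Measurable.potential {Ω : Type*} [MeasurableSpace Ω] {γg lam : ℝ} {u : Ω → Z m d}
    {s : Ω → ScaffoldState n m d} (hu : Measurable u) (hs : Measurable s) :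
    Measurable fun ω => potential γg lam (u ω) (s ω) := by
  have hv : Measurable fun ω => virtualIterate γg (s ω) :=
    (ScaffoldState.measurable_anchor.comp hs).sub
      ((measurable_const_smul γg).comp (measurable_avg fun i =>
        (ScaffoldState.measurable_acc i).comp hs))
  have hi : ∀ i, Measurable fun ω => ‖(s ω).iter i - virtualIterate γg (s ω)‖ ^ 2 := fun i =>
    (((ScaffoldState.measurable_iter i).comp hs).sub hv).norm.pow_const 2
  exact ((hv.sub hu).norm.pow_const 2).add ((measurable_avg hi).const_mul lam)

/-- The invariant that a client deviates from the last synchronized iterate by its accumulated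
directions. -/
def IsConsistent (γl : ℝ) (s : ScaffoldState n m d) : Prop :=
  ∀ i, s.iter i = s.anchor - γl • s.acc i

lemma isConsistent_scaffoldStep (F : Fin n → Z m d → ℝ) (Gh : Fin n → Z m d → Ξ → Z m d)
    (γl γg : ℝ) (w : Bool × (Fin n → Ξ)) {s : ScaffoldState n m d} (hs : IsConsistent γl s) :
    IsConsistent γl (scaffoldStep F Gh γl γg w s) := by
  intro i
  unfold scaffoldStep
  split_ifs
  · simp
  · simp only [hs i]; module

lemma isConsistent_scaffoldRun (F : Fin n → Z m d → ℝ) (Gh : Fin n → Z m d → Ξ → Z m d)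
    (γl γg : ℝ) (z0 : Z m d) (w : ℕ → Bool × (Fin n → Ξ)) (k : ℕ) :
    IsConsistent γl (scaffoldRun F Gh γl γg z0 w k) := by
  induction k with
  | zero => intro i; simp [scaffoldRun]
  | succ k ih => exact isConsistent_scaffoldStep F Gh γl γg (w k) ih

lemma potential_init (γg lam : ℝ) (u z0 : Z m d) :
    potential γg lam u (⟨fun _ => z0, z0, fun _ => 0⟩ : ScaffoldState n m d) = ‖z0 - u‖ ^ 2 := by
  simp [potential, clientDrift, virtualIterate, avg]

/-- The coin does not enter: a synchronization moves the anchor to the point at which the virtual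
iterate already is. -/
lemma virtualIterate_scaffoldStep (F : Fin n → Z m d → ℝ) (Gh : Fin n → Z m d → Ξ → Z m d)
    (γl γg : ℝ) (w : Bool × (Fin n → Ξ)) (s : ScaffoldState n m d) :
    virtualIterate γg (scaffoldStep F Gh γl γg w s)
      = virtualIterate γg s - γg • avg (scaffoldDir F Gh w.2 s) := by
  unfold virtualIterate scaffoldStep
  split_ifs
  · simp only [avg_add]; simp [avg]; module
  · simp only [avg_add]; module

lemma clientDrift_scaffoldStep_true (F : Fin n → Z m d → ℝ) (Gh : Fin n → Z m d → Ξ → Z m d)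
    (γl γg : ℝ) (ξ : Fin n → Ξ) (s : ScaffoldState n m d) :
    clientDrift γg (scaffoldStep F Gh γl γg (true, ξ) s) = 0 := by
  simp [clientDrift, virtualIterate, scaffoldStep, avg]

/-- Clients whose gradient mappings are Lipschitz and strongly monotone. -/
structure IsRegularFamily (L μ : ℝ) (F : Fin n → Z m d → ℝ) : Prop where
  lipschitz : ∀ i z w, ‖gradMap (F i) z - gradMap (F i) w‖ ≤ L * ‖z - w‖
  monotone : ∀ i z w, μ * ‖z - w‖ ^ 2 ≤ inner ℝ (gradMap (F i) z - gradMap (F i) w) (z - w)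
  gradMap_global : ∀ z, gradMap (global F) z = avg fun i => gradMap (F i) z

/-- The mean of the direction `scaffoldDir` over the samples. -/
def meanDir (F : Fin n → Z m d → ℝ) (s : ScaffoldState n m d) (i : Fin n) : Z m d :=
  gradMap (F i) (s.iter i) - gradMap (F i) s.anchor + gradMap (global F) s.anchor

/-- The noise of the direction `scaffoldDir`. -/
def noiseDir (F : Fin n → Z m d → ℝ) (Gh : Fin n → Z m d → Ξ → Z m d) (s : ScaffoldState n m d)
    (i : Fin n) (ξ : Ξ) : Z m d :=
  (Gh i (s.iter i) ξ - gradMap (F i) (s.iter i)) - (Gh i s.anchor ξ - gradMap (F i) s.anchor)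

lemma scaffoldDir_eq (F : Fin n → Z m d → ℝ) (Gh : Fin n → Z m d → Ξ → Z m d)
    (ξ : Fin n → Ξ) (s : ScaffoldState n m d) (i : Fin n) :
    scaffoldDir F Gh ξ s i = meanDir F s i + noiseDir F Gh s i (ξ i) := by
  unfold scaffoldDir meanDir noiseDir; abel

variable {F : Fin n → Z m d → ℝ} {Gh : Fin n → Z m d → Ξ → Z m d} {L μ : ℝ}

/-- The corrections `G(z̃) - Gᵢ(z̃)` have mean zero over the clients. -/
lemma IsRegularFamily.avg_meanDir (hF : IsRegularFamily L μ F) (hn : 0 < n)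
    (s : ScaffoldState n m d) :
    avg (meanDir F s) = avg fun i => gradMap (F i) (s.iter i) := by
  unfold meanDir
  rw [avg_add (fun i => gradMap (F i) (s.iter i) - gradMap (F i) s.anchor), avg_sub,
    avg_const hn, hF.gradMap_global]
  abel

lemma lintegral_ofReal_le_of_integral_le {Ω : Type*} [MeasurableSpace Ω] {P : Measure Ω}
    {φ ψ : Ω → ℝ} {B : ℝ} (hle : ∀ ω, φ ω ≤ ψ ω) (h0 : ∀ ω, 0 ≤ ψ ω) (hψ : Integrable ψ P)
    (hB : ∫ ω, ψ ω ∂P ≤ B) : ∫⁻ ω, ENNReal.ofReal (φ ω) ∂P ≤ ENNReal.ofReal B := by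
  calc _ ≤ ∫⁻ ω, ENNReal.ofReal (ψ ω) ∂P :=
        lintegral_mono fun ω => ENNReal.ofReal_le_ofReal (hle ω)
    _ = ENNReal.ofReal (∫ ω, ψ ω ∂P) :=
        (ofReal_integral_eq_lintegral_ofReal hψ (Filter.Eventually.of_forall h0)).symm
    _ ≤ _ := ENNReal.ofReal_le_ofReal hB

/-- Here `X` is the squared error of the virtual iterate, `y` the drift, and `a = γμ`. The
coefficient `(1 - p)(1 - a + p/2)` of the drift is at most `1 - p/4 - a/2`. The spare `p/4` pays for
the drift term in the recursion of `X`, and `a/2` gives the drift the same decay as `X`. -/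
lemma coin_average_le {p a lam X S H V y : ℝ} (hp : 0 < p) (ha0 : 0 ≤ a)
    (ha : a ≤ 1 / 4) (hlam : 0 ≤ lam) (hy : 0 ≤ y) (hH : 0 ≤ H) (hV : 0 ≤ V) :
    p * ((1 - a / 2) * X + lam * (p / 4) * y + S)
        + (1 - p) * ((1 - a / 2) * X + lam * (p / 4) * y + S
          + lam * ((1 - a + p / 2) * y + (8 / p + 8) * H + V))
      ≤ (1 - a / 2) * (X + lam * y) + (S + lam * (16 * H / p + V)) := by
  have h1 : (1 - p) * (1 - a + p / 2) ≤ 1 - p / 4 - a / 2 := by nlinarith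
  have h2 : (1 - p) * (8 / p + 8) ≤ 16 / p := by
    rw [le_div_iff₀ hp]
    have : (1 - p) * (8 / p + 8) * p = 8 * (1 - p) * (1 + p) := by field_simp
    rw [this]; nlinarith
  have h3 : (1 - p) * V ≤ V := mul_le_of_le_one_left hV (by linarith)
  have h4 : (1 - p) * ((1 - a + p / 2) * y + (8 / p + 8) * H + V)
      ≤ (1 - p / 4 - a / 2) * y + 16 * H / p + V := by
    calc _ = (1 - p) * (1 - a + p / 2) * y + (1 - p) * (8 / p + 8) * H + (1 - p) * V := by ring
      _ ≤ (1 - p / 4 - a / 2) * y + 16 / p * H + V := by gcongr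
      _ = _ := by ring
  have h5 := mul_le_mul_of_nonneg_left h4 hlam
  calc _ = (1 - a / 2) * X + lam * (p / 4) * y + S
        + lam * ((1 - p) * ((1 - a + p / 2) * y + (8 / p + 8) * H + V)) := by ring
    _ ≤ (1 - a / 2) * X + lam * (p / 4) * y + S
        + lam * ((1 - p / 4 - a / 2) * y + 16 * H / p + V) := by gcongr
    _ = _ := by ring

/-- The expected potential after one step of SCAFFOLD-S, when all stepsizes agree. -/
lemma lintegral_potential_scaffoldStep_le [MeasurableSpace Ξ] (hn : 0 < n) {D : Fin n → Measure Ξ}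
    [∀ i, IsProbabilityMeasure (D i)] {σ ζ γ : ℝ} (p : unitInterval) (hp : 0 < (p : ℝ))
    (hF : IsRegularFamily L μ F) (hμ0 : 0 < μ) (hμL : μ ≤ L)
    (hζ : ∀ i j z, ‖gradMap (F i) z - gradMap (F j) z‖ ≤ ζ)
    (hO : ∀ i, IsOracle σ (F i) (D i) (Gh i)) (hγ0 : 0 ≤ γ) (hγ : γ ≤ μ / (4 * L ^ 2))
    {u : Z m d} (hu : gradMap (global F) u = 0) {s : ScaffoldState n m d}
    (hs : IsConsistent γ s)
    (hmeas : Measurable fun w => potential γ (8 * γ * L ^ 2 / (μ * p)) u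
      (scaffoldStep F Gh γ γ w s)) :
    ∫⁻ w, ENNReal.ofReal (potential γ (8 * γ * L ^ 2 / (μ * p)) u (scaffoldStep F Gh γ γ w s))
        ∂((bernoulliMeasure true false p).prod (Measure.pi D))
      ≤ ENNReal.ofReal ((1 - γ * μ / 2) * potential γ (8 * γ * L ^ 2 / (μ * p)) u s
        + (4 * γ ^ 2 * σ ^ 2 / n + 8 * γ * L ^ 2 / (μ * p)
          * (16 * γ ^ 2 * ζ ^ 2 / p + 4 * γ ^ 2 * σ ^ 2))) := by
  have hL0 : 0 < L := hμ0.trans_le hμL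
  set lam := 8 * γ * L ^ 2 / (μ * p) with hlam
  have hlam0 : 0 ≤ lam := by positivity
  set v := virtualIterate γ s with hv
  have hN : ∀ i, IsNoise (D i) (4 * σ ^ 2) (noiseDir F Gh s i) := fun i =>
    (hO i).isNoise_sub _ _
  have hNavg := IsNoise.avg hn hN
  have hNi : ∀ i, IsNoise (Measure.pi D) (4 * σ ^ 2)
      fun ξ : Fin n → Ξ => noiseDir F Gh s i (ξ i) := fun i =>
    (hN i).comp_measurePreserving (measurePreserving_eval D i)
  -- the virtual iterate
  set a := v - γ • avg (meanDir F s) - u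
  have hX : ∀ w : Bool × (Fin n → Ξ), virtualIterate γ (scaffoldStep F Gh γ γ w s) - u
      = a - γ • avg fun i => noiseDir F Gh s i (w.2 i) := fun w => by
    rw [virtualIterate_scaffoldStep, show scaffoldDir F Gh w.2 s = fun i =>
      meanDir F s i + noiseDir F Gh s i (w.2 i) from funext fun i => scaffoldDir_eq F Gh w.2 s i,
      avg_add]
    simp only [a]
    module
  have ha : ‖a‖ ^ 2 ≤ (1 - γ * μ / 2) * ‖v - u‖ ^ 2 + 2 * γ * L ^ 2 / μ * clientDrift γ s := by
    simp only [a]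
    rw [hF.avg_meanDir hn]
    exact norm_meanStep_sub_sq_le hn hμ0 hμL hγ0 hγ hF.lipschitz hF.monotone
      ((hF.gradMap_global u).symm.trans hu) s.iter v
  obtain ⟨iX, bX⟩ := hNavg.integral_norm_sub_smul_sq_le a γ
  -- the clients
  set w0 := v - γ • gradMap (global F) v
  set b : Fin n → Z m d := fun i => s.iter i - γ • meanDir F s i - w0 with hb
  -- Equal stepsizes make the virtual iterate the mean of the clients. The mean minimizes the
  -- average squared distance, so the clients may be compared with the noise-free point `w0`
  -- instead.
  have hfalse : ∀ ξ : Fin n → Ξ, clientDrift γ (scaffoldStep F Gh γ γ (false, ξ) s)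
      ≤ avg fun i => ‖b i - γ • noiseDir F Gh s i (ξ i)‖ ^ 2 := fun ξ => by
    have hc := isConsistent_scaffoldStep F Gh γ γ (false, ξ) hs
    have hv1 : virtualIterate γ (scaffoldStep F Gh γ γ (false, ξ) s)
        = avg (scaffoldStep F Gh γ γ (false, ξ) s).iter := by
      rw [virtualIterate, funext hc, avg_sub, avg_const hn, avg_smul]
    unfold clientDrift
    rw [hv1]
    refine (avg_norm_sub_avg_sq_le hn _ w0).trans_eq ?_
    congr 1; funext i; congr 2
    simp only [scaffoldStep, scaffoldDir_eq, hb, Bool.false_eq_true, if_false]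
    module
  have hbi : ∀ i, ‖b i‖ ^ 2 ≤ (1 - γ * μ + p / 2) * ‖s.iter i - v‖ ^ 2
      + (8 / p + 8) * (γ ^ 2 * ζ ^ 2) := fun i => by
    have hbd : ∀ z, ‖gradMap (F i) z - gradMap (global F) z‖ ≤ ζ := fun z => by
      rw [hF.gradMap_global]
      conv_lhs => rw [← avg_const hn (gradMap (F i) z), ← avg_sub]
      rw [← avg_const hn ζ]
      refine (norm_avg_le _).trans (avg_mono fun j => ?_)
      exact hζ i j z
    -- The direction of client `i` differs from `G(v)` by `Gᵢ(zᵢ) - Gᵢ(v)`, which strong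
    -- monotonicity controls, and by the difference of `Gᵢ - G` between `v` and the anchor, which is
    -- at most `2ζ`.
    have := norm_localStep_sub_sq_le hμ0 hγ0 hγ hL0 hp (ζ := ζ) (hF.lipschitz i) (hF.monotone i)
      (s.iter i) v ((gradMap (F i) v - gradMap (global F) v)
        - (gradMap (F i) s.anchor - gradMap (global F) s.anchor))
      ((norm_sub_le _ _).trans (by linarith [hbd v, hbd s.anchor]))
    refine le_of_eq_of_le ?_ this
    congr 2
    simp only [hb, meanDir, w0]
    module
  have iD : Integrable (fun ξ : Fin n → Ξ => avg fun i => ‖b i - γ • noiseDir F Gh s i (ξ i)‖ ^ 2)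
      (Measure.pi D) :=
    (integrable_finsetSum Finset.univ fun i _ =>
      ((hNi i).integral_norm_sub_smul_sq_le (b i) γ).1).const_mul (n : ℝ)⁻¹
  have bD : ∫ ξ : Fin n → Ξ, (avg fun i => ‖b i - γ • noiseDir F Gh s i (ξ i)‖ ^ 2) ∂Measure.pi D
      ≤ (1 - γ * μ + p / 2) * clientDrift γ s + (8 / p + 8) * (γ ^ 2 * ζ ^ 2)
        + γ ^ 2 * (4 * σ ^ 2) := by
    calc _ = avg fun i => ∫ ξ : Fin n → Ξ, ‖b i - γ • noiseDir F Gh s i (ξ i)‖ ^ 2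
          ∂Measure.pi D := by
          simp only [avg]
          rw [integral_smul, integral_finsetSum _ fun i _ =>
            ((hNi i).integral_norm_sub_smul_sq_le (b i) γ).1]
      _ ≤ avg fun i => (1 - γ * μ + p / 2) * ‖s.iter i - v‖ ^ 2
          + ((8 / p + 8) * (γ ^ 2 * ζ ^ 2) + γ ^ 2 * (4 * σ ^ 2)) := avg_mono fun i => by
          linarith [((hNi i).integral_norm_sub_smul_sq_le (b i) γ).2, hbi i]
      _ = _ := by rw [avg_add, avg_mul, avg_const hn, add_assoc]; rfl
  -- the two outcomes of the coin
  set BX := (1 - γ * μ / 2) * ‖v - u‖ ^ 2 + 2 * γ * L ^ 2 / μ * clientDrift γ s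
    + γ ^ 2 * (4 * σ ^ 2 / n)
  set BD := (1 - γ * μ + p / 2) * clientDrift γ s + (8 / p + 8) * (γ ^ 2 * ζ ^ 2)
        + γ ^ 2 * (4 * σ ^ 2)
  have hD0 := clientDrift_nonneg γ s
  have hBX : ∫ ξ : Fin n → Ξ, ‖a - γ • avg fun i => noiseDir F Gh s i (ξ i)‖ ^ 2 ∂Measure.pi D
      ≤ BX := by simp only [BX]; linarith
  have hp1 : (p : ℝ) ≤ 1 := p.2.2
  have hBX0 : 0 ≤ BX := (integral_nonneg fun ξ => by positivity).trans hBX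
  have hBD0 : 0 ≤ BD :=
    (integral_nonneg fun ξ => avg_nonneg fun i => by positivity).trans bD
  have h1 : ∫⁻ ξ, ENNReal.ofReal (potential γ lam u (scaffoldStep F Gh γ γ (true, ξ) s))
      ∂Measure.pi D ≤ ENNReal.ofReal BX := by
    refine lintegral_ofReal_le_of_integral_le (fun ξ => ?_) (fun ξ => ?_) iX hBX
    · rw [potential, clientDrift_scaffoldStep_true, mul_zero, add_zero, hX]
    · positivity
  have h2 : ∫⁻ ξ, ENNReal.ofReal (potential γ lam u (scaffoldStep F Gh γ γ (false, ξ) s))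
      ∂Measure.pi D ≤ ENNReal.ofReal (BX + lam * BD) := by
    refine lintegral_ofReal_le_of_integral_le (ψ := fun ξ =>
      ‖a - γ • avg fun i => noiseDir F Gh s i (ξ i)‖ ^ 2
        + lam * avg fun i => ‖b i - γ • noiseDir F Gh s i (ξ i)‖ ^ 2)
      (fun ξ => ?_) (fun ξ => ?_) (iX.add (iD.const_mul lam)) ?_
    · rw [potential, hX]
      gcongr
      exact hfalse ξ
    · exact add_nonneg (by positivity) (mul_nonneg hlam0 (avg_nonneg fun i => by positivity))
    · rw [integral_add iX (iD.const_mul lam), integral_const_mul]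
      gcongr
  rw [lintegral_bernoulli_prod p hmeas.ennreal_ofReal]
  calc _ ≤ ENNReal.ofReal p * ENNReal.ofReal BX
        + ENNReal.ofReal (1 - p) * ENNReal.ofReal (BX + lam * BD) := by gcongr
    _ = ENNReal.ofReal (p * BX + (1 - p) * (BX + lam * BD)) := by
        rw [← ENNReal.ofReal_mul hp.le, ← ENNReal.ofReal_mul (by linarith),
          ← ENNReal.ofReal_add (by positivity)
            (mul_nonneg (by linarith) (add_nonneg hBX0 (mul_nonneg hlam0 hBD0)))]
    _ ≤ _ := ENNReal.ofReal_le_ofReal ?_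
  have hγμ : γ * μ ≤ 1 / 4 := by
    rw [le_div_iff₀ (by positivity)] at hγ
    have : γ * (4 * L ^ 2) * μ ≤ μ * μ := by gcongr
    by_contra! hcon
    have : 1 / 4 * (4 * L ^ 2) < γ * μ * (4 * L ^ 2) := by gcongr
    nlinarith
  -- The weight `lam` is chosen for this identity, which matches the spare `p/4` in
  -- `coin_average_le`.
  have hlam' : 2 * γ * L ^ 2 / μ = lam * (p / 4) := by
    rw [hlam]; field_simp; ring
  have e6 : γ ^ 2 * (4 * σ ^ 2 / n) = 4 * γ ^ 2 * σ ^ 2 / n := by ring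
  have e7 : γ ^ 2 * (4 * σ ^ 2) = 4 * γ ^ 2 * σ ^ 2 := by ring
  have e8 : 16 * γ ^ 2 * ζ ^ 2 / p = 16 * (γ ^ 2 * ζ ^ 2) / p := by ring
  have := coin_average_le (a := γ * μ) (X := ‖v - u‖ ^ 2) (S := 4 * γ ^ 2 * σ ^ 2 / n)
    (H := γ ^ 2 * ζ ^ 2) (V := 4 * γ ^ 2 * σ ^ 2) hp (by positivity) hγμ hlam0 hD0
    (by positivity) (by positivity)
  simp only [BX, BD]
  rw [hlam', e6, e7, e8]
  exact this

/-- The expected potential after one step of SCAFFOLD-S without local steps, for a well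
conditioned problem. -/
lemma lintegral_potential_scaffoldStep_zero_le [MeasurableSpace Ξ] (hn : 0 < n)
    {D : Fin n → Measure Ξ} [∀ i, IsProbabilityMeasure (D i)] (p : unitInterval)
    (hp : 0 < (p : ℝ)) (hF : IsRegularFamily L μ F) (hμ0 : 0 < μ) (hμL : μ ≤ L)
    (hL3 : L ≤ 3 * μ) {u : Z m d} (hu : gradMap (global F) u = 0) {s : ScaffoldState n m d}
    (hs : IsConsistent 0 s)
    (hmeas : Measurable fun w => potential (p / (48 * L)) (1 / 2) u
      (scaffoldStep F Gh 0 (p / (48 * L)) w s)) :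
    ∫⁻ w, ENNReal.ofReal (potential (p / (48 * L)) (1 / 2) u
        (scaffoldStep F Gh 0 (p / (48 * L)) w s))
        ∂((bernoulliMeasure true false p).prod (Measure.pi D))
      ≤ ENNReal.ofReal ((1 - p / 576) * potential (p / (48 * L)) (1 / 2) u s) := by
  have hL0 : 0 < L := hμ0.trans_le hμL
  have hp1 : (p : ℝ) ≤ 1 := p.2.2
  set γ : ℝ := p / (48 * L) with hγ
  have hγ0 : 0 ≤ γ := by positivity
  have hγL : γ * L = p / 48 := by rw [hγ]; field_simp
  set v := virtualIterate γ s with hv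
  have hi : ∀ i, s.iter i = s.anchor := fun i => by rw [hs i]; simp
  set g := gradMap (global F) s.anchor with hg
  -- Every client is at the anchor, so the two oracle answers for the same sample cancel and the
  -- direction is deterministic.
  have hdir : ∀ ξ : Fin n → Ξ, avg (scaffoldDir F Gh ξ s) = g := fun ξ => by
    rw [← avg_const hn g]
    congr 1; funext i
    simp [scaffoldDir, hi, hg]
  have hD : clientDrift γ s = ‖s.anchor - v‖ ^ 2 := by
    unfold clientDrift
    simp_rw [hi]
    rw [avg_const hn]
  have hX : ∀ w : Bool × (Fin n → Ξ), virtualIterate γ (scaffoldStep F Gh 0 γ w s) = v - γ • g :=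
    fun w => by rw [virtualIterate_scaffoldStep, hdir]
  have hfalse : ∀ ξ : Fin n → Ξ, clientDrift γ (scaffoldStep F Gh 0 γ (false, ξ) s)
      = ‖(s.anchor - v) + γ • g‖ ^ 2 := fun ξ => by
    unfold clientDrift
    rw [hX, ← avg_const hn (‖(s.anchor - v) + γ • g‖ ^ 2)]
    congr 1; funext i; congr 2
    simp only [scaffoldStep, Bool.false_eq_true, if_false, zero_smul, sub_zero, hi]
    abel
  have hXstep : ‖v - γ • g - u‖ ^ 2
      ≤ (1 - γ * μ / 2) * ‖v - u‖ ^ 2 + 2 * γ * L ^ 2 / μ * ‖s.anchor - v‖ ^ 2 := by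
    have := norm_meanStep_sub_sq_le hn hμ0 hμL hγ0 (by
      rw [hγ, div_le_div_iff₀ (by positivity) (by positivity)]
      nlinarith [mul_pos hL0 hL0]) hF.lipschitz hF.monotone
      ((hF.gradMap_global u).symm.trans hu) (fun _ => s.anchor) v
    rwa [← hF.gradMap_global, avg_const hn] at this
  have hgsq : ‖g‖ ^ 2 ≤ L ^ 2 * (2 * ‖s.anchor - v‖ ^ 2 + 2 * ‖v - u‖ ^ 2) := by
    have h1 := norm_avg_operator_sub_le hn hF.lipschitz s.anchor u
    rw [← hF.gradMap_global, ← hF.gradMap_global, hu, sub_zero] at h1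
    have h2 := pow_le_pow_left₀ (norm_nonneg _) h1 2
    rw [mul_pow] at h2
    refine h2.trans ?_
    gcongr
    simpa using norm_add_sq_le_two (s.anchor - v) (v - u)
  have hDstep : (1 - p) * ‖(s.anchor - v) + γ • g‖ ^ 2
      ≤ (1 - p / 2 + p / 576) * ‖s.anchor - v‖ ^ 2 + p / 576 * ‖v - u‖ ^ 2 := by
    -- With `t = p/2` the growth `1 + p/2` stays below the decay `1 - p`. The factor `2/p` on the
    -- other term is harmless because `γ` is proportional to `p`: about `1/p` directions accumulate
    -- between synchronizations.
    have h1 := norm_add_sq_le_young (s.anchor - v) (γ • g) (t := p / 2) (by positivity)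
    rw [norm_smul, mul_pow, Real.norm_of_nonneg hγ0] at h1
    have h2 : γ ^ 2 * ‖g‖ ^ 2 ≤ p ^ 2 / 2304 * (2 * ‖s.anchor - v‖ ^ 2 + 2 * ‖v - u‖ ^ 2) := by
      calc _ ≤ γ ^ 2 * (L ^ 2 * (2 * ‖s.anchor - v‖ ^ 2 + 2 * ‖v - u‖ ^ 2)) := by gcongr
        _ = (γ * L) ^ 2 * (2 * ‖s.anchor - v‖ ^ 2 + 2 * ‖v - u‖ ^ 2) := by ring
        _ = _ := by rw [hγL]; ring
    have h3 : (1 - p) * (1 + (p : ℝ) / 2) ≤ 1 - p / 2 := by nlinarith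
    have h4 : (1 - p) * (1 + 1 / ((p : ℝ) / 2)) ≤ 2 / p := by
      rw [le_div_iff₀ hp]
      have : (1 - p) * (1 + 1 / ((p : ℝ) / 2)) * p = (1 - p) * (p + 2) := by field_simp
      rw [this]; nlinarith
    calc _ ≤ (1 - p) * ((1 + (p : ℝ) / 2) * ‖s.anchor - v‖ ^ 2
          + (1 + 1 / ((p : ℝ) / 2)) * (γ ^ 2 * ‖g‖ ^ 2)) := by gcongr
      _ = (1 - p) * (1 + (p : ℝ) / 2) * ‖s.anchor - v‖ ^ 2
          + (1 - p) * (1 + 1 / ((p : ℝ) / 2)) * (γ ^ 2 * ‖g‖ ^ 2) := by ring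
      _ ≤ (1 - p / 2) * ‖s.anchor - v‖ ^ 2
          + 2 / p * (p ^ 2 / 2304 * (2 * ‖s.anchor - v‖ ^ 2 + 2 * ‖v - u‖ ^ 2)) := by gcongr
      _ = _ := by field_simp; ring
  have h1 : ∀ ξ : Fin n → Ξ, potential γ (1 / 2) u (scaffoldStep F Gh 0 γ (true, ξ) s)
      = ‖v - γ • g - u‖ ^ 2 := fun ξ => by
    rw [potential, clientDrift_scaffoldStep_true, hX]; ring
  have h2 : ∀ ξ : Fin n → Ξ, potential γ (1 / 2) u (scaffoldStep F Gh 0 γ (false, ξ) s)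
      = ‖v - γ • g - u‖ ^ 2 + 1 / 2 * ‖(s.anchor - v) + γ • g‖ ^ 2 := fun ξ => by
    rw [potential, hfalse, hX]
  rw [lintegral_bernoulli_prod p hmeas.ennreal_ofReal]
  simp_rw [h1, h2]
  simp only [lintegral_const, measure_univ, mul_one]
  rw [← ENNReal.ofReal_mul hp.le, ← ENNReal.ofReal_mul (by linarith),
    ← ENNReal.ofReal_add (by positivity) (mul_nonneg (by linarith) (by positivity))]
  refine ENNReal.ofReal_le_ofReal ?_
  have h3 : p / 288 ≤ γ * μ / 2 := by
    have : γ * L ≤ γ * (3 * μ) := by gcongr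
    linarith
  have h4 : 2 * γ * L ^ 2 / μ ≤ p / 8 := by
    rw [div_le_iff₀ hμ0]
    have : 2 * γ * L ^ 2 = 2 * (γ * L) * L := by ring
    rw [this, hγL]
    nlinarith
  have h5 := mul_le_mul_of_nonneg_right h3 (sq_nonneg ‖v - u‖)
  have h6 := mul_le_mul_of_nonneg_right h4 (sq_nonneg ‖s.anchor - v‖)
  rw [potential, hD, ← hv]
  have h7 : 0 ≤ p * ‖s.anchor - v‖ ^ 2 := by positivity
  have h8 : 0 ≤ p * ‖v - u‖ ^ 2 := by positivity
  linarith

end Potential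

/-! ### Integration of the one-step bound along a run of SCAFFOLD-S. -/

section MarkovChain

variable {n m d : ℕ} {Ξ Ω : Type*} [MeasurableSpace Ξ] [MeasurableSpace Ω] {P : Measure Ω}
  {p : unitInterval} {D : Fin n → Measure Ξ} {W : ℕ → ℕ → Ω → Bool × (Fin n → Ξ)}
  {f : Fin n → Z m d → ℝ} {Ghat : Fin n → Z m d → Ξ → Z m d} {c : CatalystParams} {z0 : Z m d}

/-- The state of SCAFFOLD-S before iteration `k` of meta-iteration `t`. -/
def metaState {n m d : ℕ} {Ξ Ω : Type*} (f : Fin n → Z m d → ℝ)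
    (Ghat : Fin n → Z m d → Ξ → Z m d) (c : CatalystParams) (z0 : Z m d)
    (W : ℕ → ℕ → Ω → Bool × (Fin n → Ξ)) (t k : ℕ) (ω : Ω) : ScaffoldState n m d :=
  scaffoldRun (fun i => regularize c.θ (metaIterate f Ghat c z0 W t ω) (f i))
    (fun i => regularizeOracle c.θ (metaIterate f Ghat c z0 W t ω) (Ghat i)) c.γl c.γg
    (metaIterate f Ghat c z0 W t ω) (fun j => W t j ω) k

lemma metaState_succ {Ξ Ω : Type*} {W : ℕ → ℕ → Ω → Bool × (Fin n → Ξ)}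
    {Ghat : Fin n → Z m d → Ξ → Z m d} (t k : ℕ) (ω : Ω) :
    metaState f Ghat c z0 W t (k + 1) ω = scaffoldStep
      (fun i => regularize c.θ (metaIterate f Ghat c z0 W t ω) (f i))
      (fun i => regularizeOracle c.θ (metaIterate f Ghat c z0 W t ω) (Ghat i)) c.γl c.γg (W t k ω)
      (metaState f Ghat c z0 W t k ω) :=
  rfl

lemma isConsistent_metaState {Ξ Ω : Type*} {W : ℕ → ℕ → Ω → Bool × (Fin n → Ξ)}
    {Ghat : Fin n → Z m d → Ξ → Z m d} (t k : ℕ) (ω : Ω) :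
    IsConsistent c.γl (metaState f Ghat c z0 W t k ω) :=
  isConsistent_scaffoldRun _ _ _ _ _ _ _

lemma measurable_metaIterate (hn : 0 < n) (hf : ∀ i, Differentiable ℝ (f i))
    (hG : Measurable (gradMap (global f))) (hGhat : ∀ i, Measurable (Function.uncurry (Ghat i)))
    (hW : ∀ t k, Measurable (W t k)) (t : ℕ) : Measurable (metaIterate f Ghat c z0 W t) :=
  measurable_catalystIterate hn hf hG hGhat c z0 t fun s _ => hW s

lemma measurable_metaState (hn : 0 < n) (hf : ∀ i, Differentiable ℝ (f i))
    (hG : Measurable (gradMap (global f))) (hGhat : ∀ i, Measurable (Function.uncurry (Ghat i)))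
    (hW : ∀ t k, Measurable (W t k)) (t k : ℕ) : Measurable (metaState f Ghat c z0 W t k) :=
  measurable_scaffoldRun hn hf hG hGhat c.θ c.γl c.γg
    (measurable_metaIterate hn hf hG hGhat hW t) k fun j _ => hW t j

/-- The past is independent of the coin and the samples of the current iteration. -/
lemma indepFun_metaIterate_metaState (hn : 0 < n) (hf : ∀ i, Differentiable ℝ (f i))
    (hG : Measurable (gradMap (global f))) (hGhat : ∀ i, Measurable (Function.uncurry (Ghat i)))
    (hW : IsDriver p D P W) (t k : ℕ) :
    IndepFun (fun ω => (metaIterate f Ghat c z0 W t ω, metaState f Ghat c z0 W t k ω))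
      (W t k) P := by
  -- `A` consists of the iterations before `(t, k)` in lexicographic order. The measurability lemmas
  -- are applied to the σ-algebra that these iterations generate.
  let A : Set (ℕ × ℕ) := {q | q.1 < t ∨ (q.1 = t ∧ q.2 < k)}
  have hq : (t, k) ∉ A := by simp [A]
  refine indepFun_of_measurable_iSup_comap (V := fun q : ℕ × ℕ => W q.1 q.2) hW.indep
    (fun q => hW.measurable q.1 q.2) hq ?_
  have hA : ∀ q ∈ A, Measurable[⨆ q ∈ A, MeasurableSpace.comap (W q.1 q.2) inferInstance]
      (W q.1 q.2) := fun q hq => by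
    rw [measurable_iff_comap_le]
    exact le_iSup₂ (f := fun (q : ℕ × ℕ) (_ : q ∈ A) =>
      MeasurableSpace.comap (W q.1 q.2) inferInstance) q hq
  have h1 := @measurable_catalystIterate n m d Ω
    (⨆ q ∈ A, MeasurableSpace.comap (W q.1 q.2) inferInstance) Ξ _ hn f hf hG Ghat hGhat c z0 W t
    fun s hs j => hA (s, j) (Or.inl hs)
  exact h1.prodMk (@measurable_scaffoldRun n m d Ω
    (⨆ q ∈ A, MeasurableSpace.comap (W q.1 q.2) inferInstance) Ξ _ hn f hf hG Ghat hGhat c.θ c.γl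
    c.γg _ _ h1 k fun j hj => hA (t, j) (Or.inr ⟨rfl, hj⟩))

lemma affine_recursion_le {e : ℕ → ℝ≥0∞} {e0 : ℝ≥0∞} {r b : ℝ} (hr0 : 0 ≤ r) (hr1 : r < 1)
    (hb : 0 ≤ b) (h0 : e 0 ≤ e0)
    (h : ∀ k, e (k + 1) ≤ ENNReal.ofReal r * e k + ENNReal.ofReal b) (k : ℕ) :
    e k ≤ ENNReal.ofReal (r ^ k) * e0 + ENNReal.ofReal (b / (1 - r)) := by
  have hr : 0 < 1 - r := by linarith
  induction k with
  | zero => simpa using le_add_right h0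
  | succ k ih =>
    calc _ ≤ ENNReal.ofReal r * e k + ENNReal.ofReal b := h k
      _ ≤ ENNReal.ofReal r * (ENNReal.ofReal (r ^ k) * e0 + ENNReal.ofReal (b / (1 - r)))
          + ENNReal.ofReal b := by gcongr
      _ = _ := by
          rw [mul_add, ← mul_assoc, ← ENNReal.ofReal_mul hr0, ← ENNReal.ofReal_mul hr0, add_assoc,
            ← ENNReal.ofReal_add (by positivity) hb, pow_succ']
          congr 3
          field_simp
          ring

lemma lintegral_markovStep_le [IsProbabilityMeasure P] {S T : Type*} [MeasurableSpace S]
    [MeasurableSpace T] {X : Ω → T} {Y : Ω → S} {ν : Measure S} (h : IndepFun X Y P)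
    (hX : Measurable X) (hY : Measurable Y) (hν : P.map Y = ν) {φ : T × S → ℝ≥0∞}
    (hφ : Measurable φ) {π : Ω → ℝ≥0∞} (hπ : Measurable π) {r b : ℝ≥0∞}
    (hstep : ∀ ω, ∫⁻ y, φ (X ω, y) ∂ν ≤ r * π ω + b) :
    ∫⁻ ω, φ (X ω, Y ω) ∂P ≤ r * ∫⁻ ω, π ω ∂P + b := by
  rw [IndepFun.lintegral_comp_prodMk h hX hY hφ, hν]
  refine (lintegral_mono hstep).trans_eq ?_
  rw [lintegral_add_right _ measurable_const, lintegral_const_mul _ hπ]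
  simp

/-- The potential of SCAFFOLD-S contracts in expectation, with factor `r` and offset `b`, at
every consistent state of every meta-iteration. -/
def ContractsPotential (f : Fin n → Z m d → ℝ) (Ghat : Fin n → Z m d → Ξ → Z m d)
    (c : CatalystParams) (p : unitInterval) (D : Fin n → Measure Ξ) (J : Z m d → Z m d)
    (lam r b : ℝ) : Prop :=
  ∀ u s, IsConsistent c.γl s →
    ∫⁻ w, ENNReal.ofReal (potential c.γg lam (J u) (scaffoldStep
      (fun i => regularize c.θ u (f i))
      (fun i => regularizeOracle c.θ u (Ghat i)) c.γl c.γg w s))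
      ∂((bernoulliMeasure true false p).prod (Measure.pi D))
    ≤ ENNReal.ofReal (r * potential c.γg lam (J u) s + b)

lemma measurable_potential_scaffoldStep (hn : 0 < n) (hf : ∀ i, Differentiable ℝ (f i))
    (hG : Measurable (gradMap (global f))) (hGhat : ∀ i, Measurable (Function.uncurry (Ghat i)))
    {J : Z m d → Z m d} (hJ : Measurable J) (lam : ℝ) :
    Measurable fun q : (Z m d × ScaffoldState n m d) × (Bool × (Fin n → Ξ)) =>
      potential c.γg lam (J q.1.1) (scaffoldStep (fun i => regularize c.θ q.1.1 (f i))
        (fun i => regularizeOracle c.θ q.1.1 (Ghat i)) c.γl c.γg q.2 q.1.2) := by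
  have m1 : Measurable fun q : (Z m d × ScaffoldState n m d) × (Bool × (Fin n → Ξ)) => q.1 :=
    measurable_fst
  have m2 := measurable_scaffoldStep hn hf hG hGhat c.θ c.γl c.γg m1.fst m1.snd measurable_snd
  exact Measurable.potential (hJ.comp m1.fst) m2

lemma measurable_potential_scaffoldStep_const (hn : 0 < n) (hf : ∀ i, Differentiable ℝ (f i))
    (hG : Measurable (gradMap (global f))) (hGhat : ∀ i, Measurable (Function.uncurry (Ghat i)))
    (lam : ℝ) (u v : Z m d) (s : ScaffoldState n m d) :
    Measurable fun w => potential c.γg lam v (scaffoldStep (fun i => regularize c.θ u (f i))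
      (fun i => regularizeOracle c.θ u (Ghat i)) c.γl c.γg w s) :=
  Measurable.potential measurable_const (measurable_scaffoldStep hn hf hG hGhat c.θ c.γl c.γg
    measurable_const measurable_const measurable_id)

lemma lintegral_potential_metaState_succ_le [IsProbabilityMeasure P]
    [∀ i, IsProbabilityMeasure (D i)] (hn : 0 < n) (hf : ∀ i, Differentiable ℝ (f i))
    (hG : Measurable (gradMap (global f))) (hGhat : ∀ i, Measurable (Function.uncurry (Ghat i)))
    (hW : IsDriver p D P W) {J : Z m d → Z m d} (hJ : Measurable J) {lam r b : ℝ}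
    (hlam : 0 ≤ lam) (hr0 : 0 ≤ r) (hb : 0 ≤ b)
    (hstep : ContractsPotential f Ghat c p D J lam r b) (t k : ℕ) :
    ∫⁻ ω, ENNReal.ofReal (potential c.γg lam (J (metaIterate f Ghat c z0 W t ω))
        (metaState f Ghat c z0 W t (k + 1) ω)) ∂P
      ≤ ENNReal.ofReal r * ∫⁻ ω, ENNReal.ofReal (potential c.γg lam
          (J (metaIterate f Ghat c z0 W t ω)) (metaState f Ghat c z0 W t k ω)) ∂P
        + ENNReal.ofReal b := by
  have hφ := measurable_potential_scaffoldStep (c := c) hn hf hG hGhat hJ lam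
  have hz := measurable_metaIterate (c := c) (z0 := z0) hn hf hG hGhat hW.measurable t
  have hs := measurable_metaState (c := c) (z0 := z0) hn hf hG hGhat hW.measurable t k
  have key := lintegral_markovStep_le (P := P) (Y := W t k)
    (r := ENNReal.ofReal r) (b := ENNReal.ofReal b)
    (X := fun ω => (metaIterate f Ghat c z0 W t ω, metaState f Ghat c z0 W t k ω))
    (indepFun_metaIterate_metaState (c := c) (z0 := z0) hn hf hG hGhat hW t k) (hz.prodMk hs)
    (hW.measurable t k) (hW.law t k) hφ.ennreal_ofReal
    (Measurable.potential (γg := c.γg) (lam := lam) (hJ.comp hz) hs).ennreal_ofReal fun ω => ?_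
  · simp_rw [metaState_succ]
    exact key
  · rw [← ENNReal.ofReal_mul hr0, ← ENNReal.ofReal_add
      (mul_nonneg hr0 (potential_nonneg hlam _ _)) hb]
    exact hstep _ _ (isConsistent_metaState t k ω)

lemma lintegral_potential_metaState_le [IsProbabilityMeasure P]
    [∀ i, IsProbabilityMeasure (D i)] (hn : 0 < n) (hf : ∀ i, Differentiable ℝ (f i))
    (hG : Measurable (gradMap (global f))) (hGhat : ∀ i, Measurable (Function.uncurry (Ghat i)))
    (hW : IsDriver p D P W) {J : Z m d → Z m d} (hJ : Measurable J) {lam r b : ℝ}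
    (hlam : 0 ≤ lam) (hr0 : 0 ≤ r) (hr1 : r < 1) (hb : 0 ≤ b)
    (hstep : ContractsPotential f Ghat c p D J lam r b) (t k : ℕ) :
    ∫⁻ ω, ENNReal.ofReal (potential c.γg lam (J (metaIterate f Ghat c z0 W t ω))
        (metaState f Ghat c z0 W t k ω)) ∂P
      ≤ ENNReal.ofReal (r ^ k) * ∫⁻ ω, ENNReal.ofReal (‖metaIterate f Ghat c z0 W t ω
          - J (metaIterate f Ghat c z0 W t ω)‖ ^ 2) ∂P
        + ENNReal.ofReal (b / (1 - r)) := by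
  refine affine_recursion_le (e := fun k => ∫⁻ ω, ENNReal.ofReal (potential c.γg lam
    (J (metaIterate f Ghat c z0 W t ω)) (metaState f Ghat c z0 W t k ω)) ∂P) hr0 hr1 hb ?_
    (lintegral_potential_metaState_succ_le hn hf hG hGhat hW hJ hlam hr0 hb hstep t) k
  exact lintegral_mono fun ω => ENNReal.ofReal_le_ofReal (potential_init _ _ _ _).le

lemma norm_weightedSum_sub_sq_le {E ι : Type*} [NormedAddCommGroup E] [InnerProductSpace ℝ E]
    (s : Finset ι) {w : ι → ℝ} (hw : ∀ i ∈ s, 0 ≤ w i) (hs : 0 < ∑ i ∈ s, w i) (v : ι → E) (u : E) :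
    ‖(∑ i ∈ s, w i)⁻¹ • ∑ i ∈ s, w i • v i - u‖ ^ 2
      ≤ ∑ i ∈ s, w i / (∑ i ∈ s, w i) * ‖v i - u‖ ^ 2 := by
  have hconv : ConvexOn ℝ Set.univ fun x : E => ‖x - u‖ ^ 2 := by
    have h1 : ConvexOn ℝ Set.univ fun x : E => ‖x - u‖ := by
      simpa [Function.comp_def, sub_eq_add_neg] using
        (convexOn_univ_norm (E := E)).translate_left (-u)
    exact h1.pow (fun _ _ => norm_nonneg _) 2
  have := hconv.map_centerMass_le (t := s) (w := w) (p := v) hw hs fun _ _ => Set.mem_univ _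
  simp only [Finset.centerMass] at this
  refine this.trans_eq ?_
  rw [smul_eq_mul, Finset.mul_sum]
  refine Finset.sum_congr rfl fun i _ => ?_
  simp [div_eq_inv_mul, mul_assoc]

/-- Geometric weights with base `r / 2` let a linearly decaying sequence be dominated by its
last member. -/
lemma sum_geometric_weights_le {r : ℝ} (hr : 0 < r) (K : ℕ) :
    ∑ k ∈ Finset.range (K + 1), (r / 2) ^ (1 - (k : ℤ))
        / (∑ k ∈ Finset.range (K + 1), (r / 2) ^ (1 - (k : ℤ))) * r ^ k ≤ 2 * r ^ K := by
  have hρ : 0 < r / 2 := by positivity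
  -- The weights outgrow the decay by a factor 2 per iteration, so the sum is geometric and at most
  -- twice its last term.
  have hterm : ∀ k : ℕ, (r / 2) ^ (1 - (k : ℤ)) * r ^ k = r / 2 * 2 ^ k := fun k => by
    rw [zpow_sub₀ hρ.ne', zpow_one, zpow_natCast, div_pow]
    field_simp
  set S := ∑ k ∈ Finset.range (K + 1), (r / 2) ^ (1 - (k : ℤ)) with hS
  have hSK : (r / 2) ^ (1 - (K : ℤ)) ≤ S :=
    Finset.single_le_sum (f := fun k : ℕ => (r / 2) ^ (1 - (k : ℤ))) (fun k _ => by positivity)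
      (Finset.self_mem_range_succ K)
  have hS0 : 0 < S := lt_of_lt_of_le (by positivity) hSK
  calc _ = (∑ k ∈ Finset.range (K + 1), r / 2 * 2 ^ k) / S := by
        rw [Finset.sum_div]
        refine Finset.sum_congr rfl fun k _ => ?_
        rw [← hterm]; ring
    _ ≤ 2 * r ^ K := by
        rw [div_le_iff₀ hS0, ← Finset.mul_sum]
        have h1 : ∑ k ∈ Finset.range (K + 1), (2 : ℝ) ^ k ≤ 2 * 2 ^ K := by
          rw [geom_sum_eq (by norm_num)]
          norm_num [pow_succ]
          linarith [pow_pos (two_pos (α := ℝ)) K]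
        calc _ ≤ r / 2 * (2 * 2 ^ K) := by gcongr
          _ = 2 * ((r / 2) ^ (1 - (K : ℤ)) * r ^ K) := by rw [hterm]; ring
          _ ≤ 2 * (S * r ^ K) := by gcongr
          _ = _ := by ring

/-- The accuracy of the output of SCAFFOLD-S in meta-iteration `t`. -/
lemma lintegral_metaIterate_succ_sub_le [IsProbabilityMeasure P]
    [∀ i, IsProbabilityMeasure (D i)] (hn : 0 < n) (hf : ∀ i, Differentiable ℝ (f i))
    (hG : Measurable (gradMap (global f))) (hGhat : ∀ i, Measurable (Function.uncurry (Ghat i)))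
    (hW : IsDriver p D P W) {J : Z m d → Z m d} (hJ : Measurable J) {lam r b A : ℝ}
    (hlam : 0 ≤ lam) (hr0 : 0 < r) (hr1 : r < 1) (hb : 0 ≤ b) (hA : 0 ≤ A) (hρ : c.ρ = r / 2)
    (hout : ∀ u s, IsConsistent c.γl s →
      ‖avg s.iter - J u‖ ^ 2 ≤ A * potential (n := n) c.γg lam (J u) s)
    (hstep : ContractsPotential f Ghat c p D J lam r b) (t : ℕ) :
    ∫⁻ ω, ENNReal.ofReal (‖metaIterate f Ghat c z0 W (t + 1) ω
        - J (metaIterate f Ghat c z0 W t ω)‖ ^ 2) ∂P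
      ≤ ENNReal.ofReal (2 * A * r ^ c.K) * ∫⁻ ω, ENNReal.ofReal (‖metaIterate f Ghat c z0 W t ω
          - J (metaIterate f Ghat c z0 W t ω)‖ ^ 2) ∂P
        + ENNReal.ofReal (A * (b / (1 - r))) := by
  have hr : 0 < 1 - r := by linarith
  have hρ0 := c.ρ_pos
  set wt : ℕ → ℝ := fun k => c.ρ ^ (1 - (k : ℤ)) with hwt
  set S := ∑ k ∈ Finset.range (c.K + 1), wt k with hS
  have hwt0 : ∀ k, 0 < wt k := fun k => zpow_pos hρ0 _
  have hS0 : 0 < S := Finset.sum_pos (fun k _ => hwt0 k) ⟨0, by simp⟩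
  have hx0 : ∀ k, 0 ≤ wt k / S * A := fun k =>
    mul_nonneg (div_nonneg (hwt0 k).le hS0.le) hA
  set e0 := ∫⁻ ω, ENNReal.ofReal (‖metaIterate f Ghat c z0 W t ω
          - J (metaIterate f Ghat c z0 W t ω)‖ ^ 2) ∂P
  have hpt : ∀ ω, ENNReal.ofReal (‖metaIterate f Ghat c z0 W (t + 1) ω
        - J (metaIterate f Ghat c z0 W t ω)‖ ^ 2)
      ≤ ∑ k ∈ Finset.range (c.K + 1), ENNReal.ofReal (wt k / S * A) *
        ENNReal.ofReal (potential c.γg lam (J (metaIterate f Ghat c z0 W t ω))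
          (metaState f Ghat c z0 W t k ω)) := fun ω => by
    simp_rw [← ENNReal.ofReal_mul (hx0 _)]
    rw [← ENNReal.ofReal_sum_of_nonneg fun k _ =>
      mul_nonneg (hx0 k) (potential_nonneg hlam _ _)]
    refine ENNReal.ofReal_le_ofReal ?_
    refine (norm_weightedSum_sub_sq_le (Finset.range (c.K + 1)) (fun k _ => (hwt0 k).le) hS0
      (fun k => avg (metaState f Ghat c z0 W t k ω).iter) _).trans ?_
    refine Finset.sum_le_sum fun k _ => ?_
    rw [mul_assoc]
    exact mul_le_mul_of_nonneg_left (hout _ _ (isConsistent_metaState t k ω))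
      (div_nonneg (hwt0 k).le hS0.le)
  have hmeas : ∀ k, Measurable fun ω => ENNReal.ofReal (potential c.γg lam
        (J (metaIterate f Ghat c z0 W t ω)) (metaState f Ghat c z0 W t k ω)) := fun k =>
    (Measurable.potential (hJ.comp (measurable_metaIterate hn hf hG hGhat hW.measurable t))
      (measurable_metaState hn hf hG hGhat hW.measurable t k)).ennreal_ofReal
  calc _ ≤ ∫⁻ ω, ∑ k ∈ Finset.range (c.K + 1), ENNReal.ofReal (wt k / S * A) *
        ENNReal.ofReal (potential c.γg lam (J (metaIterate f Ghat c z0 W t ω))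
          (metaState f Ghat c z0 W t k ω)) ∂P := lintegral_mono hpt
    _ = ∑ k ∈ Finset.range (c.K + 1), ENNReal.ofReal (wt k / S * A) * ∫⁻ ω,
        ENNReal.ofReal (potential c.γg lam (J (metaIterate f Ghat c z0 W t ω))
          (metaState f Ghat c z0 W t k ω)) ∂P := by
        rw [lintegral_finsetSum _ fun k _ => (hmeas k).const_mul _]
        exact Finset.sum_congr rfl fun k _ => lintegral_const_mul _ (hmeas k)
    _ ≤ ∑ k ∈ Finset.range (c.K + 1), ENNReal.ofReal (wt k / S * A) *
        (ENNReal.ofReal (r ^ k) * e0 + ENNReal.ofReal (b / (1 - r))) := by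
        gcongr with k _
        exact lintegral_potential_metaState_le hn hf hG hGhat hW hJ hlam hr0.le hr1 hb hstep t k
    _ = ENNReal.ofReal (∑ k ∈ Finset.range (c.K + 1), wt k / S * A * r ^ k) * e0
        + ENNReal.ofReal (∑ k ∈ Finset.range (c.K + 1), wt k / S * A * (b / (1 - r))) := by
        rw [ENNReal.ofReal_sum_of_nonneg fun k _ => mul_nonneg (hx0 k) (by positivity),
          ENNReal.ofReal_sum_of_nonneg fun k _ => mul_nonneg (hx0 k) (by positivity),
          Finset.sum_mul, ← Finset.sum_add_distrib]
        refine Finset.sum_congr rfl fun k _ => ?_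
        rw [mul_add, ENNReal.ofReal_mul (hx0 k), ENNReal.ofReal_mul (hx0 k), mul_assoc]
    _ ≤ _ := by
        gcongr
        · have h1 := sum_geometric_weights_le hr0 c.K
          rw [← hρ] at h1
          calc _ = A * ∑ k ∈ Finset.range (c.K + 1), wt k / S * r ^ k := by
                rw [Finset.mul_sum]; exact Finset.sum_congr rfl fun k _ => by ring
            _ ≤ A * (2 * r ^ c.K) := by gcongr
            _ = _ := by ring
        · rw [← Finset.sum_mul, ← Finset.sum_mul, ← Finset.sum_div, div_self hS0.ne', one_mul]

end MarkovChain

/-! ### The proximal point iteration with inexact subproblems. -/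

section Catalyst

variable {n m d : ℕ} {Ξ Ω : Type*} [MeasurableSpace Ξ] [MeasurableSpace Ω] {P : Measure Ω}
  {p : unitInterval} {D : Fin n → Measure Ξ}
  [∀ i, IsProbabilityMeasure (D i)] {W : ℕ → ℕ → Ω → Bool × (Fin n → Ξ)}
  {f : Fin n → Z m d → ℝ} {Ghat : Fin n → Z m d → Ξ → Z m d} {c : CatalystParams} {z0 zs : Z m d}

/-- With `q = θ/(θ+μ)`, convexity of the square gives `(a + q b)² ≤ a²/(1 - q) + q b²`; the weights
are such that the factor of the old error stays `q`. -/
lemma norm_sub_sq_le_of_resolvent {E : Type*} [NormedAddCommGroup E] {θ μ : ℝ} (hθ : 0 ≤ θ)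
    (hμ : 0 < μ) {z' j z s : E} (hj : ‖j - s‖ ≤ θ / (θ + μ) * ‖z - s‖) :
    ‖z' - s‖ ^ 2 ≤ θ / (θ + μ) * ‖z - s‖ ^ 2 + (θ + μ) / μ * ‖z' - j‖ ^ 2 := by
  have hθμ : 0 < θ + μ := by positivity
  have h1 : ‖z' - s‖ ≤ ‖z' - j‖ + θ / (θ + μ) * ‖z - s‖ := by
    calc ‖z' - s‖ = ‖(z' - j) + (j - s)‖ := by congr 1; abel
      _ ≤ _ := (norm_add_le _ _).trans (by gcongr)
  have h2 := pow_le_pow_left₀ (norm_nonneg _) h1 2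
  refine h2.trans (sub_nonneg.1 ?_)
  have : θ / (θ + μ) * ‖z - s‖ ^ 2 + (θ + μ) / μ * ‖z' - j‖ ^ 2
      - (‖z' - j‖ + θ / (θ + μ) * ‖z - s‖) ^ 2
      = θ / μ * (‖z' - j‖ - μ / (θ + μ) * ‖z - s‖) ^ 2 := by
    field_simp; ring
  rw [this]
  positivity

/-- The errors of the meta-iterates, when every subproblem is solved accurately enough. -/
lemma catalyst_recursion {θ μ ε R a b : ℝ} (hθ : 0 ≤ θ) (hμ : 0 < μ) (hε : 0 < ε)
    (ha : 0 ≤ a) (hb : 0 ≤ b)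
    (hacc : a * (R ^ 2 + ε) + b ≤ (μ / (2 * (θ + μ))) ^ 2 * ε) {e s : ℕ → ℝ≥0∞}
    (h0 : e 0 ≤ ENNReal.ofReal (R ^ 2))
    (hs : ∀ t, s t ≤ ENNReal.ofReal a * e t + ENNReal.ofReal b)
    (he : ∀ t, e (t + 1) ≤ ENNReal.ofReal (θ / (θ + μ)) * e t
      + ENNReal.ofReal ((θ + μ) / μ) * s t) (t : ℕ) :
    e t ≤ ENNReal.ofReal ((θ / (θ + μ)) ^ t * R ^ 2 + ε / 4)
      ∧ s t ≤ ENNReal.ofReal ((μ / (2 * (θ + μ))) ^ 2 * ε) := by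
  have hθμ : 0 < θ + μ := by positivity
  have hq0 : 0 ≤ θ / (θ + μ) := by positivity
  have hq1 : θ / (θ + μ) ≤ 1 := by rw [div_le_one hθμ]; linarith
  have key : ∀ t, e t ≤ ENNReal.ofReal ((θ / (θ + μ)) ^ t * R ^ 2 + ε / 4) →
      s t ≤ ENNReal.ofReal ((μ / (2 * (θ + μ))) ^ 2 * ε) := fun t ht => by
    have h1 : e t ≤ ENNReal.ofReal (R ^ 2 + ε) := by
      refine ht.trans (ENNReal.ofReal_le_ofReal ?_)
      have : (θ / (θ + μ)) ^ t * R ^ 2 ≤ 1 * R ^ 2 := by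
        gcongr; exact pow_le_one₀ hq0 hq1
      linarith
    calc _ ≤ ENNReal.ofReal a * ENNReal.ofReal (R ^ 2 + ε) + ENNReal.ofReal b :=
          (hs t).trans (by gcongr)
      _ = ENNReal.ofReal (a * (R ^ 2 + ε) + b) := by
          rw [← ENNReal.ofReal_mul ha, ← ENNReal.ofReal_add (by positivity) hb]
      _ ≤ _ := ENNReal.ofReal_le_ofReal hacc
  have main : ∀ t, e t ≤ ENNReal.ofReal ((θ / (θ + μ)) ^ t * R ^ 2 + ε / 4) := fun t => by
    induction t with
    | zero =>
      refine h0.trans (ENNReal.ofReal_le_ofReal ?_)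
      rw [pow_zero, one_mul]; linarith
    | succ t ih =>
      calc _ ≤ ENNReal.ofReal (θ / (θ + μ)) * ENNReal.ofReal ((θ / (θ + μ)) ^ t * R ^ 2 + ε / 4)
            + ENNReal.ofReal ((θ + μ) / μ) * ENNReal.ofReal ((μ / (2 * (θ + μ))) ^ 2 * ε) :=
            (he t).trans (by gcongr; exact key t ih)
        -- Since `((θ+μ)/μ) (μ/(2(θ+μ)))² = (1 - q)/4` with `q = θ/(θ+μ)`, the offset `ε/4`
        -- reproduces itself.
        _ = _ := by
            rw [← ENNReal.ofReal_mul hq0, ← ENNReal.ofReal_mul (by positivity),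
              ← ENNReal.ofReal_add (by positivity) (by positivity),
              pow_succ' (θ / (θ + μ)), mul_assoc]
            generalize (θ / (θ + μ)) ^ t * R ^ 2 = y
            congr 1
            field_simp
            ring
  exact ⟨main t, key t (main t)⟩

/-- SCAFFOLD-Catalyst-S is accurate whenever SCAFFOLD-S contracts its potential fast enough. -/
theorem catalyst_accuracy [IsProbabilityMeasure P] (hn : 0 < n) (hf : ∀ i, Differentiable ℝ (f i))
    (hG : Measurable (gradMap (global f))) (hGhat : ∀ i, Measurable (Function.uncurry (Ghat i)))
    (hW : IsDriver p D P W) {μ ε R : ℝ} (hμ0 : 0 < μ) (hε : 0 < ε)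
    (hμ : ∀ z w, μ * ‖z - w‖ ^ 2
      ≤ inner ℝ (gradMap (global f) z - gradMap (global f) w) (z - w))
    (hzs : gradMap (global f) zs = 0) (hR : ‖z0 - zs‖ ≤ R) {J : Z m d → Z m d}
    (hJ : ∀ u, gradMap (global f) (J u) + c.θ • (J u - u) = 0) {lam r b A : ℝ}
    (hlam : 0 ≤ lam) (hr0 : 0 < r) (hr1 : r < 1) (hb : 0 ≤ b) (hA : 0 ≤ A) (hρ : c.ρ = r / 2)
    (hout : ∀ u s, IsConsistent c.γl s →
      ‖avg s.iter - J u‖ ^ 2 ≤ A * potential (n := n) c.γg lam (J u) s)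
    (hstep : ContractsPotential f Ghat c p D J lam r b)
    (hacc : 8 * A * r ^ c.K * (R ^ 2 + ε) + A * (b / (1 - r))
      ≤ (μ / (2 * (c.θ + μ))) ^ 2 * ε) (t : ℕ) :
    ∫⁻ ω, ENNReal.ofReal (‖metaIterate f Ghat c z0 W t ω - zs‖ ^ 2) ∂P
        ≤ ENNReal.ofReal ((c.θ / (c.θ + μ)) ^ t * R ^ 2 + ε / 4)
      ∧ ∫⁻ ω, ENNReal.ofReal (‖metaIterate f Ghat c z0 W (t + 1) ω
        - J (metaIterate f Ghat c z0 W t ω)‖ ^ 2) ∂P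
        ≤ ENNReal.ofReal ((μ / (2 * (c.θ + μ))) ^ 2 * ε) := by
  have hθ := c.θ_nonneg
  have hθμ : 0 < c.θ + μ := by positivity
  have hq1 : c.θ / (c.θ + μ) ≤ 1 := by rw [div_le_one hθμ]; linarith
  have hr : 0 < 1 - r := by linarith
  have hJlip : ∀ u v, ‖J u - J v‖ ≤ c.θ / (c.θ + μ) * ‖u - v‖ := fun u v =>
    resolvent_norm_sub_le hμ0 hθ hμ (hJ u) (hJ v)
  have hJmeas : Measurable J :=
    (LipschitzWith.of_dist_le_mul (K := ⟨c.θ / (c.θ + μ), by positivity⟩) fun u v => by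
      rw [dist_eq_norm, dist_eq_norm]; exact hJlip u v).continuous.measurable
  have hJzs : ∀ u, ‖J u - zs‖ ≤ c.θ / (c.θ + μ) * ‖u - zs‖ := fun u =>
    resolvent_norm_sub_le hμ0 hθ hμ (hJ u) (by rw [hzs, sub_self, smul_zero, add_zero])
  have hz := fun t => measurable_metaIterate (c := c) (z0 := z0) hn hf hG hGhat hW.measurable t
  have hmz : ∀ t, Measurable fun ω =>
      ENNReal.ofReal (‖metaIterate f Ghat c z0 W t ω - zs‖ ^ 2) := fun t =>
    (((hz t).sub_const zs).norm.pow_const 2).ennreal_ofReal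
  refine catalyst_recursion (a := 8 * A * r ^ c.K) (b := A * (b / (1 - r)))
    (e := fun t => ∫⁻ ω, ENNReal.ofReal (‖metaIterate f Ghat c z0 W t ω - zs‖ ^ 2) ∂P)
    (s := fun t => ∫⁻ ω, ENNReal.ofReal (‖metaIterate f Ghat c z0 W (t + 1) ω
        - J (metaIterate f Ghat c z0 W t ω)‖ ^ 2) ∂P)
    hθ hμ0 hε (by positivity) (by positivity) hacc ?_ (fun t => ?_) (fun t => ?_) t
  · have : ∀ ω, metaIterate f Ghat c z0 W 0 ω = z0 := fun ω => rfl
    simp_rw [this]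
    rw [lintegral_const, measure_univ, mul_one]
    gcongr
  · refine (lintegral_metaIterate_succ_sub_le hn hf hG hGhat hW hJmeas hlam hr0 hr1 hb hA hρ hout
      hstep t).trans (add_le_add ?_ le_rfl)
    calc _ ≤ ENNReal.ofReal (2 * A * r ^ c.K) * ∫⁻ ω, ENNReal.ofReal 4 *
          ENNReal.ofReal (‖metaIterate f Ghat c z0 W t ω - zs‖ ^ 2) ∂P := by
          gcongr with ω
          rw [← ENNReal.ofReal_mul (by norm_num)]
          refine ENNReal.ofReal_le_ofReal ?_
          set z := metaIterate f Ghat c z0 W t ω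
          -- The warm start: the initial error of a subproblem is controlled by the current outer
          -- error. Squaring gives the factor 4 that turns `2A` into `8A`.
          have h1 : ‖z - J z‖ ≤ 2 * ‖z - zs‖ := by
            have h2 : c.θ / (c.θ + μ) * ‖z - zs‖ ≤ 1 * ‖z - zs‖ := by gcongr
            calc ‖z - J z‖ = ‖(z - zs) - (J z - zs)‖ := by congr 1; abel
              _ ≤ _ := (norm_sub_le _ _).trans (by linarith [hJzs z])
          calc _ ≤ (2 * ‖z - zs‖) ^ 2 := by gcongr
            _ = _ := by ring
      _ = _ := by
          rw [lintegral_const_mul _ (hmz t), ← mul_assoc, ← ENNReal.ofReal_mul (by positivity)]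
          congr 2; ring
  · have hmJ : Measurable fun ω => ENNReal.ofReal (‖metaIterate f Ghat c z0 W (t + 1) ω
        - J (metaIterate f Ghat c z0 W t ω)‖ ^ 2) :=
      (((hz (t + 1)).sub (hJmeas.comp (hz t))).norm.pow_const 2).ennreal_ofReal
    rw [← lintegral_const_mul _ (hmz t), ← lintegral_const_mul _ hmJ,
      ← lintegral_add_left ((hmz t).const_mul _)]
    refine lintegral_mono fun ω => ?_
    rw [← ENNReal.ofReal_mul (by positivity), ← ENNReal.ofReal_mul (by positivity),
      ← ENNReal.ofReal_add (by positivity) (by positivity)]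
    exact ENNReal.ofReal_le_ofReal (norm_sub_sq_le_of_resolvent hθ hμ0 (hJzs _))

lemma integrable_and_integral_le_of_lintegral_le {Ω : Type*} [MeasurableSpace Ω] {P : Measure Ω}
    {φ : Ω → ℝ} (hφ : Measurable φ) (h0 : ∀ ω, 0 ≤ φ ω) {B : ℝ} (hB : 0 ≤ B)
    (h : ∫⁻ ω, ENNReal.ofReal (φ ω) ∂P ≤ ENNReal.ofReal B) :
    Integrable φ P ∧ ∫ ω, φ ω ∂P ≤ B := by
  constructor
  · refine ⟨hφ.aestronglyMeasurable, ?_⟩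
    rw [hasFiniteIntegral_iff_ofReal (Filter.Eventually.of_forall h0)]
    exact h.trans_lt ENNReal.ofReal_lt_top
  · rw [integral_eq_lintegral_of_nonneg_ae (Filter.Eventually.of_forall h0)
      hφ.aestronglyMeasurable]
    exact ENNReal.toReal_le_of_le_ofReal hB h

lemma expectedRounds_eq (hW : IsDriver p D P W) :
    expectedRounds c P W = ENNReal.ofReal (c.T * (c.K * p)) := by
  have hmeas : ∀ t k, MeasurableSet {ω | (W t k ω).1 = true} := fun t k =>
    (measurable_fst.comp (hW.measurable t k)) (measurableSet_singleton true)
  have h1 : ∀ t k, ∫⁻ ω, (if (W t k ω).1 = true then (1 : ℝ≥0∞) else 0) ∂P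
      = ENNReal.ofReal p := fun t k => by
    have hm : Measurable fun w : Bool × (Fin n → Ξ) => if w.1 = true then (1 : ℝ≥0∞) else 0 :=
      Measurable.ite (measurable_fst (measurableSet_singleton true)) measurable_const
        measurable_const
    rw [← lintegral_map (f := fun w : Bool × (Fin n → Ξ) => if w.1 = true then (1 : ℝ≥0∞) else 0)
      hm (hW.measurable t k), hW.law t k, lintegral_bernoulli_prod p hm]
    simp
  have h2 : ∀ t k, Measurable fun ω => if (W t k ω).1 = true then (1 : ℝ≥0∞) else 0 := fun t k =>
    Measurable.ite (hmeas t k) measurable_const measurable_const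
  unfold expectedRounds syncRounds
  push_cast
  rw [lintegral_finsetSum _ fun t _ => Finset.measurable_fun_sum _ fun k _ => h2 t k]
  simp_rw [lintegral_finsetSum _ fun k _ => h2 _ k, h1]
  simp only [Finset.sum_const, Finset.card_range, nsmul_eq_mul]
  rw [ENNReal.ofReal_mul (by positivity), ENNReal.ofReal_mul (by positivity),
    ENNReal.ofReal_natCast, ENNReal.ofReal_natCast]

end Catalyst

/-! ### The contraction for the two choices of parameters. -/

section Rates

variable {n m d : ℕ}

/-- The regularizer adds `θ` to both constants. For `θ = β` their ratio `3β/(μ+β)` is at most 3. -/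
lemma isRegularFamily_regularize {β μ θ : ℝ} (hβ : 0 ≤ β) (hθ : 0 ≤ θ)
    {f : Fin n → Z m d → ℝ} (hs : ∀ i, IsSmooth β (f i))
    (hc : ∀ i, IsStronglyConvexConcave μ (f i)) (u : Z m d) :
    IsRegularFamily (2 * β + θ) (μ + θ) fun i => regularize θ u (f i) := by
  have hd : ∀ i z w, gradMap (regularize θ u (f i)) z - gradMap (regularize θ u (f i)) w
      = (gradMap (f i) z - gradMap (f i) w) + θ • (z - w) := fun i z w => by
    rw [gradMap_regularize (hs i).differentiable, gradMap_regularize (hs i).differentiable]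
    module
  refine ⟨fun i z w => ?_, fun i z w => ?_,
    gradMap_global fun i => differentiable_regularize (hs i).differentiable θ u⟩
  · rw [hd]
    refine (norm_add_le _ _).trans ?_
    rw [norm_smul, Real.norm_of_nonneg hθ, add_mul]
    gcongr
    exact (hs i).norm_gradMap_sub_le hβ z w
  · rw [hd, inner_add_left, inner_smul_left, real_inner_self_eq_norm_sq, add_mul]
    gcongr
    · exact (hc i).inner_gradMap_sub_ge z w
    · simp

lemma exists_resolvent (hn : 0 < n) {β μ θ : ℝ} (hμ : 0 < μ) (hμβ : μ ≤ β) (hθ : 0 ≤ θ)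
    {f : Fin n → Z m d → ℝ} (hs : ∀ i, IsSmooth β (f i))
    (hc : ∀ i, IsStronglyConvexConcave μ (f i)) :
    ∃ J : Z m d → Z m d, ∀ u, gradMap (global f) (J u) + θ • (J u - u) = 0 := by
  have : ∀ u, ∃ z, gradMap (global f) z + θ • (z - u) = 0 := fun u => by
    have hF := isRegularFamily_regularize (hμ.le.trans hμβ) hθ hs hc u
    obtain ⟨z, hz⟩ := exists_zero_of_stronglyMonotone (A := fun z => avg fun i =>
      gradMap (regularize θ u (f i)) z) (by linarith) (by linarith)
      (norm_avg_operator_sub_le hn hF.lipschitz) (inner_avg_operator_sub_ge hn hF.monotone)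
    refine ⟨z, ?_⟩
    rw [← gradMap_global_regularize hn fun i => (hs i).differentiable, hF.gradMap_global]
    exact hz
  choose J hJ using this
  exact ⟨J, hJ⟩

lemma regularize_zero (u : Z m d) (g : Z m d → ℝ) : regularize 0 u g = g := by
  funext z; simp [regularize]

lemma regularizeOracle_zero {Ξ : Type*} (u : Z m d) (Gh : Z m d → Ξ → Z m d) :
    regularizeOracle 0 u Gh = Gh := by
  funext z ξ; simp [regularizeOracle]

variable {Ξ : Type*} [MeasurableSpace Ξ] {D : Fin n → Measure Ξ} [∀ i, IsProbabilityMeasure (D i)]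
  {f : Fin n → Z m d → ℝ} {Ghat : Fin n → Z m d → Ξ → Z m d} {c : CatalystParams}
  {p : unitInterval} {β μ σ ζ γ : ℝ} {J : Z m d → Z m d}

lemma contractsPotential_of_no_localSteps (hn : 0 < n) (hp : 0 < (p : ℝ)) (hμ : 0 < μ)
    (hμβ : μ ≤ β) (hs : ∀ i, IsSmooth β (f i)) (hc : ∀ i, IsStronglyConvexConcave μ (f i))
    (hGhat : ∀ i, Measurable (Function.uncurry (Ghat i))) (hG : Measurable (gradMap (global f)))
    (hJ : ∀ u, gradMap (global f) (J u) + c.θ • (J u - u) = 0)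
    (hθ : c.θ = β) (hγl : c.γl = 0) (hγg : c.γg = p / (48 * (2 * β + β))) :
    ContractsPotential f Ghat c p D J (1 / 2) (1 - p / 576) 0 := by
  intro u s hs'
  have hmeas := measurable_potential_scaffoldStep_const (c := c) hn (fun i => (hs i).differentiable)
    hG hGhat (1 / 2) u (J u) s
  have hF := isRegularFamily_regularize (hμ.le.trans hμβ) (hμ.le.trans hμβ) hs hc u
  have hu := hJ u
  rw [← gradMap_global_regularize hn fun i => (hs i).differentiable] at hu
  rw [hθ, hγl, hγg] at *
  rw [add_zero]
  exact lintegral_potential_scaffoldStep_zero_le hn p hp hF (by linarith) (by linarith)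
    (by linarith) hu hs' hmeas

/-- The mean of the clients is the anchor, not the virtual iterate. The drift is their squared
distance, so passing from one to the other costs the factor 4. -/
lemma norm_avg_iter_sub_sq_le_of_no_localSteps (hn : 0 < n) {γg : ℝ} (u : Z m d)
    {s : ScaffoldState n m d} (hs : IsConsistent 0 s) :
    ‖avg s.iter - u‖ ^ 2 ≤ 4 * potential γg (1 / 2) u s := by
  have h1 : s.iter = fun _ => s.anchor := funext fun i => by rw [hs i]; simp
  have h2 : clientDrift γg s = ‖s.anchor - virtualIterate γg s‖ ^ 2 := by
    unfold clientDrift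
    rw [h1, avg_const hn]
  rw [h1, avg_const hn, potential, h2]
  have := norm_add_sq_le_two (s.anchor - virtualIterate γg s) (virtualIterate γg s - u)
  rw [sub_add_sub_cancel] at this
  linarith [sq_nonneg ‖virtualIterate γg s - u‖]

lemma contractsPotential_of_equal_stepsizes (hn : 0 < n) (hp : 0 < (p : ℝ)) (hμ : 0 < μ)
    (hμβ : μ ≤ β) (hs : ∀ i, IsSmooth β (f i)) (hc : ∀ i, IsStronglyConvexConcave μ (f i))
    (hζ : ∀ i j z, ‖gradMap (f i) z - gradMap (f j) z‖ ≤ ζ)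
    (hO : ∀ i, IsOracle σ (f i) (D i) (Ghat i)) (hG : Measurable (gradMap (global f)))
    (hJ : ∀ u, gradMap (global f) (J u) + c.θ • (J u - u) = 0)
    (hθ : c.θ = 0) (hγl : c.γl = γ) (hγg : c.γg = γ) (hγ0 : 0 ≤ γ)
    (hγ : γ ≤ μ / (4 * (2 * β) ^ 2)) :
    ContractsPotential f Ghat c p D J (8 * γ * (2 * β) ^ 2 / (μ * p)) (1 - γ * μ / 2)
      (4 * γ ^ 2 * σ ^ 2 / n + 8 * γ * (2 * β) ^ 2 / (μ * p)
        * (16 * γ ^ 2 * ζ ^ 2 / p + 4 * γ ^ 2 * σ ^ 2)) := by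
  intro u s hs'
  have hmeas := measurable_potential_scaffoldStep_const (c := c) hn (fun i => (hs i).differentiable)
    hG (fun i => (hO i).measurable) (8 * γ * (2 * β) ^ 2 / (μ * p)) u (J u) s
  have hF := isRegularFamily_regularize (hμ.le.trans hμβ) le_rfl hs hc u
  have hu := hJ u
  rw [hθ, zero_smul, add_zero] at hu
  rw [hγl] at hs'
  rw [hθ, hγl, hγg] at *
  simp only [regularize_zero, regularizeOracle_zero, add_zero] at *
  exact lintegral_potential_scaffoldStep_le hn p hp hF hμ (by linarith) hζ hO hγ0 hγ hu hs' hmeas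

lemma norm_avg_iter_sub_sq_le_of_equal_stepsizes (hn : 0 < n) {lam : ℝ} (hlam : 0 ≤ lam)
    (u : Z m d) {s : ScaffoldState n m d} (hs : IsConsistent γ s) :
    ‖avg s.iter - u‖ ^ 2 ≤ 1 * potential γ lam u s := by
  have : avg s.iter = virtualIterate γ s := by
    rw [virtualIterate, funext hs, avg_sub, avg_const hn, avg_smul]
  rw [this, one_mul, potential]
  linarith [mul_nonneg hlam (clientDrift_nonneg γ s)]

end Rates

/-! ### From contraction to the prescribed accuracies. -/

section Accuracy

variable {n m d : ℕ} {Ξ Ω : Type*} [MeasurableSpace Ξ] [MeasurableSpace Ω] {P : Measure Ω}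
  [IsProbabilityMeasure P] {p : unitInterval} {D : Fin n → Measure Ξ}
  [∀ i, IsProbabilityMeasure (D i)] {W : ℕ → ℕ → Ω → Bool × (Fin n → Ξ)}
  {f : Fin n → Z m d → ℝ} {Ghat : Fin n → Z m d → Ξ → Z m d} {c : CatalystParams} {z0 zs : Z m d}
  {β μ σ ε R : ℝ}

/-- The subproblems and the original problem are solved to the prescribed accuracies. -/
def IsAccurate {n m d : ℕ} {Ξ Ω : Type*} [MeasurableSpace Ω] (f : Fin n → Z m d → ℝ)
    (Ghat : Fin n → Z m d → Ξ → Z m d) (c : CatalystParams) (z0 zs : Z m d) (P : Measure Ω)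
    (W : ℕ → ℕ → Ω → Bool × (Fin n → Ξ)) (μ ε : ℝ) : Prop :=
  (∀ prox : Z m d → Z m d,
    (∀ u, IsMinimaxOptimal (regularize c.θ u (global f)) (prox u)) → ∀ t < c.T,
      Integrable (fun ω => ‖metaIterate f Ghat c z0 W (t + 1) ω
        - prox (metaIterate f Ghat c z0 W t ω)‖ ^ 2) P ∧
      ∫ ω, ‖metaIterate f Ghat c z0 W (t + 1) ω
        - prox (metaIterate f Ghat c z0 W t ω)‖ ^ 2 ∂P ≤ (μ / (2 * (c.θ + μ))) ^ 2 * ε) ∧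
  Integrable (fun ω => ‖metaIterate f Ghat c z0 W c.T ω - zs‖ ^ 2) P ∧
  ∫ ω, ‖metaIterate f Ghat c z0 W c.T ω - zs‖ ^ 2 ∂P ≤ ε

lemma measurable_gradMap_global (hn : 0 < n) (hβ : 0 ≤ β) (hs : ∀ i, IsSmooth β (f i)) :
    Measurable (gradMap (global f)) := by
  refine (LipschitzWith.of_dist_le_mul (K := ⟨2 * β, by positivity⟩) fun z w => ?_).continuous.measurable
  rw [dist_eq_norm, dist_eq_norm, gradMap_global fun i => (hs i).differentiable,
    gradMap_global fun i => (hs i).differentiable]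
  exact norm_avg_operator_sub_le hn (fun i => (hs i).norm_gradMap_sub_le hβ) z w

/-- The common interface of the two cases. `hacc` asks for enough inner iterations and a small
stationary error. `hT` asks for enough meta-iterations: its `3ε/4` and the `ε/4` from the inexact
subproblems add up to `ε`. -/
theorem isAccurate_of_contractsPotential (hn : 0 < n) (hμ : 0 < μ) (hμβ : μ ≤ β) (hε : 0 < ε)
    (hs : ∀ i, IsSmooth β (f i)) (hc : ∀ i, IsStronglyConvexConcave μ (f i))
    (hO : ∀ i, IsOracle σ (f i) (D i) (Ghat i)) (hzs : IsMinimaxOptimal (global f) zs)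
    (hR : ‖z0 - zs‖ ≤ R) (hW : IsDriver p D P W) {lam r b A : ℝ}
    (hlam : 0 ≤ lam) (hr0 : 0 < r) (hr1 : r < 1) (hb : 0 ≤ b) (hA : 0 ≤ A) (hρ : c.ρ = r / 2)
    (hout : ∀ u s, IsConsistent c.γl s →
      ‖avg s.iter - u‖ ^ 2 ≤ A * potential (n := n) (m := m) (d := d) c.γg lam u s)
    (hstep : ∀ J : Z m d → Z m d, (∀ u, gradMap (global f) (J u) + c.θ • (J u - u) = 0) →
      ContractsPotential f Ghat c p D J lam r b)
    (hacc : 8 * A * r ^ c.K * (R ^ 2 + ε) + A * (b / (1 - r)) ≤ (μ / (2 * (c.θ + μ))) ^ 2 * ε)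
    (hT : (c.θ / (c.θ + μ)) ^ c.T * R ^ 2 ≤ 3 / 4 * ε) :
    IsAccurate f Ghat c z0 zs P W μ ε := by
  have hβ : 0 ≤ β := hμ.le.trans hμβ
  have hdiff := fun i => (hs i).differentiable
  have hG := measurable_gradMap_global hn hβ hs
  have hGhat := fun i => (hO i).measurable
  have hmono : ∀ z w, μ * ‖z - w‖ ^ 2
      ≤ inner ℝ (gradMap (global f) z - gradMap (global f) w) (z - w) := fun z w => by
    rw [gradMap_global hdiff, gradMap_global hdiff]
    exact inner_avg_operator_sub_ge hn (fun i => (hc i).inner_gradMap_sub_ge) z w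
  obtain ⟨J, hJ⟩ := exists_resolvent hn hμ hμβ c.θ_nonneg hs hc
  have hzs' := gradMap_eq_zero_of_isMinimaxOptimal (differentiable_global hdiff) hzs
  have key := catalyst_accuracy hn hdiff hG hGhat hW hμ hε hmono hzs' hR hJ hlam hr0 hr1 hb hA hρ
    (fun u s => hout (J u) s) (hstep J hJ) hacc
  have hz := fun t => measurable_metaIterate (c := c) (z0 := z0) hn hdiff hG hGhat hW.measurable t
  refine ⟨fun prox hprox t _ => ?_, ?_⟩
  · have hp : ∀ u, gradMap (global f) (prox u) + c.θ • (prox u - u) = 0 := fun u => by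
      rw [← gradMap_regularize (differentiable_global hdiff)]
      exact gradMap_eq_zero_of_isMinimaxOptimal
        (differentiable_regularize (differentiable_global hdiff) _ _) (hprox u)
    have hlip : ∀ u v, ‖prox u - prox v‖ ≤ c.θ / (c.θ + μ) * ‖u - v‖ := fun u v =>
      resolvent_norm_sub_le hμ c.θ_nonneg hmono (hp u) (hp v)
    -- Equal centers in the resolvent bound: the proximal point is unique.
    have hpJ : prox = J := funext fun u => by
      have := resolvent_norm_sub_le hμ c.θ_nonneg hmono (hp u) (hJ u)
      rw [sub_self, norm_zero, mul_zero] at this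
      exact sub_eq_zero.1 (norm_le_zero_iff.1 this)
    have hθμ : 0 < c.θ + μ := add_pos_of_nonneg_of_pos c.θ_nonneg hμ
    have hpm : Measurable prox :=
      (LipschitzWith.of_dist_le_mul (K := ⟨c.θ / (c.θ + μ), div_nonneg c.θ_nonneg hθμ.le⟩)
        fun u v => by rw [dist_eq_norm, dist_eq_norm]; exact hlip u v).continuous.measurable
    refine integrable_and_integral_le_of_lintegral_le
      (((hz (t + 1)).sub (hpm.comp (hz t))).norm.pow_const 2) (fun ω => by positivity)
      (by positivity) ?_
    rw [hpJ]
    exact (key t).2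
  · refine integrable_and_integral_le_of_lintegral_le
      (((hz c.T).sub_const zs).norm.pow_const 2) (fun ω => by positivity) hε.le
      ((key c.T).1.trans (ENNReal.ofReal_le_ofReal ?_))
    linarith

end Accuracy

/-! ### Numerical estimates for the parameters. -/

section Parameters

lemma one_sub_pow_ceil_le {x S : ℝ} (hx0 : 0 < x) (hx1 : x ≤ 1) (hS : 0 < S) (j : ℕ) :
    (1 - x) ^ ⌈j * Real.log S / x⌉₊ ≤ (S ^ j)⁻¹ := by
  have h1 : (1 - x) ^ ⌈j * Real.log S / x⌉₊ ≤ Real.exp (-x) ^ ⌈j * Real.log S / x⌉₊ :=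
    pow_le_pow_left₀ (by linarith) (Real.one_sub_le_exp_neg x) _
  refine h1.trans ?_
  rw [← Real.exp_nat_mul, ← Real.exp_log (pow_pos hS j), ← Real.exp_neg, Real.log_pow]
  refine Real.exp_le_exp.2 ?_
  have := Nat.le_ceil (j * Real.log S / x)
  rw [div_le_iff₀ hx0] at this
  linarith

lemma ceil_div_le {a x B : ℝ} (ha : 0 ≤ a) (hx0 : 0 < x) (hB : a / x + 1 ≤ B) :
    (⌈a / x⌉₊ : ℝ) ≤ B :=
  (Nat.ceil_lt_add_one (by positivity)).le.trans hB

/-- The argument of the logarithm in the rate. -/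
def logArg (β μ ε R : ℝ) : ℝ := 2 + β / μ + R ^ 2 / ε

variable {β μ ε R : ℝ}

lemma three_le_logArg (hμ : 0 < μ) (hμβ : μ ≤ β) (hε : 0 < ε) : 3 ≤ logArg β μ ε R := by
  have h1 : 1 ≤ β / μ := (one_le_div hμ).2 hμβ
  have h2 : 0 ≤ R ^ 2 / ε := by positivity
  unfold logArg; linarith

lemma one_le_log_logArg (hμ : 0 < μ) (hμβ : μ ≤ β) (hε : 0 < ε) :
    1 ≤ Real.log (logArg β μ ε R) := by
  have h3 := three_le_logArg (R := R) hμ hμβ hε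
  rw [Real.le_log_iff_exp_le (by linarith)]
  linarith [Real.exp_one_lt_d9]

/-- The initial error costs one power of the argument `S` of the logarithm; iteration counts
proportional to `j log S` remove `j` powers. -/
lemma sq_add_le_mul_logArg (hμ : 0 < μ) (hμβ : μ ≤ β) (hε : 0 < ε) :
    R ^ 2 + ε ≤ ε * logArg β μ ε R := by
  have h1 : 1 ≤ β / μ := (one_le_div hμ).2 hμβ
  have h2 : ε * logArg β μ ε R = 2 * ε + ε * (β / μ) + R ^ 2 := by unfold logArg; field_simp
  rw [h2]
  nlinarith

/-- The parameters for the rate `β / μ`: without local steps the noise of the oracles cancels. -/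
def paramsNoLocalSteps (p : unitInterval) (β μ ε R : ℝ) (hp : 0 < (p : ℝ)) (hβ : 0 < β) :
    CatalystParams where
  θ := β
  γl := 0
  γg := p / (48 * (2 * β + β))
  ρ := (1 - p / 576) / 2
  T := ⌈(2 : ℕ) * Real.log (logArg β μ ε R) / (μ / (β + μ))⌉₊
  K := ⌈(9 : ℕ) * Real.log (logArg β μ ε R) / (p / 576)⌉₊
  θ_nonneg := hβ.le
  γl_nonneg := le_rfl
  γg_pos := by positivity
  ρ_pos := by linarith [p.2.2]
  ρ_lt_one := by linarith

/-- The parameters for the second term of the rate: no regularization and equal stepsizes. -/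
def paramsEqualStepsizes (γ μ S : ℝ) (hγ : 0 < γ) (hμ : 0 < μ) (hγμ : γ * μ ≤ 1) :
    CatalystParams where
  θ := 0
  γl := γ
  γg := γ
  ρ := (1 - γ * μ / 2) / 2
  T := 1
  K := ⌈(6 : ℕ) * Real.log S / (γ * μ / 2)⌉₊
  θ_nonneg := le_rfl
  γl_nonneg := hγ.le
  γg_pos := hγ
  ρ_pos := by linarith
  ρ_lt_one := by linarith [mul_pos hγ hμ]

section NoLocalSteps

variable {p : unitInterval} (hp : 0 < (p : ℝ)) (hμ : 0 < μ) (hμβ : μ ≤ β) (hε : 0 < ε)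

include hμ hμβ hε in
-- The exponent 9 in `K`: one power of `S` pays for `R² + ε`, two for the accuracy `(μ/(2(β+μ)))² ≥
-- 1/(16S²)`, and six for the constants, by `512 ≤ 3⁶ ≤ S⁶`.
lemma accuracy_noLocalSteps :
    8 * 4 * (1 - (p : ℝ) / 576) ^ (paramsNoLocalSteps p β μ ε R hp (hμ.trans_le hμβ)).K
        * (R ^ 2 + ε) + 4 * (0 / (1 - (1 - (p : ℝ) / 576)))
      ≤ (μ / (2 * (β + μ))) ^ 2 * ε := by
  have hβ : 0 < β := hμ.trans_le hμβ
  have hS := three_le_logArg (R := R) hμ hμβ hε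
  have hsq := sq_add_le_mul_logArg (R := R) hμ hμβ hε
  have hK := one_sub_pow_ceil_le (x := (p : ℝ) / 576) (by positivity) (by linarith [p.2.2])
    (S := logArg β μ ε R) (by linarith) 9
  have hκS : β / μ ≤ logArg β μ ε R := by
    have : 0 ≤ R ^ 2 / ε := by positivity
    unfold logArg; linarith
  have hδ : (1 / (4 * logArg β μ ε R)) ^ 2 ≤ (μ / (2 * (β + μ))) ^ 2 := by
    refine pow_le_pow_left₀ (by positivity) ?_ 2
    rw [div_le_div_iff₀ (by linarith) (by positivity)]
    rw [div_le_iff₀ hμ] at hκS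
    nlinarith
  set S := logArg β μ ε R with hSdef
  have hS0 : 0 < S := by linarith
  have e1 : (paramsNoLocalSteps p β μ ε R hp (hμ.trans_le hμβ)).K
    = ⌈(9 : ℕ) * Real.log S / (p / 576)⌉₊ := rfl
  rw [e1, zero_div, mul_zero, add_zero]
  calc _ ≤ 8 * 4 * (S ^ 9)⁻¹ * (ε * S) := by
        gcongr
    _ = 32 * ε / S ^ 8 := by field_simp; norm_num
    _ ≤ (1 / (4 * S)) ^ 2 * ε := by
        have : (1 / (4 * S)) ^ 2 * ε = ε / (16 * S ^ 2) := by field_simp; norm_num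
        rw [this, div_le_div_iff₀ (by positivity) (by positivity)]
        have h6 : (3 : ℝ) ^ 6 ≤ S ^ 6 := by gcongr
        have : 512 * (ε * S ^ 2) ≤ S ^ 6 * (ε * S ^ 2) := by
          gcongr; linarith
        linarith
    _ ≤ _ := by gcongr

include hμ hμβ hε in
lemma meta_accuracy_noLocalSteps :
    (β / (β + μ)) ^ (paramsNoLocalSteps p β μ ε R hp (hμ.trans_le hμβ)).T * R ^ 2
      ≤ 3 / 4 * ε := by
  have hβ : 0 < β := hμ.trans_le hμβ
  have hS := three_le_logArg (R := R) hμ hμβ hε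
  have hsq := sq_add_le_mul_logArg (R := R) hμ hμβ hε
  have hT := one_sub_pow_ceil_le (x := μ / (β + μ)) (by positivity)
    (by rw [div_le_one (by positivity)]; linarith) (S := logArg β μ ε R) (by linarith) 2
  set S := logArg β μ ε R with hSdef
  have e1 : (paramsNoLocalSteps p β μ ε R hp (hμ.trans_le hμβ)).T
    = ⌈(2 : ℕ) * Real.log S / (μ / (β + μ))⌉₊ := rfl
  have e2 : β / (β + μ) = 1 - μ / (β + μ) := by field_simp; ring
  have hS0 : 0 < S := by linarith
  rw [e1, e2]
  calc _ ≤ (S ^ 2)⁻¹ * (ε * S) := by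
        gcongr; linarith
    _ = ε / S := by field_simp
    _ ≤ ε / 3 := by gcongr
    _ ≤ _ := by linarith

include hp hμ hμβ hε in
-- `T` is at most `5 (β/μ) log` and `K p` at most `5185 log`, where 5185 is `9 · 576 + 1`. Hence
-- 30000 covers `5 · 5185 + 5`.
lemma rounds_noLocalSteps :
    ((paramsNoLocalSteps p β μ ε R hp (hμ.trans_le hμβ)).T : ℝ)
        + (paramsNoLocalSteps p β μ ε R hp (hμ.trans_le hμβ)).T
          * ((paramsNoLocalSteps p β μ ε R hp (hμ.trans_le hμβ)).K * p)
      ≤ 30000 * Real.log (logArg β μ ε R) ^ 2 * (β / μ) := by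
  have hβ : 0 < β := hμ.trans_le hμβ
  have hκ : 1 ≤ β / μ := (one_le_div hμ).2 hμβ
  have hl := one_le_log_logArg (R := R) hμ hμβ hε
  have hp1 : (p : ℝ) ≤ 1 := p.2.2
  set l := Real.log (logArg β μ ε R) with hldef
  have hκl : 1 ≤ β / μ * l := one_le_mul_of_one_le_of_one_le hκ hl
  have hT : ((paramsNoLocalSteps p β μ ε R hp hβ).T : ℝ) ≤ 5 * (β / μ * l) := by
    refine ceil_div_le (by positivity) (by positivity) ?_
    have : ((2 : ℕ) : ℝ) * l / (μ / (β + μ)) = 2 * (β / μ * l) + 2 * l := by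
      push_cast; field_simp
    rw [this]
    nlinarith
  have hK : ((paramsNoLocalSteps p β μ ε R hp hβ).K : ℝ) ≤ 5185 * l / p := by
    refine ceil_div_le (by positivity) (by positivity) ?_
    have : ((9 : ℕ) : ℝ) * l / (p / 576) + 1 = (5184 * l + p) / p := by
      push_cast; field_simp; ring
    rw [this]
    gcongr
    linarith
  have hKp : ((paramsNoLocalSteps p β μ ε R hp hβ).K : ℝ) * p ≤ 5185 * l :=
    (le_div_iff₀ hp).1 hK
  have h1 : ((paramsNoLocalSteps p β μ ε R hp hβ).T : ℝ)
      * ((paramsNoLocalSteps p β μ ε R hp hβ).K * p) ≤ 5 * (β / μ * l) * (5185 * l) := by gcongr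
  have h2 : β / μ * l * 1 ≤ β / μ * l * l := by gcongr
  nlinarith

end NoLocalSteps

section EqualStepsizes

variable {n : ℕ} {p σ ζ : ℝ}

/-- The second term of the rate, for finite heterogeneity. -/
def localRate (n : ℕ) (p β μ σ ζ ε : ℝ) : ℝ :=
  p * β ^ 2 / μ ^ 2 + p * σ ^ 2 / (n * μ ^ 2 * ε) + √p * β * σ / (μ ^ 2 * √ε)
    + β / (μ ^ 2 * √ε) * ζ

variable (hn : 0 < n) (hp : 0 < p) (hμ : 0 < μ) (hμβ : μ ≤ β) (hσ : 0 ≤ σ) (hζ : 0 ≤ ζ)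
  (hε : 0 < ε)

include hn hp hμ hμβ hσ hζ hε in
lemma localRate_bounds :
    p * β ^ 2 / μ ^ 2 ≤ localRate n p β μ σ ζ ε
      ∧ p * σ ^ 2 / (n * μ ^ 2 * ε) ≤ localRate n p β μ σ ζ ε
      ∧ √p * β * σ / (μ ^ 2 * √ε) ≤ localRate n p β μ σ ζ ε
      ∧ β / (μ ^ 2 * √ε) * ζ ≤ localRate n p β μ σ ζ ε := by
  have hβ : 0 < β := hμ.trans_le hμβ
  have h1 : 0 ≤ p * β ^ 2 / μ ^ 2 := by positivity
  have h2 : 0 ≤ p * σ ^ 2 / (n * μ ^ 2 * ε) := by positivity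
  have h3 : 0 ≤ √p * β * σ / (μ ^ 2 * √ε) := by positivity
  have h4 : 0 ≤ β / (μ ^ 2 * √ε) * ζ := by positivity
  unfold localRate
  refine ⟨?_, ?_, ?_, ?_⟩ <;> linarith

include hn hp hμ hμβ hσ hζ hε in
lemma le_localRate : p ≤ localRate n p β μ σ ζ ε := by
  refine le_trans ?_ (localRate_bounds hn hp hμ hμβ hσ hζ hε).1
  rw [le_div_iff₀ (by positivity)]
  gcongr

include hn hp hμ hμβ hσ hζ hε in
/-- The stationary error of SCAFFOLD-S for the stepsize `p / (128 μ B)`. -/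
lemma stationary_error_le {γ : ℝ} (hγ : γ = p / (128 * μ * localRate n p β μ σ ζ ε)) :
    (4 * γ ^ 2 * σ ^ 2 / n + 8 * γ * (2 * β) ^ 2 / (μ * p)
        * (16 * γ ^ 2 * ζ ^ 2 / p + 4 * γ ^ 2 * σ ^ 2)) / (1 - (1 - γ * μ / 2))
      ≤ 9 / 64 * ε := by
  have hβ : 0 < β := hμ.trans_le hμβ
  obtain ⟨-, h2, h3, h4⟩ := localRate_bounds hn hp hμ hμβ hσ hζ hε
  have hB0 : 0 < localRate n p β μ σ ζ ε := hp.trans_le (le_localRate hn hp hμ hμβ hσ hζ hε)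
  set B := localRate n p β μ σ ζ ε
  have hγ0 : 0 < γ := by rw [hγ]; positivity
  have hγB : γ * (128 * μ * B) = p := by rw [hγ]; field_simp
  have hsε : √ε ^ 2 = ε := Real.sq_sqrt hε.le
  have hsp : √p ^ 2 = p := Real.sq_sqrt hp.le
  have hsε0 : 0 < √ε := Real.sqrt_pos.2 hε
  have hsp0 : 0 < √p := Real.sqrt_pos.2 hp
  have hn' : (0 : ℝ) < n := by positivity
  -- Each of `k2`, `k3`, `k4` uses one summand of the rate: noise of the mean direction, drift
  -- caused by noise, and drift caused by heterogeneity.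
  have k2 : γ * σ ^ 2 / (n * μ) ≤ ε / 128 := by
    rw [div_le_iff₀ (by positivity)] at h2 ⊢
    have : p * σ ^ 2 = 128 * μ * B * (γ * σ ^ 2) := by rw [← hγB]; ring
    rw [this] at h2
    have h2' : 128 * μ * B * (γ * σ ^ 2) ≤ 128 * μ * B * (ε / 128 * (n * μ)) := by
      refine h2.trans_eq ?_; ring
    exact le_of_mul_le_mul_left h2' (by positivity)
  have k3 : γ * β * σ / (μ * √p) ≤ √ε / 128 := by
    rw [div_le_iff₀ (by positivity)] at h3 ⊢
    have h3' : 128 * μ * B * (γ * β * σ) ≤ 128 * μ * B * (√ε / 128 * (μ * √p)) := by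
      calc _ = γ * (128 * μ * B) * β * σ := by ring
        _ = √p * (√p * β * σ) := by rw [hγB]; nth_rewrite 1 [← hsp]; ring
        _ ≤ √p * (B * (μ ^ 2 * √ε)) := by gcongr
        _ = _ := by ring
    exact le_of_mul_le_mul_left h3' (by positivity)
  have k4 : γ * β * ζ / (μ * p) ≤ √ε / 128 := by
    rw [div_mul_eq_mul_div, div_le_iff₀ (by positivity)] at h4
    rw [div_le_iff₀ (by positivity)]
    have h4' : 128 * μ * B * (γ * β * ζ) ≤ 128 * μ * B * (√ε / 128 * (μ * p)) := by
      calc _ = γ * (128 * μ * B) * (β * ζ) := by ring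
        _ = p * (β * ζ) := by rw [hγB]
        _ ≤ p * (B * (μ ^ 2 * √ε)) := by gcongr
        _ = _ := by ring
    exact le_of_mul_le_mul_left h4' (by positivity)
  have e : (4 * γ ^ 2 * σ ^ 2 / n + 8 * γ * (2 * β) ^ 2 / (μ * p)
        * (16 * γ ^ 2 * ζ ^ 2 / p + 4 * γ ^ 2 * σ ^ 2)) / (1 - (1 - γ * μ / 2))
      = 8 * (γ * σ ^ 2 / (n * μ)) + 1024 * (γ * β * ζ / (μ * p)) ^ 2
        + 256 * (γ * β * σ / (μ * √p)) ^ 2 := by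
    have : (1 - (1 - γ * μ / 2)) = γ * μ / 2 := by ring
    rw [this, div_pow (γ * β * σ), mul_pow μ, hsp]
    field_simp
    ring
  have k3' := pow_le_pow_left₀ (by positivity) k3 2
  have k4' := pow_le_pow_left₀ (by positivity) k4 2
  rw [div_pow (√ε), hsε] at k3' k4'
  rw [e]
  -- The three parts contribute `8/128`, `1024/128²` and `256/128²` of `ε`, together `9/64`.
  linarith

end EqualStepsizes

end Parameters

/-! ### The two guarantees and the choice between them. -/

section Main

variable {n m d : ℕ} {p : unitInterval} {β μ σ ε R : ℝ}

/-- The guarantee with the rate `β / μ`. -/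
theorem noLocalSteps_guarantee {Ξ Ω : Type*} [MeasurableSpace Ξ] [MeasurableSpace Ω]
    {P : Measure Ω} [IsProbabilityMeasure P] {D : Fin n → Measure Ξ}
    [∀ i, IsProbabilityMeasure (D i)] {W : ℕ → ℕ → Ω → Bool × (Fin n → Ξ)}
    {f : Fin n → Z m d → ℝ} {Ghat : Fin n → Z m d → Ξ → Z m d} {z0 zs : Z m d}
    (hn : 0 < n) (hp : 0 < (p : ℝ)) (hμ : 0 < μ) (hμβ : μ ≤ β) (hε : 0 < ε)
    (hs : ∀ i, IsSmooth β (f i)) (hc : ∀ i, IsStronglyConvexConcave μ (f i))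
    (hO : ∀ i, IsOracle σ (f i) (D i) (Ghat i)) (hzs : IsMinimaxOptimal (global f) zs)
    (hR : ‖z0 - zs‖ ≤ R) (hW : IsDriver p D P W) :
    IsAccurate f Ghat (paramsNoLocalSteps p β μ ε R hp (hμ.trans_le hμβ)) z0 zs P W μ ε :=
  isAccurate_of_contractsPotential (lam := 1 / 2) (r := 1 - p / 576) (b := 0) (A := 4) hn hμ hμβ
    hε hs hc hO hzs hR hW (by norm_num) (by linarith [p.2.2]) (by linarith) le_rfl (by norm_num)
    rfl (fun u _ hs' => norm_avg_iter_sub_sq_le_of_no_localSteps hn u hs')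
    (fun _ hJ => contractsPotential_of_no_localSteps hn hp hμ hμβ hs hc
      (fun i => (hO i).measurable) (measurable_gradMap_global hn (hμ.le.trans hμβ) hs) hJ rfl rfl
      rfl)
    (accuracy_noLocalSteps hp hμ hμβ hε) (meta_accuracy_noLocalSteps hp hμ hμβ hε)

/-- The guarantee with the rate `localRate`. -/
theorem equalStepsizes_guarantee {ζ : ℝ} (hn : 0 < n) (hp : 0 < (p : ℝ)) (hμ : 0 < μ)
    (hμβ : μ ≤ β) (hσ : 0 ≤ σ) (hζ : 0 ≤ ζ) (hε : 0 < ε) :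
    ∃ c : CatalystParams, c.T = 1 ∧
      c.K * (p : ℝ) ≤ 1600 * Real.log (logArg β μ ε R) ^ 2 * localRate n p β μ σ ζ ε ∧
      ∀ {m d : ℕ} {Ξ Ω : Type*} [MeasurableSpace Ξ] [MeasurableSpace Ω]
        {P : Measure Ω} [IsProbabilityMeasure P] {D : Fin n → Measure Ξ}
        [∀ i, IsProbabilityMeasure (D i)] {W : ℕ → ℕ → Ω → Bool × (Fin n → Ξ)}
        {f : Fin n → Z m d → ℝ} {Ghat : Fin n → Z m d → Ξ → Z m d} {z0 zs : Z m d},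
        (∀ i, IsSmooth β (f i)) → (∀ i, IsStronglyConvexConcave μ (f i)) →
        (∀ i j z, ‖gradMap (f i) z - gradMap (f j) z‖ ≤ ζ) →
        (∀ i, IsOracle σ (f i) (D i) (Ghat i)) → IsMinimaxOptimal (global f) zs →
        ‖z0 - zs‖ ≤ R → IsDriver p D P W → IsAccurate f Ghat c z0 zs P W μ ε := by
  have hβ : 0 < β := hμ.trans_le hμβ
  have hpB := le_localRate hn hp hμ hμβ hσ hζ hε
  have hB1 := (localRate_bounds hn hp hμ hμβ hσ hζ hε).1
  have hS := three_le_logArg (R := R) hμ hμβ hε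
  have hl := one_le_log_logArg (R := R) hμ hμβ hε
  have hsq := sq_add_le_mul_logArg (R := R) hμ hμβ hε
  set B := localRate n p β μ σ ζ ε with hB
  set S := logArg β μ ε R
  set l := Real.log S with hldef
  have hB0 : 0 < B := hp.trans_le hpB
  have hS0 : 0 < S := by linarith
  set γ := p / (128 * μ * B) with hγdef
  have hγ0 : 0 < γ := by positivity
  have hγμ : γ * μ = p / (128 * B) := by rw [hγdef]; field_simp
  have hγμ0 : 0 < γ * μ := by positivity
  have hγμ1 : γ * μ ≤ 1 := by
    rw [hγμ, div_le_one (by positivity)]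
    linarith
  -- The summand `pβ²/μ²` of the rate is there for this stepsize condition.
  have hγβ : γ ≤ μ / (4 * (2 * β) ^ 2) := by
    rw [hγdef, div_le_div_iff₀ (by positivity) (by positivity)]
    rw [div_le_iff₀ (by positivity)] at hB1
    nlinarith [mul_pos hB0 (pow_pos hμ 2)]
  have hK := one_sub_pow_ceil_le (x := γ * μ / 2) (by positivity) (by linarith) hS0 6
  refine ⟨paramsEqualStepsizes γ μ S hγ0 hμ hγμ1, rfl, ?_, ?_⟩
  · have hKle : ((paramsEqualStepsizes γ μ S hγ0 hμ hγμ1).K : ℝ) ≤ 1600 * l * B / p := by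
      refine ceil_div_le (by positivity) (by positivity) ?_
      have : ((6 : ℕ) : ℝ) * l / (γ * μ / 2) + 1 = (1536 * l * B + p) / p := by
        rw [hγμ]; push_cast; field_simp; ring
      rw [this]
      gcongr
      nlinarith [mul_le_mul_of_nonneg_right hl hB0.le]
    have h1 := (le_div_iff₀ hp).1 hKle
    have h2 : l * B ≤ l ^ 2 * B := by
      gcongr
      nlinarith
    linarith
  · intro m d Ξ Ω _ _ P _ D _ W f Ghat z0 zs hs hc hhet hO hzs hR hW
    have hlam : 0 ≤ 8 * γ * (2 * β) ^ 2 / (μ * p) := by positivity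
    have hp1 : (p : ℝ) ≤ 1 := p.2.2
    refine isAccurate_of_contractsPotential (lam := 8 * γ * (2 * β) ^ 2 / (μ * p))
      (r := 1 - γ * μ / 2) (b := 4 * γ ^ 2 * σ ^ 2 / n + 8 * γ * (2 * β) ^ 2 / (μ * p)
        * (16 * γ ^ 2 * ζ ^ 2 / p + 4 * γ ^ 2 * σ ^ 2)) (A := 1) hn hμ hμβ
      hε hs hc hO hzs hR hW hlam (by linarith) (by linarith) (by positivity) zero_le_one
      rfl (fun u _ hs' => norm_avg_iter_sub_sq_le_of_equal_stepsizes hn hlam u hs')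
      (fun _ hJ => contractsPotential_of_equal_stepsizes hn hp hμ hμβ hs hc hhet hO
        (measurable_gradMap_global hn hβ.le hs) hJ rfl rfl rfl hγ0.le hγβ) ?_ ?_
    · have e1 : (paramsEqualStepsizes γ μ S hγ0 hμ hγμ1).K
        = ⌈(6 : ℕ) * Real.log S / (γ * μ / 2)⌉₊ := rfl
      have e2 : (paramsEqualStepsizes γ μ S hγ0 hμ hγμ1).θ = 0 := rfl
      have e3 : (μ / (2 * (0 + μ))) ^ 2 * ε = ε / 4 := by field_simp; ring
      have hst := stationary_error_le hn hp hμ hμβ hσ hζ hε hγdef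
      rw [e1, e2, e3, one_mul]
      -- The exponent 6 in `K` leaves `8ε/S⁵ ≤ 8ε/3⁵`. Together with the stationary error, `1/30 +
      -- 9/64` is below the `1/4` required when `θ = 0`.
      have h1 : 8 * 1 * (1 - γ * μ / 2) ^ ⌈(6 : ℕ) * Real.log S / (γ * μ / 2)⌉₊ * (R ^ 2 + ε)
          ≤ ε / 30 := by
        calc _ ≤ 8 * 1 * (S ^ 6)⁻¹ * (ε * S) := by gcongr
          _ = 8 * ε / S ^ 5 := by field_simp
          _ ≤ 8 * ε / 3 ^ 5 := by gcongr
          _ ≤ _ := by linarith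
      linarith
    · have e2 : (paramsEqualStepsizes γ μ S hγ0 hμ hγμ1).θ = 0 := rfl
      have e3 : (paramsEqualStepsizes γ μ S hγ0 hμ hγμ1).T = 1 := rfl
      rw [e2, e3]
      -- Without regularization the proximal point is the saddle point itself, so one meta-iteration
      -- has contraction factor 0.
      simp only [zero_div, pow_one, zero_mul]
      positivity

lemma logFactor_eq (C : ℝ) (q : ℕ) :
    logFactor C q β μ ε R = ENNReal.ofReal (C * Real.log (logArg β μ ε R) ^ q) :=
  rfl

lemma expectedRounds_le {Ξ Ω : Type*} [MeasurableSpace Ξ] [MeasurableSpace Ω] {P : Measure Ω}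
    {D : Fin n → Measure Ξ} [∀ i, IsProbabilityMeasure (D i)]
    {W : ℕ → ℕ → Ω → Bool × (Fin n → Ξ)} (hW : IsDriver p D P W) {c : CatalystParams} {C B : ℝ}
    {q : ℕ} (hC : 0 ≤ C * Real.log (logArg β μ ε R) ^ q)
    (h : c.T * (c.K * (p : ℝ)) ≤ C * Real.log (logArg β μ ε R) ^ q * B) :
    expectedRounds c P W ≤ logFactor C q β μ ε R * ENNReal.ofReal B := by
  rw [expectedRounds_eq hW, logFactor_eq, ← ENNReal.ofReal_mul hC]
  exact ENNReal.ofReal_le_ofReal h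

lemma add_expectedRounds_le {Ξ Ω : Type*} [MeasurableSpace Ξ] [MeasurableSpace Ω] {P : Measure Ω}
    {D : Fin n → Measure Ξ} [∀ i, IsProbabilityMeasure (D i)]
    {W : ℕ → ℕ → Ω → Bool × (Fin n → Ξ)} (hW : IsDriver p D P W) {c : CatalystParams} {C B : ℝ}
    {q : ℕ} (hC : 0 ≤ C * Real.log (logArg β μ ε R) ^ q)
    (h : c.T + c.T * (c.K * (p : ℝ)) ≤ C * Real.log (logArg β μ ε R) ^ q * B) :
    c.T + expectedRounds c P W ≤ logFactor C q β μ ε R * ENNReal.ofReal B := by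
  have hp : 0 ≤ (p : ℝ) := p.2.1
  rw [expectedRounds_eq hW, logFactor_eq, ← ENNReal.ofReal_mul hC, ← ENNReal.ofReal_natCast,
    ← ENNReal.ofReal_add (by positivity) (by positivity)]
  exact ENNReal.ofReal_le_ofReal h

lemma rate_eq_of_ne_top {ζ : ℝ≥0∞} (hζ : ζ ≠ ⊤) (hp : 0 ≤ (p : ℝ)) (hμ : 0 < μ) (hμβ : μ ≤ β)
    (hσ : 0 ≤ σ) (hε : 0 < ε) :
    rate n p β μ σ ζ ε
      = min (ENNReal.ofReal (β / μ)) (ENNReal.ofReal (localRate n p β μ σ ζ.toReal ε)) := by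
  have hβ : 0 < β := hμ.trans_le hμβ
  unfold rate localRate
  rw [ENNReal.ofReal_add (p := p * β ^ 2 / μ ^ 2 + p * σ ^ 2 / (n * μ ^ 2 * ε)
    + √p * β * σ / (μ ^ 2 * √ε)) (by positivity) (by positivity),
    ENNReal.ofReal_mul (by positivity) (q := ζ.toReal), ENNReal.ofReal_toReal hζ]

lemma rate_top (hμ : 0 < μ) (hμβ : μ ≤ β) (hε : 0 < ε) :
    rate n p β μ σ ⊤ ε = ENNReal.ofReal (β / μ) := by
  have hβ : 0 < β := hμ.trans_le hμβ
  have h : ENNReal.ofReal (β / (μ ^ 2 * √ε)) ≠ 0 :=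
    (ENNReal.ofReal_pos.2 (by positivity)).ne'
  unfold rate
  rw [ENNReal.mul_top h, add_top, min_eq_left le_top]

lemma IsHeterogeneous.norm_sub_le {ζ : ℝ≥0∞} (hζ : ζ ≠ ⊤) {f : Fin n → Z m d → ℝ}
    (h : IsHeterogeneous ζ f) (i j : Fin n) (z : Z m d) :
    ‖gradMap (f i) z - gradMap (f j) z‖ ≤ ζ.toReal := by
  have h1 : ‖gradMap (f i) z - gradMap (f j) z‖ₑ ≤ ζ :=
    (ENNReal.pow_le_pow_left_iff two_ne_zero).1 (h i j z)
  rw [← toReal_enorm]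
  exact ENNReal.toReal_mono hζ h1

end Main

end FedMinimax

end

theorem theorem3 :
    ∃ (C : ℝ) (q : ℕ), 0 < C ∧
      -- the numbers on which the choice of the parameters may depend
      ∀ (n : ℕ) (p : unitInterval) (β μ σ ε R : ℝ) (ζ : ℝ≥0∞),
        0 < n → 0 < (p : ℝ) → 0 < μ → μ ≤ β → 0 ≤ σ → 0 < ε → 0 ≤ R →
        ∃ c : FedMinimax.CatalystParams,
          -- the problem, the stochastic oracles, the initial point, and the randomness
          ∀ (m d : ℕ) (f : Fin n → FedMinimax.Z m d → ℝ)
            (Ξ : Type*) [MeasurableSpace Ξ] (D : Fin n → Measure Ξ)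
            [∀ i, IsProbabilityMeasure (D i)]
            (Ghat : Fin n → FedMinimax.Z m d → Ξ → FedMinimax.Z m d)
            (zs z0 : FedMinimax.Z m d)
            (Ω : Type*) [MeasurableSpace Ω] (P : Measure Ω) [IsProbabilityMeasure P]
            (W : ℕ → ℕ → Ω → Bool × (Fin n → Ξ)),
            (∀ i, FedMinimax.IsSmooth β (f i)) →
            (∀ i, FedMinimax.IsStronglyConvexConcave μ (f i)) →
            FedMinimax.IsHeterogeneous ζ f →
            (∀ i, FedMinimax.IsOracle σ (f i) (D i) (Ghat i)) →
            FedMinimax.IsMinimaxOptimal (FedMinimax.global f) zs →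
            ‖z0 - zs‖ ≤ R →
            FedMinimax.IsDriver p D P W →
            -- every subproblem is solved to the prescribed accuracy
            (∀ prox : FedMinimax.Z m d → FedMinimax.Z m d,
              (∀ u, FedMinimax.IsMinimaxOptimal
                (FedMinimax.regularize c.θ u (FedMinimax.global f)) (prox u)) →
              ∀ t < c.T,
                Integrable (fun ω => ‖FedMinimax.metaIterate f Ghat c z0 W (t + 1) ω
                  - prox (FedMinimax.metaIterate f Ghat c z0 W t ω)‖ ^ 2) P ∧
                ∫ ω, ‖FedMinimax.metaIterate f Ghat c z0 W (t + 1) ω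
                  - prox (FedMinimax.metaIterate f Ghat c z0 W t ω)‖ ^ 2 ∂P
                  ≤ (μ / (2 * (c.θ + μ))) ^ 2 * ε) ∧
            -- the output has the accuracy `ε`
            Integrable (fun ω => ‖FedMinimax.metaIterate f Ghat c z0 W c.T ω - zs‖ ^ 2) P ∧
            ∫ ω, ‖FedMinimax.metaIterate f Ghat c z0 W c.T ω - zs‖ ^ 2 ∂P ≤ ε ∧
            -- the expected number of synchronizations
            FedMinimax.expectedRounds c P W ≤
              FedMinimax.logFactor C q β μ ε R * FedMinimax.rate n p β μ σ ζ ε ∧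
            -- the same, if one communication per meta-iteration is counted as well
            c.T + FedMinimax.expectedRounds c P W ≤
              FedMinimax.logFactor C q β μ ε R * max 1 (FedMinimax.rate n p β μ σ ζ ε) := by
  refine ⟨30000, 2, by norm_num, ?_⟩
  intro n p β μ σ ε R ζ hn hp hμ hμβ hσ hε _
  have hβ : 0 < β := hμ.trans_le hμβ
  have hl := FedMinimax.one_le_log_logArg (R := R) hμ hμβ hε
  have hC : 0 ≤ 30000 * Real.log (FedMinimax.logArg β μ ε R) ^ 2 := by positivity
  -- Infinite heterogeneity makes the second term of the rate infinite, so it goes to the case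
  -- without local steps.
  by_cases hcase : ζ ≠ ⊤ ∧ FedMinimax.localRate n p β μ σ ζ.toReal ε ≤ β / μ
  · obtain ⟨hζ, hle⟩ := hcase
    obtain ⟨c, hT, hK, hacc⟩ := FedMinimax.equalStepsizes_guarantee (R := R) hn hp hμ hμβ hσ
      ζ.toReal_nonneg hε
    have hB0 : 0 < FedMinimax.localRate n p β μ σ ζ.toReal ε :=
      hp.trans_le (FedMinimax.le_localRate hn hp hμ hμβ hσ ζ.toReal_nonneg hε)
    have hrate := FedMinimax.rate_eq_of_ne_top (n := n) hζ hp.le hμ hμβ hσ hε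
    rw [min_eq_right (ENNReal.ofReal_le_ofReal hle)] at hrate
    refine ⟨c, fun m d f Ξ _ D _ Ghat zs z0 Ω _ P _ W hs hc hhet hO hzs hR hW => ?_⟩
    obtain ⟨h1, h2, h3⟩ := hacc hs hc (hhet.norm_sub_le hζ) hO hzs hR hW
    refine ⟨h1, h2, h3, ?_, ?_⟩
    · rw [hrate]
      refine FedMinimax.expectedRounds_le hW hC ?_
      rw [hT, Nat.cast_one, one_mul]
      refine hK.trans ?_
      gcongr
      norm_num
    · rw [hrate, ← ENNReal.ofReal_one, ← ENNReal.ofReal_max]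
      refine FedMinimax.add_expectedRounds_le hW hC ?_
      rw [hT, Nat.cast_one, one_mul]
      set B := FedMinimax.localRate n p β μ σ ζ.toReal ε
      -- `B` may be below 1, so the single meta-iteration is charged to the 1 in the maximum.
      have hm1 : 1 ≤ max 1 B := le_max_left _ _
      have hl2 : 1 ≤ Real.log (FedMinimax.logArg β μ ε R) ^ 2 := one_le_pow₀ hl
      have h4 : 1600 * Real.log (FedMinimax.logArg β μ ε R) ^ 2 * B
          ≤ 1600 * Real.log (FedMinimax.logArg β μ ε R) ^ 2 * max 1 B := by
        gcongr
        exact le_max_right _ _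
      have h5 := one_le_mul_of_one_le_of_one_le hl2 hm1
      linarith
  · have hrate : FedMinimax.rate n p β μ σ ζ ε = ENNReal.ofReal (β / μ) := by
      by_cases hζ : ζ = ⊤
      · rw [hζ, FedMinimax.rate_top hμ hμβ hε]
      · rw [FedMinimax.rate_eq_of_ne_top hζ hp.le hμ hμβ hσ hε]
        exact min_eq_left (ENNReal.ofReal_le_ofReal
          (not_le.1 fun h => hcase ⟨hζ, h⟩).le)
    have hrounds := FedMinimax.rounds_noLocalSteps (R := R) hp hμ hμβ hε
    refine ⟨FedMinimax.paramsNoLocalSteps p β μ ε R hp hβ,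
      fun m d f Ξ _ D _ Ghat zs z0 Ω _ P _ W hs hc _ hO hzs hR hW => ?_⟩
    obtain ⟨h1, h2, h3⟩ := FedMinimax.noLocalSteps_guarantee hn hp hμ hμβ hε hs hc hO hzs hR hW
    refine ⟨h1, h2, h3, ?_, ?_⟩
    · rw [hrate]
      exact FedMinimax.expectedRounds_le hW hC (le_trans (by simp) hrounds)
    · rw [hrate]
      exact (FedMinimax.add_expectedRounds_le hW hC hrounds).trans
        (by gcongr; exact le_max_right _ _)
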